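/- Let $n_1,n_2\ge 1$ and let $\Omega_i\subset\mathbb{R}^{n_i}$ ($i=1,2$) be nonempty bounded open sets. All functions are real-valued. For $s\ge 0$ let $H^s(\Omega_i)$ be the Hilbert space of restrictions to $\Omega_i$ of functions in $H^s(\mathbb{R}^{n_i})$, with the quotient norm $\|u\|=\inf\{\|U\|_{H^s(\mathbb{R}^{n_i})}: U|_{\Omega_i}=u\}$ (for smooth domains this is the usual Sobolev space, with an equivalent norm), and let $H^{s_1,s_2}_{mix}(\Omega_1\times\Omega_2)=H^{s_1}(\Omega_1)\otimes H^{s_2}(\Omega_2)$ be the Hilbert space tensor product, a subspace of $L^2(\Omega_1\times\Omega_2)$. For $i=1,2$ let $r_i\ge 1$ be an integer and let $V^{(i)}_0\subset V^{(i)}_1\subset\cdots\subset L^2(\Omega_i)$ be finite-dimensional spaces with dense union and $\dim V^{(i)}_j\sim 2^{jn_i}$, consisting of piecewise polynomials of exactness $r_i$ with respect to meshes of width $h_j=2^{-j}$. That is, for every $j$ there is a finite partition of $\Omega_i$, up to null sets, into measurable cells of diameter $\lesssim 2^{-j}$, each containing a ball of radius $\gtrsim 2^{-j}$ (uniformly in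 $j$), such that on every cell each function of $V^{(i)}_j$ is a polynomial of degree less than $r_i$ in each variable, and every polynomial of total degree less than $r_i$ is the restriction to the cell of some function of $V^{(i)}_j$. Assume the approximation property $$\inf_{v\in V^{(i)}_j}\|u-v\|_{L^2(\Omega_i)}\lesssim 2^{-jt}\|u\|_{H^t(\Omega_i)},\qquad u\in H^t(\Omega_i),\quad 0\le t\le r_i,$$ uniformly in $j$ and $u$. A function $f\in L^2(\Omega_1\times\Omega_2)$ has a singular value decomposition $f=\sum_{k\ge 0}\sigma_k\,u_k\otimes v_k$ with $\sigma_0\ge\sigma_1\ge\dots\ge 0$ and orthonormal systems $(u_k)$ and $(v_k)$. A fully discrete truncated singular value decomposition of $f$ is a sum $\sum_{k<R}\sigma_k\,u_k'\otimes v_k'$ in which the singular functions are replaced by approximations $u_k'\in V^{(1)}_{j_1}$ and $v_k'\in V^{(2)}_{j_2}$ from single-scale spaces of fixed levels $j_1,j_2$; it has $R\,(\dim V^{(1)}_{j_1}+\dim V^{(2)}_{j_2})$ degrees of freedom. For $s_1,s_2>0$ let $\operatorname{dof}_{svd}(\varepsilon)$ be the smallest number of degrees of freedom that suffices to approximate any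 $f$ in the unit ball of $H^{s_1,s_2}_{mix}(\Omega_1\times\Omega_2)$ with $L^2(\Omega_1\times\Omega_2)$-error at most $\varepsilon$ (that is, the supremum over these $f$ of the minimal number of degrees of freedom for $f$, over all $R,j_1,j_2$ and all singular value decompositions of $f$), where $u_k'$ and $v_k'$ are the best $L^2$-approximations of $u_k$ and $v_k$. Let $\operatorname{dof}^{*}_{svd}(\varepsilon)\le\operatorname{dof}_{svd}(\varepsilon)$ be the same number when $u_k'\in V^{(1)}_{j_1}$ and $v_k'\in V^{(2)}_{j_2}$ may be chosen arbitrarily. Then, for all $s_1,s_2>0$, as $\varepsilon\to 0$, $$\operatorname{dof}^{*}_{svd}(\varepsilon)\sim\operatorname{dof}_{svd}(\varepsilon)\sim\varepsilon^{-\frac{n_1n_2}{s_1n_2+s_2n_1}}\;\varepsilon^{-\max\left\{\frac{n_1}{\min\{s_1,r_1\}},\frac{n_2}{\min\{s_2,r_2\}}\right\}},$$ that is, there are constants $c,C,\varepsilon_0>0$, independent of $\varepsilon$, such that both numbers lie between $c$ times and $C$ times the right-hand side for all $0<\varepsilon\le\varepsilon_0$. -/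

import Mathlib

open MeasureTheory TemperedDistribution
open scoped ENNReal TensorProduct

noncomputable section

namespace LowRank

/-! ### Sobolev spaces -/

/-- `ℝⁿ` with the Euclidean norm. -/
abbrev Eucl (n : ℕ) : Type := EuclideanSpace ℝ (Fin n)

/-- The real Hilbert space `L²(Ω)`. -/
abbrev L2 {n : ℕ} (Ω : Set (Eucl n)) : Type := Lp ℝ 2 (volume.restrict Ω)

/-- The real Hilbert space `L²(Ω₁ × Ω₂)`. -/
abbrev L2prod {n₁ n₂ : ℕ} (Ω₁ : Set (Eucl n₁)) (Ω₂ : Set (Eucl n₂)) : Type :=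
  Lp ℝ 2 ((volume.restrict Ω₁).prod (volume.restrict Ω₂))

/-- A real `L²` function on `ℝⁿ`, seen as a complex-valued tempered distribution. -/
def toDistribution (n : ℕ) :
    Lp ℝ 2 (volume : Measure (Eucl n)) →ₗ[ℝ] TemperedDistribution (Eucl n) ℂ where
  toFun U := Lp.toTemperedDistribution (Complex.ofRealCLM.compLp U)
  map_add' U V := by
    simp only [← Lp.toTemperedDistributionCLM_apply]
    rw [← map_add]
    congr 1
    exact (Complex.ofRealCLM.compLpL 2 (volume : Measure (Eucl n))).map_add U V
  map_smul' c U := by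
    simp only [← Lp.toTemperedDistributionCLM_apply]
    have h : Complex.ofRealCLM.compLp (c • U) = (c : ℂ) • Complex.ofRealCLM.compLp U := by
      have := (Complex.ofRealCLM.compLpL 2 (volume : Measure (Eucl n))).map_smul c U
      refine this.trans ?_
      rfl
    rw [h, map_smul]
    rfl

/-- The functions in `L²(ℝⁿ)` that belong to the Sobolev space of order `s`. -/
def sobolevSubmodule (n : ℕ) (s : ℝ) : Submodule ℝ (Lp ℝ 2 (volume : Measure (Eucl n))) where
  carrier := {U | MemSobolev s 2 (toDistribution n U)}
  add_mem' {U V} hU hV := by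
    have := MemSobolev.add hU hV
    rwa [← map_add] at this
  zero_mem' := by
    have := memSobolev_fun_zero (Eucl n) ℂ s 2
    rwa [← map_zero (toDistribution n)] at this
  smul_mem' c U hU := by
    have := MemSobolev.smul (c : ℂ) hU
    have h : toDistribution n (c • U) = (c : ℂ) • toDistribution n U := by
      rw [map_smul]
      rfl
    change MemSobolev s 2 (toDistribution n (c • U))
    rwa [h]

/-- The Sobolev space `Hˢ(ℝⁿ)` of real functions, `s ≥ 0`. It does not carry the norm of `L²`, but
the norm `‖U‖ = ‖(1 + |ξ|²)^{s/2} 𝓕U‖_{L²}`, which is installed below. -/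
def HsRn (n : ℕ) (s : ℝ) : Type := sobolevSubmodule n s

instance (n : ℕ) (s : ℝ) : AddCommGroup (HsRn n s) :=
  inferInstanceAs (AddCommGroup (sobolevSubmodule n s))

instance (n : ℕ) (s : ℝ) : Module ℝ (HsRn n s) :=
  inferInstanceAs (Module ℝ (sobolevSubmodule n s))

/-- The inclusion `Hˢ(ℝⁿ) ⊂ L²(ℝⁿ)`. -/
def HsRn.incl (n : ℕ) (s : ℝ) : HsRn n s →ₗ[ℝ] Lp ℝ 2 (volume : Measure (Eucl n)) :=
  (sobolevSubmodule n s).subtype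

theorem toTemperedDistribution_injective (n : ℕ) :
    Function.Injective
      (Lp.toTemperedDistributionCLM ℂ (volume : Measure (Eucl n)) 2) :=
  LinearMap.ker_eq_bot.mp Lp.ker_toTemperedDistributionCLM_eq_bot

/-- The `L²` function `𝓕⁻¹ (1 + |ξ|²)^{s/2} 𝓕U`, for `U ∈ Hˢ(ℝⁿ)`. -/
def HsRn.potentialFun {n : ℕ} {s : ℝ} (U : HsRn n s) : Lp ℂ 2 (volume : Measure (Eucl n)) :=
  Classical.choose U.2

theorem HsRn.potentialFun_spec {n : ℕ} {s : ℝ} (U : HsRn n s) :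
    besselPotential (Eucl n) ℂ s (toDistribution n (HsRn.incl n s U)) =
      Lp.toTemperedDistributionCLM ℂ (volume : Measure (Eucl n)) 2 (HsRn.potentialFun U) :=
  Classical.choose_spec U.2

/-- The map `U ↦ 𝓕⁻¹ (1 + |ξ|²)^{s/2} 𝓕U` from `Hˢ(ℝⁿ)` to `L²(ℝⁿ)`. -/
def HsRn.potential (n : ℕ) (s : ℝ) : HsRn n s →ₗ[ℝ] Lp ℂ 2 (volume : Measure (Eucl n)) where
  toFun := HsRn.potentialFun
  map_add' U V := by
    apply toTemperedDistribution_injective n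
    rw [map_add, ← HsRn.potentialFun_spec, ← HsRn.potentialFun_spec, ← HsRn.potentialFun_spec,
      map_add, map_add, map_add]
  map_smul' c U := by
    apply toTemperedDistribution_injective n
    have h : toDistribution n (HsRn.incl n s (c • U)) =
        (c : ℂ) • toDistribution n (HsRn.incl n s U) := by
      rw [map_smul, map_smul]
      rfl
    have h' : (RingHom.id ℝ) c • HsRn.potentialFun U = (c : ℂ) • HsRn.potentialFun U := rfl
    rw [h', map_smul, ← HsRn.potentialFun_spec, ← HsRn.potentialFun_spec, h, map_smul]

theorem HsRn.potential_injective (n : ℕ) (s : ℝ) : Function.Injective (HsRn.potential n s) := by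
  intro U V h
  have h1 : toDistribution n (HsRn.incl n s U) = toDistribution n (HsRn.incl n s V) := by
    have e : besselPotential (Eucl n) ℂ s (toDistribution n (HsRn.incl n s U)) =
        besselPotential (Eucl n) ℂ s (toDistribution n (HsRn.incl n s V)) := by
      rw [HsRn.potentialFun_spec, HsRn.potentialFun_spec]
      exact congrArg _ h
    have e' := congrArg (besselPotential (Eucl n) ℂ (-s)) e
    simpa using e'
  have h2 := toTemperedDistribution_injective n h1
  apply Subtype.ext
  change HsRn.incl n s U = HsRn.incl n s V
  have hU := Complex.ofRealCLM.coeFn_compLp (HsRn.incl n s U)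
  have hV := Complex.ofRealCLM.coeFn_compLp (HsRn.incl n s V)
  apply Lp.ext
  rw [h2] at hU
  filter_upwards [hU, hV] with x hx hy
  have := hx.symm.trans hy
  simpa using this

instance (n : ℕ) (s : ℝ) : NormedAddCommGroup (HsRn n s) :=
  NormedAddCommGroup.induced (HsRn n s) (Lp ℂ 2 (volume : Measure (Eucl n)))
    (HsRn.potential n s) (HsRn.potential_injective n s)

theorem HsRn.norm_def {n : ℕ} {s : ℝ} (U : HsRn n s) : ‖U‖ = ‖HsRn.potential n s U‖ := rfl

instance (n : ℕ) (s : ℝ) : InnerProductSpace ℝ (HsRn n s) where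
  inner U V := inner ℝ (HsRn.potential n s U) (HsRn.potential n s V)
  norm_smul_le c U := by
    rw [HsRn.norm_def, HsRn.norm_def, map_smul, norm_smul]
  norm_sq_eq_re_inner U := by
    rw [HsRn.norm_def]
    exact norm_sq_eq_re_inner (𝕜 := ℝ) _
  conj_inner_symm U V := inner_conj_symm _ _
  add_left U V W := by rw [map_add]; exact inner_add_left _ _ _
  smul_left U V c := by rw [map_smul]; exact inner_smul_left _ _ _

/-- The restriction map `Hˢ(ℝⁿ) → L²(Ω)`. -/
def HsRn.restrict {n : ℕ} (Ω : Set (Eucl n)) (s : ℝ) : HsRn n s →ₗ[ℝ] L2 Ω :=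
  (LpToLpRestrictCLM (Eucl n) ℝ ℝ volume 2 Ω).toLinearMap ∘ₗ HsRn.incl n s

/-- The Sobolev space `Hˢ(Ω)`, `s ≥ 0`, of the restrictions to `Ω` of functions in `Hˢ(ℝⁿ)`, with
the norm `‖u‖ = inf {‖U‖ : U ∈ Hˢ(ℝⁿ), U = u on Ω}`. This is the Hilbert space quotient of
`Hˢ(ℝⁿ)` by the closed subspace of all functions that vanish on `Ω`; as usual, it is realized as the
orthogonal complement of that subspace, so that `u` is represented by its extension
of smallest norm. The function on `Ω` itself is `Hs.toL2 u`. -/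
def Hs {n : ℕ} (Ω : Set (Eucl n)) (s : ℝ) : Type :=
  ((LinearMap.ker (HsRn.restrict Ω s))ᗮ : Submodule ℝ (HsRn n s))

instance {n : ℕ} (Ω : Set (Eucl n)) (s : ℝ) : NormedAddCommGroup (Hs Ω s) :=
  inferInstanceAs
    (NormedAddCommGroup ((LinearMap.ker (HsRn.restrict Ω s))ᗮ : Submodule ℝ (HsRn n s)))

instance {n : ℕ} (Ω : Set (Eucl n)) (s : ℝ) : InnerProductSpace ℝ (Hs Ω s) :=
  inferInstanceAs
    (InnerProductSpace ℝ ((LinearMap.ker (HsRn.restrict Ω s))ᗮ : Submodule ℝ (HsRn n s)))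

/-- The inclusion `Hˢ(Ω) ⊂ L²(Ω)`. -/
def Hs.toL2 {n : ℕ} (Ω : Set (Eucl n)) (s : ℝ) : Hs Ω s →ₗ[ℝ] L2 Ω :=
  HsRn.restrict Ω s ∘ₗ ((LinearMap.ker (HsRn.restrict Ω s))ᗮ).subtype

/-! ### Tensor products -/

/-- The function `u ⊗ v : (x, y) ↦ u(x) v(y)`. -/
def tensorFun {X Y : Type*} [MeasurableSpace X] [MeasurableSpace Y] {μ : Measure X}
    {ν : Measure Y} [SigmaFinite μ] [SigmaFinite ν] (u : Lp ℝ 2 μ) (v : Lp ℝ 2 ν) :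
    Lp ℝ 2 (μ.prod ν) :=
  MemLp.toLp (fun p : X × Y => u p.1 * v p.2) (by
    have hm : AEStronglyMeasurable (fun p : X × Y => u p.1 * v p.2) (μ.prod ν) :=
      (Lp.aestronglyMeasurable u).comp_fst.mul (Lp.aestronglyMeasurable v).comp_snd
    rw [memLp_two_iff_integrable_sq hm]
    have h := ((memLp_two_iff_integrable_sq (Lp.aestronglyMeasurable u)).mp (Lp.memLp u)).mul_prod
      ((memLp_two_iff_integrable_sq (Lp.aestronglyMeasurable v)).mp (Lp.memLp v))
    refine h.congr (Filter.Eventually.of_forall fun p => ?_)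
    simp only [mul_pow])

theorem coeFn_tensorFun {X Y : Type*} [MeasurableSpace X] [MeasurableSpace Y] {μ : Measure X}
    {ν : Measure Y} [SigmaFinite μ] [SigmaFinite ν] (u : Lp ℝ 2 μ) (v : Lp ℝ 2 ν) :
    tensorFun u v =ᵐ[μ.prod ν] fun p => u p.1 * v p.2 :=
  MemLp.coeFn_toLp _

/-- The bilinear map `(u, v) ↦ u ⊗ v`. -/
def tensorBilin {X Y : Type*} [MeasurableSpace X] [MeasurableSpace Y] (μ : Measure X)
    (ν : Measure Y) [SigmaFinite μ] [SigmaFinite ν] :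
    Lp ℝ 2 μ →ₗ[ℝ] Lp ℝ 2 ν →ₗ[ℝ] Lp ℝ 2 (μ.prod ν) :=
  LinearMap.mk₂ ℝ tensorFun
    (fun u u' v => by
      apply Lp.ext
      filter_upwards [coeFn_tensorFun (u + u') v, coeFn_tensorFun u v, coeFn_tensorFun u' v,
        Lp.coeFn_add (tensorFun u v) (tensorFun u' v),
        Measure.quasiMeasurePreserving_fst.ae (Lp.coeFn_add u u')] with p h1 h2 h3 h4 h5
      rw [h1, h4, Pi.add_apply, h2, h3, h5, Pi.add_apply, add_mul])
    (fun c u v => by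
      apply Lp.ext
      filter_upwards [coeFn_tensorFun (c • u) v, coeFn_tensorFun u v,
        Lp.coeFn_smul c (tensorFun u v),
        Measure.quasiMeasurePreserving_fst.ae (Lp.coeFn_smul c u)] with p h1 h2 h3 h4
      rw [h1, h3, Pi.smul_apply, h2, h4, Pi.smul_apply, smul_eq_mul, smul_eq_mul, mul_assoc])
    (fun u v v' => by
      apply Lp.ext
      filter_upwards [coeFn_tensorFun u (v + v'), coeFn_tensorFun u v, coeFn_tensorFun u v',
        Lp.coeFn_add (tensorFun u v) (tensorFun u v'),
        Measure.quasiMeasurePreserving_snd.ae (Lp.coeFn_add v v')] with p h1 h2 h3 h4 h5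
      rw [h1, h4, Pi.add_apply, h2, h3, h5, Pi.add_apply, mul_add])
    (fun c u v => by
      apply Lp.ext
      filter_upwards [coeFn_tensorFun u (c • v), coeFn_tensorFun u v,
        Lp.coeFn_smul c (tensorFun u v),
        Measure.quasiMeasurePreserving_snd.ae (Lp.coeFn_smul c v)] with p h1 h2 h3 h4
      rw [h1, h3, Pi.smul_apply, h2, h4, Pi.smul_apply, smul_eq_mul, smul_eq_mul, mul_left_comm])

/-- The space `H_mix^{s₁,s₂}(Ω₁ × Ω₂) = H^{s₁}(Ω₁) ⊗ H^{s₂}(Ω₂)`: the Hilbert space tensor product,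
that is, the completion of the algebraic tensor product with respect to the cross norm
given by `⟪u ⊗ v, u' ⊗ v'⟫ = ⟪u, u'⟫ ⟪v, v'⟫`. -/
abbrev HMix {n₁ n₂ : ℕ} (Ω₁ : Set (Eucl n₁)) (Ω₂ : Set (Eucl n₂)) (s₁ s₂ : ℝ) : Type :=
  UniformSpace.Completion (Hs Ω₁ s₁ ⊗[ℝ] Hs Ω₂ s₂)

/-- The linear map on the algebraic tensor product that sends `u ⊗ v` to the function
`(x, y) ↦ u(x) v(y)`. -/
def algToL2 {n₁ n₂ : ℕ} (Ω₁ : Set (Eucl n₁)) (Ω₂ : Set (Eucl n₂)) (s₁ s₂ : ℝ) :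
    Hs Ω₁ s₁ ⊗[ℝ] Hs Ω₂ s₂ →ₗ[ℝ] L2prod Ω₁ Ω₂ :=
  TensorProduct.lift ((tensorBilin (volume.restrict Ω₁) (volume.restrict Ω₂)).compl₁₂
    (Hs.toL2 Ω₁ s₁) (Hs.toL2 Ω₂ s₂))

theorem inner_tensorFun {X Y : Type*} [MeasurableSpace X] [MeasurableSpace Y] {μ : Measure X}
    {ν : Measure Y} [SigmaFinite μ] [SigmaFinite ν] (u u' : Lp ℝ 2 μ) (v v' : Lp ℝ 2 ν) :
    inner ℝ (tensorFun u v) (tensorFun u' v') = inner ℝ u u' * inner ℝ v v' := by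
  rw [L2.inner_def, L2.inner_def, L2.inner_def, ← integral_prod_mul]
  apply integral_congr_ae
  filter_upwards [coeFn_tensorFun u v, coeFn_tensorFun u' v'] with p h1 h2
  rw [h1, h2]
  simp only [RCLike.inner_apply, conj_trivial]
  ring

theorem norm_lift_tensorBilin {X Y : Type*} [MeasurableSpace X] [MeasurableSpace Y]
    (μ : Measure X) (ν : Measure Y) [SigmaFinite μ] [SigmaFinite ν] (t : Lp ℝ 2 μ ⊗[ℝ] Lp ℝ 2 ν) :
    ‖TensorProduct.lift (tensorBilin μ ν) t‖ = ‖t‖ := by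
  have key : ∀ t t' : Lp ℝ 2 μ ⊗[ℝ] Lp ℝ 2 ν,
      inner ℝ (TensorProduct.lift (tensorBilin μ ν) t) (TensorProduct.lift (tensorBilin μ ν) t') =
        inner ℝ t t' := by
    intro t t'
    induction t with
    | zero => simp
    | add x y hx hy => rw [map_add, inner_add_left, inner_add_left, hx, hy]
    | tmul u v =>
      induction t' with
      | zero => simp
      | add x y hx hy => rw [map_add, inner_add_right, inner_add_right, hx, hy]
      | tmul u' v' =>
        rw [TensorProduct.lift.tmul, TensorProduct.lift.tmul, TensorProduct.inner_tmul]
        exact inner_tensorFun u u' v v'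
  rw [@norm_eq_sqrt_real_inner _ _ _ t, norm_eq_sqrt_real_inner, key]

theorem norm_sum_tmul_sq {E F : Type*} [NormedAddCommGroup E] [InnerProductSpace ℝ E]
    [NormedAddCommGroup F] [InnerProductSpace ℝ F] {ι : Type*} [Fintype ι] (e : ι → E) (f : ι → F)
    (hf : Orthonormal ℝ f) : ‖∑ i, e i ⊗ₜ[ℝ] f i‖ ^ 2 = ∑ i, ‖e i‖ ^ 2 := by
  classical
  rw [← real_inner_self_eq_norm_sq, sum_inner]
  refine Finset.sum_congr rfl fun i _ => ?_
  rw [inner_sum, Finset.sum_eq_single i]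
  · rw [TensorProduct.inner_tmul, real_inner_self_eq_norm_sq, real_inner_self_eq_norm_sq,
      hf.1 i]
    ring
  · intro j _ hj
    rw [TensorProduct.inner_tmul, hf.2 hj.symm, mul_zero]
  · intro h
    exact absurd (Finset.mem_univ i) h

theorem norm_map_id_le {E F G : Type*} [NormedAddCommGroup E] [InnerProductSpace ℝ E]
    [NormedAddCommGroup F] [InnerProductSpace ℝ F] [NormedAddCommGroup G] [InnerProductSpace ℝ G]
    (A : E →ₗ[ℝ] G) (hA : ∀ x, ‖A x‖ ≤ ‖x‖) (t : E ⊗[ℝ] F) :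
    ‖TensorProduct.map A (LinearMap.id : F →ₗ[ℝ] F) t‖ ≤ ‖t‖ := by
  obtain ⟨E', F', iE', iF', hz⟩ :=
    TensorProduct.exists_finite_submodule_of_setFinite {t} (Set.finite_singleton t)
  obtain ⟨y, rfl⟩ := Set.singleton_subset_iff.mp hz
  let f := stdOrthonormalBasis ℝ F'
  obtain ⟨c, hc⟩ := TensorProduct.eq_repr_basis_right f.toBasis y
  have h1 : TensorProduct.mapIncl E' F' y = ∑ i, (c i : E) ⊗ₜ[ℝ] (f i : F) := by
    rw [← hc, Finsupp.sum_fintype _ _ (by simp), map_sum]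
    simp [TensorProduct.mapIncl]
  have hf : Orthonormal ℝ fun i => (f i : F) := by
    have := f.orthonormal.comp_linearIsometry F'.subtypeₗᵢ
    exact this
  rw [h1, map_sum]
  simp only [TensorProduct.map_tmul, LinearMap.id_apply]
  rw [← abs_of_nonneg (norm_nonneg (∑ i, A (c i : E) ⊗ₜ[ℝ] (f i : F))),
    ← abs_of_nonneg (norm_nonneg (∑ i, (c i : E) ⊗ₜ[ℝ] (f i : F))), ← sq_le_sq,
    norm_sum_tmul_sq _ _ hf, norm_sum_tmul_sq _ _ hf]
  exact Finset.sum_le_sum fun i _ => by gcongr; exact hA _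

theorem norm_map_le {E F G H : Type*} [NormedAddCommGroup E] [InnerProductSpace ℝ E]
    [NormedAddCommGroup F] [InnerProductSpace ℝ F] [NormedAddCommGroup G] [InnerProductSpace ℝ G]
    [NormedAddCommGroup H] [InnerProductSpace ℝ H]
    (A : E →ₗ[ℝ] G) (hA : ∀ x, ‖A x‖ ≤ ‖x‖) (B : F →ₗ[ℝ] H) (hB : ∀ x, ‖B x‖ ≤ ‖x‖)
    (t : E ⊗[ℝ] F) : ‖TensorProduct.map A B t‖ ≤ ‖t‖ := by
  have h1 : TensorProduct.map A B t = TensorProduct.comm ℝ H G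
      (TensorProduct.map B LinearMap.id
        (TensorProduct.comm ℝ G F (TensorProduct.map A LinearMap.id t))) := by
    induction t with
    | zero => simp
    | add x y hx hy => simp only [map_add, hx, hy]
    | tmul u v => simp
  rw [h1, TensorProduct.norm_comm]
  refine (norm_map_id_le B hB _).trans ?_
  rw [TensorProduct.norm_comm]
  exact norm_map_id_le A hA t

open scoped BoundedContinuousFunction FourierTransform in
theorem HsRn.norm_incl_le {n : ℕ} {s : ℝ} (hs : 0 ≤ s) (U : HsRn n s) :
    ‖HsRn.incl n s U‖ ≤ ‖U‖ := by
  let g : Eucl n → ℂ := fun x => ((1 + ‖x‖ ^ 2) ^ (-s / 2) : ℝ)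
  have hg : g.HasTemperateGrowth := by
    change Function.HasTemperateGrowth fun x : Eucl n => (((1 + ‖x‖ ^ 2) ^ (-s / 2) : ℝ) : ℂ)
    fun_prop
  have hg1 : ∀ x, ‖g x‖ ≤ 1 := by
    intro x
    rw [Complex.norm_real, Real.norm_eq_abs, abs_eq_self.mpr (by positivity)]
    exact Real.rpow_le_one_of_one_le_of_nonpos (by simp) (by linarith)
  let g' : Eucl n →ᵇ ℂ := BoundedContinuousFunction.ofNormedAddCommGroup g hg.1.continuous 1 hg1
  let G := HsRn.potential n s U
  have e : Complex.ofRealCLM.compLp (HsRn.incl n s U) =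
      𝓕⁻ ((g'.memLp_top.toLp _ (μ := volume)) • 𝓕 G) := by
    apply toTemperedDistribution_injective n
    have h1 := congrArg (besselPotential (Eucl n) ℂ (-s)) (HsRn.potentialFun_spec U)
    rw [besselPotential_besselPotential_apply, add_neg_cancel, besselPotential_zero,
      ContinuousLinearMap.id_apply] at h1
    refine h1.trans ?_
    rw [Lp.toTemperedDistributionCLM_apply, Lp.toTemperedDistributionCLM_apply,
      ← Lp.fourierInv_toTemperedDistribution_eq,
      Lp.toTemperedDistribution_smul_eq (by apply hg), ← Lp.fourier_toTemperedDistribution_eq,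
      besselPotential, TemperedDistribution.fourierMultiplierCLM_apply]
    rfl
  have n1 : ‖HsRn.incl n s U‖ = ‖Complex.ofRealCLM.compLp (HsRn.incl n s U)‖ := by
    rw [Lp.norm_def, Lp.norm_def]
    congr 1
    apply eLpNorm_congr_norm_ae
    filter_upwards [Complex.ofRealCLM.coeFn_compLp (HsRn.incl n s U)] with x hx
    rw [hx]
    simp
  rw [n1, e, HsRn.norm_def]
  have h2 : ‖𝓕⁻ ((g'.memLp_top.toLp _ (μ := volume)) • 𝓕 G)‖ =
      ‖(g'.memLp_top.toLp _ (μ := volume)) • 𝓕 G‖ :=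
    (Lp.fourierTransformₗᵢ (Eucl n) ℂ).symm.norm_map _
  rw [h2]
  refine (Lp.norm_smul_le _ _).trans ?_
  rw [Lp.norm_fourier_eq]
  have h3 : ‖g'.memLp_top.toLp _ (μ := volume)‖ ≤ 1 := by
    rw [Lp.norm_toLp]
    refine ENNReal.toReal_le_of_le_ofReal zero_le_one ?_
    rw [eLpNorm_exponent_top]
    exact eLpNormEssSup_le_of_ae_bound (Filter.Eventually.of_forall hg1)
  calc _ ≤ 1 * ‖G‖ := by gcongr
    _ = _ := one_mul _

theorem HsRn.norm_restrict_le {n : ℕ} (Ω : Set (Eucl n)) {s : ℝ} (hs : 0 ≤ s) (U : HsRn n s) :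
    ‖HsRn.restrict Ω s U‖ ≤ ‖U‖ := by
  refine le_trans ?_ (HsRn.norm_incl_le hs U)
  exact norm_Lp_toLp_restrict_le Ω (HsRn.incl n s U)

theorem HsRn.completeSpace {n : ℕ} {s : ℝ} (hs : 0 ≤ s) : CompleteSpace (HsRn n s) := by
  refine Metric.complete_of_cauchySeq_tendsto fun U hU => ?_
  have hiso : Isometry (HsRn.potential n s) :=
    AddMonoidHomClass.isometry_of_norm _ fun V => (HsRn.norm_def V).symm
  obtain ⟨G, hG⟩ := cauchySeq_tendsto_of_complete (hiso.uniformContinuous.comp_cauchySeq hU)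
  let incl : HsRn n s →L[ℝ] Lp ℝ 2 (volume : Measure (Eucl n)) :=
    (HsRn.incl n s).mkContinuous 1 fun V => by
      rw [one_mul]
      exact HsRn.norm_incl_le hs V
  obtain ⟨W, hW⟩ := cauchySeq_tendsto_of_complete (incl.uniformContinuous.comp_cauchySeq hU)
  have hWG : besselPotential (Eucl n) ℂ s (toDistribution n W) =
      Lp.toTemperedDistributionCLM ℂ (volume : Measure (Eucl n)) 2 G := by
    have h1 := ((Lp.toTemperedDistributionCLM ℂ (volume : Measure (Eucl n)) 2).continuous.tendsto
      G).comp hG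
    have h2 := (((besselPotential (Eucl n) ℂ s).continuous.comp
      ((Lp.toTemperedDistributionCLM ℂ (volume : Measure (Eucl n)) 2).continuous.comp
        (Complex.ofRealCLM.compLpL 2 (volume : Measure (Eucl n))).continuous)).tendsto W).comp hW
    refine tendsto_nhds_unique h2 (h1.congr fun k => ?_)
    exact (HsRn.potentialFun_spec (U k)).symm
  let W' : HsRn n s := ⟨W, G, hWG⟩
  refine ⟨W', ?_⟩
  rw [hiso.isEmbedding.tendsto_nhds_iff]
  have : HsRn.potential n s W' = G := by
    apply toTemperedDistribution_injective n
    exact (HsRn.potentialFun_spec W').symm.trans hWG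
  rw [this]
  exact hG

/-- The elements of `Hˢ(Ω)` are exactly the restrictions of functions in `Hˢ(ℝⁿ)`, and every
extension has at least the norm of the restriction. -/
theorem Hs.exists_of_extension {n : ℕ} (Ω : Set (Eucl n)) {s : ℝ} (hs : 0 ≤ s) (U : HsRn n s) :
    ∃ u : Hs Ω s, Hs.toL2 Ω s u = HsRn.restrict Ω s U ∧ ‖u‖ ≤ ‖U‖ := by
  have := HsRn.completeSpace (n := n) hs
  let R : HsRn n s →L[ℝ] L2 Ω := (HsRn.restrict Ω s).mkContinuous 1 fun V => by
    rw [one_mul]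
    exact HsRn.norm_restrict_le Ω hs V
  have hc : IsClosed ((LinearMap.ker (HsRn.restrict Ω s) : Submodule ℝ (HsRn n s)) :
      Set (HsRn n s)) := ContinuousLinearMap.isClosed_ker R
  have : CompleteSpace (LinearMap.ker (HsRn.restrict Ω s)) := hc.completeSpace_coe
  let K : Submodule ℝ (HsRn n s) := LinearMap.ker (HsRn.restrict Ω s)
  obtain ⟨y, hy, z, hz, rfl⟩ := K.exists_add_mem_mem_orthogonal U
  refine ⟨⟨z, hz⟩, ?_, ?_⟩
  · rw [map_add, LinearMap.mem_ker.mp hy, zero_add]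
    rfl
  · change ‖z‖ ≤ ‖y + z‖
    have h0 : inner ℝ y z = 0 := hz y hy
    have h1 := norm_add_sq_eq_norm_sq_add_norm_sq_of_inner_eq_zero y z h0
    nlinarith [norm_nonneg z, norm_nonneg (y + z), mul_self_nonneg ‖y‖]

theorem Hs.toL2_injective {n : ℕ} (Ω : Set (Eucl n)) (s : ℝ) :
    Function.Injective (Hs.toL2 Ω s) := by
  refine (injective_iff_map_eq_zero _).mpr fun u hu => Subtype.ext ?_
  have h1 : u.1 ∈ LinearMap.ker (HsRn.restrict Ω s) := LinearMap.mem_ker.mpr hu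
  exact inner_self_eq_zero.mp (u.2 u.1 h1)

theorem norm_algToL2_le {n₁ n₂ : ℕ} (Ω₁ : Set (Eucl n₁)) (Ω₂ : Set (Eucl n₂)) {s₁ s₂ : ℝ}
    (hs₁ : 0 ≤ s₁) (hs₂ : 0 ≤ s₂) (t : Hs Ω₁ s₁ ⊗[ℝ] Hs Ω₂ s₂) :
    ‖algToL2 Ω₁ Ω₂ s₁ s₂ t‖ ≤ ‖t‖ := by
  have h : algToL2 Ω₁ Ω₂ s₁ s₂ t =
      TensorProduct.lift (tensorBilin (volume.restrict Ω₁) (volume.restrict Ω₂))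
        (TensorProduct.map (Hs.toL2 Ω₁ s₁) (Hs.toL2 Ω₂ s₂) t) := by
    induction t with
    | zero => simp
    | add x y hx hy => simp only [map_add, hx, hy]
    | tmul u v => rfl
  rw [h, norm_lift_tensorBilin]
  exact norm_map_le (Hs.toL2 Ω₁ s₁) (fun u => HsRn.norm_restrict_le Ω₁ hs₁ u.1) (Hs.toL2 Ω₂ s₂)
    (fun v => HsRn.norm_restrict_le Ω₂ hs₂ v.1) t

/-- The inclusion `H_mix^{s₁,s₂}(Ω₁ × Ω₂) ⊂ L²(Ω₁ × Ω₂)`, the continuous extension of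
`u ⊗ v ↦ ((x, y) ↦ u(x) v(y))`, for `s₁, s₂ ≥ 0`. -/
def HMix.toL2 {n₁ n₂ : ℕ} (Ω₁ : Set (Eucl n₁)) (Ω₂ : Set (Eucl n₂)) (s₁ s₂ : ℝ) :
    HMix Ω₁ Ω₂ s₁ s₂ →L[ℝ] L2prod Ω₁ Ω₂ :=
  (algToL2 Ω₁ Ω₂ s₁ s₂).extendOfNorm
    (UniformSpace.Completion.toComplₗᵢ (𝕜 := ℝ) (E := Hs Ω₁ s₁ ⊗[ℝ] Hs Ω₂ s₂)).toLinearMap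

theorem HMix.toL2_tmul {n₁ n₂ : ℕ} (Ω₁ : Set (Eucl n₁)) (Ω₂ : Set (Eucl n₂)) {s₁ s₂ : ℝ}
    (hs₁ : 0 ≤ s₁) (hs₂ : 0 ≤ s₂) (u : Hs Ω₁ s₁) (v : Hs Ω₂ s₂) :
    HMix.toL2 Ω₁ Ω₂ s₁ s₂ ((u ⊗ₜ[ℝ] v : Hs Ω₁ s₁ ⊗[ℝ] Hs Ω₂ s₂) : HMix Ω₁ Ω₂ s₁ s₂) =
      tensorFun (Hs.toL2 Ω₁ s₁ u) (Hs.toL2 Ω₂ s₂ v) :=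
  LinearMap.extendOfNorm_eq UniformSpace.Completion.denseRange_coe
    ⟨1, fun t => by
      rw [one_mul]
      exact (norm_algToL2_le Ω₁ Ω₂ hs₁ hs₂ t).trans
        (UniformSpace.Completion.norm_coe t).ge⟩ (u ⊗ₜ[ℝ] v)

/-! ### Single-scale spaces -/

/-- The mesh width `h_j = 2^{-j}`. -/
def meshWidth (j : ℕ) : ℝ := (1 / 2) ^ j

/-- The function `v` agrees with the polynomial `p` almost everywhere on `K`. -/
def EqPolyOn {n : ℕ} {Ω : Set (Eucl n)} (K : Set (Eucl n)) (v : L2 Ω)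
    (p : MvPolynomial (Fin n) ℝ) : Prop :=
  (v : Eucl n → ℝ) =ᵐ[volume.restrict K] fun x => MvPolynomial.eval (fun i => x i) p

/-- A partition of `Ω` (up to null sets) into finitely many cells that are shape regular and of
size `h`, in the sense that each cell has diameter at most `C h` and contains a ball of
radius `c h`. -/
structure IsMesh {n : ℕ} (Ω : Set (Eucl n)) (c C h : ℝ) (T : Set (Set (Eucl n))) : Prop where
  finite : T.Finite
  measurable : ∀ K ∈ T, MeasurableSet K
  subset : ∀ K ∈ T, K ⊆ Ω
  disjoint : ∀ K ∈ T, ∀ L ∈ T, K ≠ L → volume (K ∩ L) = 0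
  cover : volume (Ω \ ⋃₀ T) = 0
  diam : ∀ K ∈ T, Metric.diam K ≤ C * h
  ball : ∀ K ∈ T, ∃ x, Metric.ball x (c * h) ⊆ K

/-- A multiscale sequence `V 0 ⊆ V 1 ⊆ ⋯ ⊆ L²(Ω)` of piecewise polynomial spaces on meshes of
width `h_j = 2^{-j}`, with polynomial exactness `r`. -/
structure IsMultiscale {n : ℕ} (Ω : Set (Eucl n)) (r : ℕ) (V : ℕ → Submodule ℝ (L2 Ω)) :
    Prop where
  nested : Monotone V
  finiteDimensional : ∀ j, FiniteDimensional ℝ (V j)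
  /-- `dim V_j ∼ 2^{jn}` -/
  dim : ∃ c C : ℝ, 0 < c ∧ ∀ j : ℕ, c * 2 ^ (j * n) ≤ (Module.finrank ℝ (V j) : ℝ) ∧
    (Module.finrank ℝ (V j) : ℝ) ≤ C * 2 ^ (j * n)
  dense : Dense (⋃ j, (V j : Set (L2 Ω)))
  /-- On every cell, the functions of `V_j` are polynomials of degree less than `r` in each
  variable, and all polynomials of total degree less than `r` occur. -/
  piecewise : ∃ (c C : ℝ) (T : ℕ → Set (Set (Eucl n))), 0 < c ∧ ∀ j, IsMesh Ω c C (meshWidth j) (T j) ∧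
    ∀ K ∈ T j,
      (∀ v ∈ V j, ∃ p : MvPolynomial (Fin n) ℝ, (∀ i, p.degreeOf i < r) ∧ EqPolyOn K v p) ∧
      (∀ p : MvPolynomial (Fin n) ℝ, p.totalDegree < r → ∃ v ∈ V j, EqPolyOn K v p)
  /-- The approximation property `inf_{v ∈ V_j} ‖u - v‖ ≲ h_j^t ‖u‖_{H^t}` for `0 ≤ t ≤ r`,
  uniformly in `j`. -/
  approx : ∀ t : ℝ, 0 ≤ t → t ≤ r → ∃ C : ℝ, ∀ (j : ℕ) (u : Hs Ω t),
    Metric.infDist (Hs.toL2 Ω t u) (V j : Set (L2 Ω)) ≤ C * meshWidth j ^ t * ‖u‖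

/-! ### The fully discrete singular value decomposition -/

/-- A singular value decomposition `f = ∑ₖ σₖ uₖ ⊗ vₖ` in `L²(Ω₁ × Ω₂)`. -/
structure IsSVD {n₁ n₂ : ℕ} {Ω₁ : Set (Eucl n₁)} {Ω₂ : Set (Eucl n₂)} (f : L2prod Ω₁ Ω₂)
    (σ : ℕ → ℝ) (u : ℕ → L2 Ω₁) (v : ℕ → L2 Ω₂) : Prop where
  nonneg : ∀ k, 0 ≤ σ k
  antitone : Antitone σ
  orthonormal_left : Orthonormal ℝ u
  orthonormal_right : Orthonormal ℝ v
  hasSum : HasSum (fun k => σ k • tensorFun (u k) (v k)) f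

/-- `w` is the best approximation of `u` in the subspace `V`. -/
def IsBestApprox {n : ℕ} {Ω : Set (Eucl n)} (V : Submodule ℝ (L2 Ω)) (u w : L2 Ω) : Prop :=
  w ∈ V ∧ ∀ z ∈ V, ‖u - w‖ ≤ ‖u - z‖

section

variable {n₁ n₂ : ℕ} {Ω₁ : Set (Eucl n₁)} {Ω₂ : Set (Eucl n₂)}

/-- The numbers `N` of degrees of freedom for which some fully discrete truncated singular value
decomposition of `f` has an error of at most `ε`. It consists of `R` terms, and its left and right
singular functions are replaced by approximations in the single-scale spaces `V₁ j₁` and `V₂ j₂`;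
this needs `N = R (dim V₁ j₁ + dim V₂ j₂)` coefficients. The predicates `A₁` and `A₂`
tell which approximations in a subspace are admitted. -/
def discreteSVDDofs (A₁ : Submodule ℝ (L2 Ω₁) → L2 Ω₁ → L2 Ω₁ → Prop)
    (A₂ : Submodule ℝ (L2 Ω₂) → L2 Ω₂ → L2 Ω₂ → Prop)
    (V₁ : ℕ → Submodule ℝ (L2 Ω₁)) (V₂ : ℕ → Submodule ℝ (L2 Ω₂))
    (f : L2prod Ω₁ Ω₂) (ε : ℝ) : Set ℕ :=
  {N | ∃ (R j₁ j₂ : ℕ) (σ : ℕ → ℝ) (u u' : ℕ → L2 Ω₁) (v v' : ℕ → L2 Ω₂),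
    IsSVD f σ u v ∧
    (∀ k < R, A₁ (V₁ j₁) (u k) (u' k)) ∧
    (∀ k < R, A₂ (V₂ j₂) (v k) (v' k)) ∧
    ‖f - ∑ k ∈ Finset.range R, σ k • tensorFun (u' k) (v' k)‖ ≤ ε ∧
    N = R * (Module.finrank ℝ (V₁ j₁) + Module.finrank ℝ (V₂ j₂))}

/-- The number `dof_svd(ε)` of degrees of freedom that is needed to approximate the functions in
the unit ball of `H_mix^{s₁,s₂}(Ω₁ × Ω₂)` with accuracy `ε` in `L²(Ω₁ × Ω₂)` by the truncated
singular value decomposition, where the singular functions are replaced by their best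
approximations in single-scale spaces. -/
def dofSVD (s₁ s₂ : ℝ) (V₁ : ℕ → Submodule ℝ (L2 Ω₁)) (V₂ : ℕ → Submodule ℝ (L2 Ω₂)) (ε : ℝ) :
    ℕ∞ :=
  ⨆ (F : HMix Ω₁ Ω₂ s₁ s₂) (_ : ‖F‖ ≤ 1),
    ⨅ N ∈ discreteSVDDofs IsBestApprox IsBestApprox V₁ V₂ (HMix.toL2 Ω₁ Ω₂ s₁ s₂ F) ε, (N : ℕ∞)

/-- The same number if the singular functions may be replaced by arbitrary functions in the
single-scale spaces. -/
def dofSVDFree (s₁ s₂ : ℝ) (V₁ : ℕ → Submodule ℝ (L2 Ω₁)) (V₂ : ℕ → Submodule ℝ (L2 Ω₂))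
    (ε : ℝ) : ℕ∞ :=
  ⨆ (F : HMix Ω₁ Ω₂ s₁ s₂) (_ : ‖F‖ ≤ 1),
    ⨅ N ∈ discreteSVDDofs (fun V _ w => w ∈ V) (fun V _ w => w ∈ V) V₁ V₂
      (HMix.toL2 Ω₁ Ω₂ s₁ s₂ F) ε, (N : ℕ∞)

end

end LowRank

end

/-! Read a tensor as a Hilbert-Schmidt operator (`IsCross.op`), whose singular values are those of
the tensor. If the tensor is the image of some φ in the mixed Sobolev space, its operator factors as
i₁ ∘ op φ ∘ i₂*, where i₁, i₂ are the Sobolev inclusions into L² (`IsCross.op_map`). Put β = s₁/n₁ +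
s₂/n₂; the first exponent of the theorem is 1/β.

Upper bound. Each inclusion is approximated by an m-dimensional space with error of order m^(-s/n)
(`exists_approx_subspace`). By the factorization the two errors multiply, so some space of dimension
at most 2m captures the left singular functions up to m^(-β) in the weighted square sum. Since the
singular values decrease, truncation after 2m terms is at least as good
(`IsCross.norm_sub_truncation_le`). Replacing the singular functions by projections costs only
h^min(s,r) in each variable, independently of the number of terms: the vectors σₖuₖ are i₁-images of
vectors whose squared norms sum to at most 1 (`IsCross.sum_norm_smul_sub_sq_le`). Hence R ~ ε^(-1/β)
and dim V ~ ε^(-n/min(s,r)) suffice, and the larger of the two dimensions dominates their sum.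

Lower bound. One function must force many terms and a fine level at the same time. Take φ = a ∑ eₖ ⊗
zₖ + b w ⊗ z₀, where the eₖ are L²-orthonormal, the zₖ are too, and z₀ is L²-orthogonal to all zₖ.
The first part has m equal singular values, so a sum of fewer than m/2 elementary tensors is too far
away; by the inverse estimate `exists_inverse_subspace`, φ can be kept in the unit ball with m ~
ε^(-1/β). Testing with z₀ isolates b w, and w is chosen at distance of order h^min(s,r) from a given
level (`IsMultiscale.exists_far`), so the left factors must come from a finer level. The number of
terms times this single dimension already gives the rate, provided that the variable attaining the
maximum is the one put on the left. The argument looks only at the number of terms and at the spaces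
of the factors, so it also covers arbitrary approximations.

The distance h^min(s,r) has two sources. For s ≤ r a space of dimension ~ h^(-n) cannot contain good
approximations of all of a larger space with an inverse estimate. For s > r, on every cell the r-th
power of a coordinate stays away from polynomials of lower degree in that coordinate. -/

noncomputable section

namespace LowRank

/-! ### Bilinear maps that multiply inner products -/

/-- A bilinear map that realizes (part of) a Hilbert space tensor product. -/
def IsCross {E F H : Type*} [NormedAddCommGroup E] [InnerProductSpace ℝ E]
    [NormedAddCommGroup F] [InnerProductSpace ℝ F] [NormedAddCommGroup H] [InnerProductSpace ℝ H]
    (t : E →ₗ[ℝ] F →ₗ[ℝ] H) : Prop :=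
  ∀ x x' y y', inner ℝ (t x y) (t x' y') = inner ℝ x x' * inner ℝ y y'

namespace IsCross

variable {E F H : Type*} [NormedAddCommGroup E] [InnerProductSpace ℝ E]
    [NormedAddCommGroup F] [InnerProductSpace ℝ F] [NormedAddCommGroup H] [InnerProductSpace ℝ H]
    {t : E →ₗ[ℝ] F →ₗ[ℝ] H}

theorem flip (ht : IsCross t) : IsCross t.flip := fun x x' y y' => by
  rw [LinearMap.flip_apply, LinearMap.flip_apply, ht, mul_comm]

theorem norm_apply (ht : IsCross t) (x : E) (y : F) : ‖t x y‖ = ‖x‖ * ‖y‖ := by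
  rw [norm_eq_sqrt_real_inner, ht, real_inner_self_eq_norm_sq, real_inner_self_eq_norm_sq,
    ← mul_pow, Real.sqrt_sq (by positivity)]

theorem inner_lift (ht : IsCross t) (z z' : E ⊗[ℝ] F) :
    inner ℝ (TensorProduct.lift t z) (TensorProduct.lift t z') = inner ℝ z z' := by
  induction z with
  | zero => simp
  | add x y hx hy => rw [map_add, inner_add_left, inner_add_left, hx, hy]
  | tmul u v =>
    induction z' with
    | zero => simp
    | add x y hx hy => rw [map_add, inner_add_right, inner_add_right, hx, hy]
    | tmul u' v' =>
      rw [TensorProduct.lift.tmul, TensorProduct.lift.tmul, TensorProduct.inner_tmul]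
      exact ht u u' v v'

theorem norm_lift (ht : IsCross t) (z : E ⊗[ℝ] F) : ‖TensorProduct.lift t z‖ = ‖z‖ := by
  rw [norm_eq_sqrt_real_inner, @norm_eq_sqrt_real_inner _ _ _ z, ht.inner_lift]

/-- Applying an operator with bound `δ` to the second factors of `∑ g i ⊗ v i`, where the `v i` are
orthonormal. -/
theorem norm_sum_sq_le (ht : IsCross t) {F' : Type*} [NormedAddCommGroup F']
    [InnerProductSpace ℝ F'] (B : F' →L[ℝ] F) {ι : Type*} [Fintype ι] {v : ι → F'}
    (hv : Orthonormal ℝ v) (g : ι → E) :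
    ‖∑ i, t (g i) (B (v i))‖ ^ 2 ≤ ‖B‖ ^ 2 * ∑ i, ‖g i‖ ^ 2 := by
  have h1 : ∑ i, t (g i) (B (v i)) = TensorProduct.lift t (B.lTensor E (∑ i, g i ⊗ₜ[ℝ] v i)) := by
    simp
  have h2 : ‖B.lTensor E (∑ i, g i ⊗ₜ[ℝ] v i)‖ ≤ ‖B‖ * ‖∑ i, g i ⊗ₜ[ℝ] v i‖ :=
    (ContinuousLinearMap.le_opNorm _ _).trans
      (by gcongr; exact ContinuousLinearMap.norm_lTensor_le _ _)
  rw [h1, ht.norm_lift, ← norm_sum_tmul_sq g v hv, ← mul_pow]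
  gcongr

theorem norm_sum_sq (ht : IsCross t) {ι : Type*} [Fintype ι] {v : ι → F}
    (hv : Orthonormal ℝ v) (g : ι → E) :
    ‖∑ i, t (g i) (v i)‖ ^ 2 = ∑ i, ‖g i‖ ^ 2 := by
  have h1 : ∑ i, t (g i) (v i) = TensorProduct.lift t (∑ i, g i ⊗ₜ[ℝ] v i) := by simp
  rw [h1, ht.norm_lift, norm_sum_tmul_sq g v hv]

/-- The map `x ↦ t x y`. -/
def leftL (ht : IsCross t) (y : F) : E →L[ℝ] H :=
  (t.flip y).mkContinuous ‖y‖ fun x => by rw [LinearMap.flip_apply, ht.norm_apply, mul_comm]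

theorem leftL_apply (ht : IsCross t) (x : E) (y : F) : ht.leftL y x = t x y := rfl

theorem norm_leftL_le (ht : IsCross t) (y : F) : ‖ht.leftL y‖ ≤ ‖y‖ :=
  LinearMap.mkContinuous_norm_le _ (norm_nonneg _) _

/-! ### The operator attached to a tensor -/

section Complete

variable [CompleteSpace E] [CompleteSpace H]

/-- The operator `F → E` that belongs to `f ∈ H`, given by `⟪x, op f y⟫ = ⟪x ⊗ y, f⟫`. -/
def op (ht : IsCross t) (f : H) : F →L[ℝ] E :=
  LinearMap.mkContinuous
    { toFun := fun y => ContinuousLinearMap.adjoint (ht.leftL y) f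
      map_add' := fun y y' => ext_inner_left ℝ fun x => by
        simp [inner_add_right, ContinuousLinearMap.adjoint_inner_right, inner_add_left,
          leftL_apply]
      map_smul' := fun c y => ext_inner_left ℝ fun x => by
        simp [inner_smul_right, ContinuousLinearMap.adjoint_inner_right, inner_smul_left,
          leftL_apply] }
    ‖f‖ fun y => by
      refine (ContinuousLinearMap.le_opNorm (ContinuousLinearMap.adjoint (ht.leftL y)) f).trans ?_
      rw [mul_comm, LinearIsometryEquiv.norm_map]
      gcongr
      exact ht.norm_leftL_le y

theorem inner_op (ht : IsCross t) (f : H) (x : E) (y : F) :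
    inner ℝ x (ht.op f y) = inner ℝ (t x y) f := by
  exact ContinuousLinearMap.adjoint_inner_right (ht.leftL y) x f

theorem norm_op_le (ht : IsCross t) (f : H) : ‖ht.op f‖ ≤ ‖f‖ :=
  LinearMap.mkContinuous_norm_le _ (norm_nonneg _) _

theorem op_add (ht : IsCross t) (f g : H) : ht.op (f + g) = ht.op f + ht.op g := by
  ext y
  refine ext_inner_left ℝ fun x => ?_
  rw [add_apply, inner_add_right, inner_op, inner_op, inner_op,
    inner_add_right]

theorem op_smul (ht : IsCross t) (c : ℝ) (f : H) : ht.op (c • f) = c • ht.op f := by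
  ext y
  refine ext_inner_left ℝ fun x => ?_
  rw [smul_apply, inner_smul_right, inner_op, inner_op, inner_smul_right]

/-- The linear isometric inclusion of `H` into the bounded operators, as a continuous map. -/
def opL (ht : IsCross t) : H →L[ℝ] F →L[ℝ] E :=
  LinearMap.mkContinuous { toFun := ht.op, map_add' := ht.op_add, map_smul' := ht.op_smul } 1
    fun f => by rw [one_mul]; exact ht.norm_op_le f

theorem opL_apply (ht : IsCross t) (f : H) : ht.opL f = ht.op f := rfl

theorem op_sub (ht : IsCross t) (f g : H) : ht.op (f - g) = ht.op f - ht.op g :=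
  map_sub ht.opL f g

theorem op_sum (ht : IsCross t) {ι : Type*} (s : Finset ι) (f : ι → H) :
    ht.op (∑ i ∈ s, f i) = ∑ i ∈ s, ht.op (f i) :=
  map_sum ht.opL f s

theorem op_apply_cross (ht : IsCross t) (x : E) (y y' : F) :
    ht.op (t x y) y' = (inner ℝ y' y : ℝ) • x := by
  refine ext_inner_left ℝ fun x' => ?_
  rw [inner_op, ht, inner_smul_right, mul_comm]

/-- Duality: the sum S on the left is the inner product of f with ∑ op f (B vᵢ) ⊗ B vᵢ, and the
square of the norm of that tensor is at most ‖B‖² S. Cauchy-Schwarz gives S² ≤ ‖B‖² S ‖f‖². This is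
the Hilbert-Schmidt bound, and it is what keeps all error estimates free of the number of terms. -/
theorem sum_norm_op_sq_le (ht : IsCross t) {F' : Type*} [NormedAddCommGroup F']
    [InnerProductSpace ℝ F'] (B : F' →L[ℝ] F) {ι : Type*} [Fintype ι] {v : ι → F'}
    (hv : Orthonormal ℝ v) (f : H) :
    ∑ i, ‖ht.op f (B (v i))‖ ^ 2 ≤ ‖B‖ ^ 2 * ‖f‖ ^ 2 := by
  set S := ∑ i, ‖ht.op f (B (v i))‖ ^ 2 with hS
  have hS0 : 0 ≤ S := Finset.sum_nonneg fun i _ => sq_nonneg _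
  have h1 : S = inner ℝ (∑ i, t (ht.op f (B (v i))) (B (v i))) f := by
    rw [sum_inner, hS]
    refine Finset.sum_congr rfl fun i _ => ?_
    rw [← real_inner_self_eq_norm_sq, inner_op]
  have h2 : S ≤ ‖∑ i, t (ht.op f (B (v i))) (B (v i))‖ * ‖f‖ := h1 ▸ real_inner_le_norm _ _
  have h3 := ht.norm_sum_sq_le B hv fun i => ht.op f (B (v i))
  rw [← hS] at h3
  have h4 : S ^ 2 ≤ ‖B‖ ^ 2 * S * ‖f‖ ^ 2 := by
    calc S ^ 2 ≤ (‖∑ i, t (ht.op f (B (v i))) (B (v i))‖ * ‖f‖) ^ 2 := by gcongr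
      _ = ‖∑ i, t (ht.op f (B (v i))) (B (v i))‖ ^ 2 * ‖f‖ ^ 2 := mul_pow _ _ _
      _ ≤ _ := by gcongr
  rcases hS0.eq_or_lt with h | h
  · rw [← h]; positivity
  · nlinarith

theorem sum_norm_op_sq_le' (ht : IsCross t) {ι : Type*} [Fintype ι] {v : ι → F}
    (hv : Orthonormal ℝ v) (f : H) : ∑ i, ‖ht.op f (v i)‖ ^ 2 ≤ ‖f‖ ^ 2 := by
  refine (ht.sum_norm_op_sq_le (ContinuousLinearMap.id ℝ F) hv f).trans ?_
  have h1 : ‖ContinuousLinearMap.id ℝ F‖ ≤ 1 := ContinuousLinearMap.norm_id_le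
  have h2 : ‖ContinuousLinearMap.id ℝ F‖ ^ 2 ≤ 1 := pow_le_one₀ (norm_nonneg _) h1
  nlinarith [sq_nonneg ‖f‖]

/-- An element of the closed span of the elementary tensors is determined by its operator. -/
theorem eq_zero_of_op_eq_zero (ht : IsCross t) {f : H}
    (hf : f ∈ (Submodule.span ℝ {h | ∃ x y, h = t x y}).topologicalClosure)
    (h0 : ht.op f = 0) : f = 0 := by
  have h1 : f ∈ (Submodule.span ℝ {h | ∃ x y, h = t x y})ᗮ := by
    rw [Submodule.mem_orthogonal]
    intro u hu
    induction hu using Submodule.span_induction with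
    | mem z hz =>
      obtain ⟨x, y, rfl⟩ := hz
      rw [← ht.inner_op, h0]; simp
    | zero => simp
    | add x y _ _ hx hy => rw [inner_add_left, hx, hy, add_zero]
    | smul c x _ hx => rw [inner_smul_left, hx, mul_zero]
  rw [← Submodule.orthogonal_closure] at h1
  exact inner_self_eq_zero.mp (h1 f hf)

/-- Elementary tensors give operators of rank one, and compactness survives limits in the operator
norm, in which `opL` is continuous. -/
theorem isCompactOperator_op (ht : IsCross t) [CompleteSpace F] {f : H}
    (hf : f ∈ (Submodule.span ℝ {h | ∃ x y, h = t x y}).topologicalClosure) :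
    IsCompactOperator (ht.op f) := by
  have hc : IsClosed {A : F →L[ℝ] E | IsCompactOperator A} := isClosed_setOfPred_isCompactOperator
  have hc' := hc.preimage ht.opL.continuous
  refine closure_minimal (s := (Submodule.span ℝ {h | ∃ x y, h = t x y} : Set H)) ?_ hc' hf
  intro u hu
  change IsCompactOperator (ht.op u)
  induction hu using Submodule.span_induction with
  | mem z hz =>
    obtain ⟨x, y, rfl⟩ := hz
    have h1 : ht.op (t x y) = (innerSL ℝ y).smulRight x := by
      ext y'
      rw [op_apply_cross, ContinuousLinearMap.smulRight_apply, innerSL_apply_apply,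
        real_inner_comm]
    have h2 : IsCompactOperator (ContinuousLinearMap.toSpanSingleton ℝ x) :=
      isCompactOperator_id.clm_comp _
    have h3 := h2.comp_clm (innerSL ℝ y)
    rw [h1]
    exact h3
  | zero =>
    have : ht.op (0 : H) = 0 := map_zero ht.opL
    rw [this]
    exact isCompactOperator_zero
  | add x y _ _ hx hy =>
    rw [op_add]
    exact hx.add hy
  | smul c x _ hx =>
    rw [op_smul]
    exact hx.smul c

end Complete

end IsCross

/-! ### Existence of singular value decompositions -/

/-- Greedy choice: always take an index with the largest remaining value, which exists because the
superlevel sets are finite. An index with positive value cannot be passed over forever, since then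
infinitely many chosen indices would lie in one superlevel set. Indices with value zero may be
missed. -/
theorem exists_antitone_enumeration {ι : Type*} [Infinite ι] (a : ι → ℝ) (h0 : ∀ i, 0 ≤ a i)
    (hfin : ∀ ε > 0, {i | ε ≤ a i}.Finite) :
    ∃ e : ℕ → ι, Function.Injective e ∧ Antitone (a ∘ e) ∧ ∀ i, i ∉ Set.range e → a i = 0 := by
  classical
  have hpick : ∀ S : Finset ι, ∃ i, i ∉ S ∧ ∀ j, j ∉ S → a j ≤ a i := by
    intro S
    by_cases h : ∃ i, i ∉ S ∧ 0 < a i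
    · obtain ⟨i, hi, hpos⟩ := h
      obtain ⟨k, hk, hmax⟩ := Set.exists_max_image ({j | a i ≤ a j} ∩ {j | j ∉ S}) a
        ((hfin _ hpos).inter_of_left _) ⟨i, le_refl (a i), hi⟩
      refine ⟨k, hk.2, fun j hj => ?_⟩
      by_cases hij : a i ≤ a j
      · exact hmax j ⟨hij, hj⟩
      · exact (not_le.mp hij).le.trans hk.1
    · push Not at h
      obtain ⟨i, hi⟩ := Infinite.exists_notMem_finset S
      exact ⟨i, hi, fun j hj => (h j hj).trans (h0 i)⟩
  choose pick hp1 hp2 using hpick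
  let g : ℕ → Finset ι := fun n => Nat.rec ∅ (fun _ S => insert (pick S) S) n
  have hg : ∀ n, g (n + 1) = insert (pick (g n)) (g n) := fun n => rfl
  have hmono : Monotone g := monotone_nat_of_le_succ fun n => by
    rw [hg]; exact Finset.subset_insert _ _
  have hmem : ∀ k n, k < n → pick (g k) ∈ g n := fun k n hkn =>
    hmono (Nat.succ_le_of_lt hkn) (by rw [hg]; exact Finset.mem_insert_self _ _)
  have hinj : Function.Injective fun n => pick (g n) := by
    intro k n h
    by_contra hne
    rcases Nat.lt_or_gt_of_ne hne with hlt | hlt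
    · exact hp1 (g n) ((show pick (g k) = pick (g n) from h) ▸ hmem k n hlt)
    · exact hp1 (g k) ((show pick (g k) = pick (g n) from h) ▸ hmem n k hlt)
  have hsub : ∀ n, ∀ i ∈ g n, ∃ k, pick (g k) = i := by
    intro n
    induction n with
    | zero => intro i hi; simp [g] at hi
    | succ n ih =>
      intro i hi
      rw [hg, Finset.mem_insert] at hi
      rcases hi with rfl | hi
      · exact ⟨n, rfl⟩
      · exact ih i hi
  refine ⟨fun n => pick (g n), hinj, antitone_nat_of_succ_le fun n => ?_, fun i hi => ?_⟩
  · refine hp2 (g n) _ fun h => hp1 (g (n + 1)) ?_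
    exact hmono (Nat.le_succ n) h
  · have hle : ∀ n, a i ≤ a (pick (g n)) := fun n => hp2 (g n) i fun h => hi (hsub n i h)
    by_contra hne
    have hpos : 0 < a i := lt_of_le_of_ne (h0 i) (Ne.symm hne)
    exact Set.infinite_range_of_injective hinj ((hfin _ hpos).subset (by
      rintro _ ⟨n, rfl⟩; exact hle n))

theorem exists_unit_orthogonal {E : Type*} [NormedAddCommGroup E] [InnerProductSpace ℝ E]
    (hE : ¬ FiniteDimensional ℝ E) (S : Finset E) :
    ∃ x : E, ‖x‖ = 1 ∧ ∀ y ∈ S, inner ℝ y x = 0 := by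
  have h1 : (Submodule.span ℝ (S : Set E))ᗮ ≠ ⊥ := by
    intro h
    rw [Submodule.orthogonal_eq_bot_iff] at h
    exact hE ⟨⟨S, h⟩⟩
  obtain ⟨x, hx, hx0⟩ := Submodule.exists_mem_ne_zero_of_ne_bot h1
  refine ⟨‖x‖⁻¹ • x, norm_smul_inv_norm hx0, fun y hy => ?_⟩
  rw [inner_smul_right, (Submodule.mem_orthogonal _ _).mp hx y (Submodule.subset_span hy),
    mul_zero]

/-- A sequence of orthogonal vectors can be normalized, where vanishing vectors are replaced. -/
theorem exists_orthonormal_normalize {E : Type*} [NormedAddCommGroup E] [InnerProductSpace ℝ E]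
    (hE : ¬ FiniteDimensional ℝ E) (a : ℕ → E) (ha : ∀ k l, k ≠ l → inner ℝ (a k) (a l) = 0)
    (hanti : Antitone fun k => ‖a k‖) :
    ∃ u : ℕ → E, Orthonormal ℝ u ∧ ∀ k, a k = ‖a k‖ • u k := by
  classical
  choose pick hp1 hp2 using exists_unit_orthogonal hE
  -- The vanishing vectors form a tail because the norms decrease. A replacement therefore only has
  -- to be orthogonal to what was chosen before it; no given nonzero vector comes later.
  let step : ℕ → Finset E → E := fun n S => if a n = 0 then pick S else ‖a n‖⁻¹ • a n
  let g : ℕ → Finset E := fun n => Nat.rec ∅ (fun n S => insert (step n S) S) n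
  have hg : ∀ n, g (n + 1) = insert (step n (g n)) (g n) := fun n => rfl
  have hmono : Monotone g := monotone_nat_of_le_succ fun n => by
    rw [hg]; exact Finset.subset_insert _ _
  have hmem : ∀ k n, k < n → step k (g k) ∈ g n := fun k n hkn =>
    hmono (Nat.succ_le_of_lt hkn) (by rw [hg]; exact Finset.mem_insert_self _ _)
  have hlt : ∀ k n, k < n → inner ℝ (step k (g k)) (step n (g n)) = 0 := by
    intro k n hkn
    by_cases hn : a n = 0
    · have : step n (g n) = pick (g n) := if_pos hn
      rw [this]
      exact hp2 _ _ (hmem k n hkn)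
    · have hk : a k ≠ 0 := by
        intro h
        have := hanti hkn.le
        simp only [h, norm_zero, norm_le_zero_iff] at this
        exact hn this
      have e1 : step n (g n) = ‖a n‖⁻¹ • a n := if_neg hn
      have e2 : step k (g k) = ‖a k‖⁻¹ • a k := if_neg hk
      rw [e1, e2, inner_smul_left, inner_smul_right, ha k n hkn.ne, mul_zero, mul_zero]
  refine ⟨fun n => step n (g n), ⟨fun n => ?_, fun k n hkn => ?_⟩, fun k => ?_⟩
  · by_cases hn : a n = 0
    · simp only [step, if_pos hn, hp1]
    · simp only [step, if_neg hn]
      exact norm_smul_inv_norm hn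
  · rcases Nat.lt_or_gt_of_ne hkn with h | h
    · exact hlt k n h
    · change inner ℝ (step k (g k)) (step n (g n)) = 0
      rw [real_inner_comm]; exact hlt n k h
  · by_cases hn : a k = 0
    · simp [hn]
    · simp only [step, if_neg hn]
      rw [smul_smul, mul_inv_cancel₀ (norm_ne_zero_iff.mpr hn), one_smul]

/-- An orthogonal family of closed subspaces with dense span has an adapted orthonormal basis. -/
theorem exists_hilbertBasis_of_orthogonalFamily.{u} {F : Type u} [NormedAddCommGroup F]
    [InnerProductSpace ℝ F] [CompleteSpace F] {κ : Type} (G : κ → Submodule ℝ F)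
    [∀ μ, CompleteSpace (G μ)] (hG : OrthogonalFamily ℝ (fun μ => G μ) fun μ => (G μ).subtypeₗᵢ)
    (htop : (⨆ μ, G μ)ᗮ = ⊥) :
    ∃ (ι : Type u) (b : HilbertBasis ι ℝ F) (μ : ι → κ), ∀ i, b i ∈ G (μ i) := by
  have hb : ∀ μ, ∃ (w : Set (G μ)) (b : HilbertBasis w ℝ (G μ)), ⇑b = ((↑) : w → _) :=
    fun μ => exists_hilbertBasis ℝ _
  choose w b hwb using hb
  let V : (Σ μ, w μ) → F := fun i => (b i.1 i.2 : F)
  have hV : Orthonormal ℝ V :=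
    hG.orthonormal_sigma_orthonormal fun μ => (b μ).orthonormal
  have hbot : (Submodule.span ℝ (Set.range V))ᗮ = ⊥ := by
    rw [eq_bot_iff, ← htop]
    intro x hx
    rw [← Submodule.iInf_orthogonal, Submodule.mem_iInf]
    intro μ
    rw [Submodule.mem_orthogonal]
    intro y hy
    have hz : ∀ z : G μ, inner ℝ x (z : F) = 0 := by
      have h0 : ((innerSL ℝ x).comp (G μ).subtypeL) = 0 := by
        refine ContinuousLinearMap.ext_on
          (Submodule.dense_iff_topologicalClosure_eq_top.mpr (b μ).dense_span) ?_
        rintro _ ⟨i, rfl⟩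
        change inner ℝ x (b μ i : F) = 0
        rw [real_inner_comm]
        exact (Submodule.mem_orthogonal _ _).mp hx _ (Submodule.subset_span ⟨⟨μ, i⟩, rfl⟩)
      exact fun z => DFunLike.congr_fun h0 z
    rw [real_inner_comm]
    exact hz ⟨y, hy⟩
  refine ⟨Σ μ, w μ, HilbertBasis.mkOfOrthogonalEqBot hV hbot, fun i => i.1, fun i => ?_⟩
  rw [congrFun (HilbertBasis.coe_mkOfOrthogonalEqBot hV hbot) i]
  exact (b i.1 i.2).2

/-- A compact symmetric operator has an orthonormal basis of eigenvectors. -/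
theorem exists_hilbertBasis_eigenvectors.{u} {F : Type u} [NormedAddCommGroup F]
    [InnerProductSpace ℝ F] [CompleteSpace F] {T : F →L[ℝ] F} (hT : IsCompactOperator T)
    (hT' : T.IsSymmetric) :
    ∃ (ι : Type u) (b : HilbertBasis ι ℝ F) (μ : ι → ℝ), ∀ i, T (b i) = μ i • b i := by
  have hcl : ∀ μ : ℝ, CompleteSpace (Module.End.eigenspace (T : Module.End ℝ F) μ) := fun μ => by
    have : IsClosed (Module.End.eigenspace (T : Module.End ℝ F) μ : Set F) := by
      have h : (Module.End.eigenspace (T : Module.End ℝ F) μ : Set F) = {x | T x = μ • x} := by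
        ext x
        exact Module.End.mem_eigenspace_iff
      rw [h]
      exact isClosed_eq T.continuous (continuous_const_smul μ)
    exact this.completeSpace_coe
  obtain ⟨ι, b, μ, hb⟩ := exists_hilbertBasis_of_orthogonalFamily _
    hT'.orthogonalFamily_eigenspaces
    (ContinuousLinearMap.orthogonalComplement_iSup_eigenspaces_eq_bot hT hT')
  exact ⟨ι, b, μ, fun i => Module.End.mem_eigenspace_iff.mp (hb i)⟩

namespace IsCross

variable {E F H : Type*} [NormedAddCommGroup E] [InnerProductSpace ℝ E]
    [NormedAddCommGroup F] [InnerProductSpace ℝ F] [NormedAddCommGroup H] [InnerProductSpace ℝ H]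
    {t : E →ₗ[ℝ] F →ₗ[ℝ] H}

theorem orthonormal (ht : IsCross t) {ι : Type*} {u : ι → E} {v : ι → F} (hu : Orthonormal ℝ u)
    (hv : Orthonormal ℝ v) : Orthonormal ℝ fun k => t (u k) (v k) := by
  refine ⟨fun k => ?_, fun k l hkl => ?_⟩
  · rw [ht.norm_apply, hu.1, hv.1, one_mul]
  · change inner ℝ (t (u k) (v k)) (t (u l) (v l)) = 0
    rw [ht, hu.2 hkl, zero_mul]

variable [CompleteSpace E] [CompleteSpace H]

theorem op_apply_of_hasSum (ht : IsCross t) {f : H} {σ : ℕ → ℝ} {u : ℕ → E} {v : ℕ → F}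
    (hv : Orthonormal ℝ v) (hf : HasSum (fun k => σ k • t (u k) (v k)) f) (k : ℕ) :
    ht.op f (v k) = σ k • u k := by
  have h1 := (ContinuousLinearMap.apply ℝ E (v k)).hasSum (ht.opL.hasSum hf)
  have h2 : HasSum (fun l => (ContinuousLinearMap.apply ℝ E (v k))
      (ht.opL (σ l • t (u l) (v l)))) (σ k • u k) := by
    have h3 := hasSum_ite_eq k (σ k • u k)
    refine h3.congr_fun fun l => ?_
    rw [ContinuousLinearMap.apply_apply, map_smul, opL_apply, smul_apply, op_apply_cross]
    by_cases hl : l = k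
    · rw [if_pos hl, hl, real_inner_self_eq_norm_sq, hv.1]; simp
    · rw [if_neg hl, hv.2 (Ne.symm hl), zero_smul, smul_zero]
  exact h1.unique h2

/-- With A the operator of f, diagonalize the compact symmetric operator A*A. The images A bᵢ of its
eigenbasis are orthogonal, and their norms are the singular values. Infinite dimension is needed
because both orthonormal systems are infinite sequences, even for f of finite rank. -/
theorem exists_svd [CompleteSpace F] (ht : IsCross t) (hE : ¬ FiniteDimensional ℝ E) (hF : ¬ FiniteDimensional ℝ F)
    {f : H} (hf : f ∈ (Submodule.span ℝ {h | ∃ x y, h = t x y}).topologicalClosure) :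
    ∃ (σ : ℕ → ℝ) (u : ℕ → E) (v : ℕ → F), (∀ k, 0 ≤ σ k) ∧ Antitone σ ∧ Orthonormal ℝ u ∧
      Orthonormal ℝ v ∧ HasSum (fun k => σ k • t (u k) (v k)) f := by
  set A := ht.op f with hA
  have hAc : IsCompactOperator A := ht.isCompactOperator_op hf
  let T : F →L[ℝ] F := (ContinuousLinearMap.adjoint A).comp A
  have hTc : IsCompactOperator T :=
    hAc.clm_comp (ContinuousLinearMap.adjoint A)
  have hTs : T.IsSymmetric := fun x y => by
    change inner ℝ (ContinuousLinearMap.adjoint A (A x)) y =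
      inner ℝ x (ContinuousLinearMap.adjoint A (A y))
    rw [ContinuousLinearMap.adjoint_inner_left, ContinuousLinearMap.adjoint_inner_right]
  obtain ⟨ι, b, μ, hb⟩ := exists_hilbertBasis_eigenvectors hTc hTs
  have hinf : Infinite ι := by
    by_contra h
    rw [not_infinite_iff_finite] at h
    have := Fintype.ofFinite ι
    exact hF (b.toOrthonormalBasis.toBasis.finiteDimensional_of_finite)
  have horth : ∀ i j, i ≠ j → inner ℝ (A (b i)) (A (b j)) = 0 := fun i j hij => by
    rw [← ContinuousLinearMap.adjoint_inner_left]
    change inner ℝ (T (b i)) (b j) = 0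
    rw [hb, inner_smul_left, b.orthonormal.2 hij, mul_zero]
  have hsum : Summable fun i => ‖A (b i)‖ ^ 2 :=
    summable_of_sum_le (c := ‖f‖ ^ 2) (fun i => sq_nonneg _) fun s => by
      have := ht.sum_norm_op_sq_le' (b.orthonormal.comp ((↑) : s → ι) Subtype.val_injective) f
      rw [← Finset.sum_coe_sort]
      exact this
  -- Square summability of the singular values makes the superlevel sets finite, so they can be
  -- sorted.
  have hfin : ∀ ε > 0, {i | ε ≤ ‖A (b i)‖}.Finite := fun ε hε => by
    have h1 := hsum.tendsto_cofinite_zero.eventually_lt_const (u := ε ^ 2) (by positivity)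
    rw [Filter.eventually_cofinite] at h1
    refine h1.subset fun i hi => ?_
    simp only [Set.mem_ofPred_eq, not_lt] at hi ⊢
    gcongr
  obtain ⟨e, he, hanti, hzero⟩ :=
    exists_antitone_enumeration (fun i => ‖A (b i)‖) (fun i => norm_nonneg _) hfin
  have hv : Orthonormal ℝ (b ∘ e) := b.orthonormal.comp e he
  obtain ⟨u, hu, hau⟩ := exists_orthonormal_normalize hE (fun k => A (b (e k)))
    (fun k l hkl => horth _ _ (he.ne hkl)) hanti
  have hs : Summable fun k => ‖A (b (e k))‖ • t (u k) (b (e k)) := by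
    have h1 := (ht.orthonormal hu hv).orthogonalFamily.summable_iff_norm_sq_summable
      fun k => ‖A (b (e k))‖
    have h2 := h1.mpr (by simpa [Function.comp_def] using hsum.comp_injective he)
    simpa [LinearIsometry.toSpanSingleton_apply] using h2
  obtain ⟨g, hg⟩ := hs
  refine ⟨fun k => ‖A (b (e k))‖, u, b ∘ e, fun k => norm_nonneg _, hanti, hu, hv, ?_⟩
  -- Both f and g lie in the closed span of the elementary tensors, where a tensor is determined by
  -- its operator. The operators agree on the eigenbasis: on enumerated vectors by construction, and
  -- on the others because both vanish.
  have hgf : f - g = 0 := by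
    apply ht.eq_zero_of_op_eq_zero
    · refine Submodule.sub_mem _ hf ?_
      refine (Submodule.isClosed_topologicalClosure _).mem_of_tendsto hg
        (Filter.Eventually.of_forall fun s => ?_)
      exact Submodule.sum_mem _ fun k _ => Submodule.smul_mem _ _
        (Submodule.le_topologicalClosure _ (Submodule.subset_span ⟨_, _, rfl⟩))
    · rw [op_sub, sub_eq_zero]
      refine ContinuousLinearMap.ext_on
        (Submodule.dense_iff_topologicalClosure_eq_top.mpr b.dense_span) ?_
      rintro _ ⟨i, rfl⟩
      by_cases hi : i ∈ Set.range e
      · obtain ⟨k, rfl⟩ := hi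
        exact (hau k).trans (ht.op_apply_of_hasSum hv hg k).symm
      · have h1 : ht.op f (b i) = 0 := norm_eq_zero.mp (hzero i hi)
        rw [h1]
        have h2 := (ContinuousLinearMap.apply ℝ E (b i)).hasSum (ht.opL.hasSum hg)
        have h3 : ∀ k, (ContinuousLinearMap.apply ℝ E (b i))
            (ht.opL (‖A (b (e k))‖ • t (u k) ((b ∘ e) k))) = 0 := fun k => by
          rw [ContinuousLinearMap.apply_apply, map_smul, opL_apply, smul_apply, op_apply_cross]
          have : inner ℝ (b i) ((b ∘ e) k) = (0 : ℝ) :=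
            b.orthonormal.2 fun h => hi ⟨k, h.symm⟩
          rw [this, zero_smul, smul_zero]
        have h4 : HasSum (fun k => (ContinuousLinearMap.apply ℝ E (b i))
            (ht.opL (‖A (b (e k))‖ • t (u k) ((b ∘ e) k)))) 0 := by
          simp only [h3]; exact hasSum_zero
        exact (h2.unique h4).symm
  rw [sub_eq_zero.mp hgf]
  exact hg

end IsCross

/-! ### Approximation of tensors -/

theorem norm_sub_starProjection_le {E : Type*} [NormedAddCommGroup E] [InnerProductSpace ℝ E]
    (V : Submodule ℝ E) [V.HasOrthogonalProjection] (x : E) {w : E} (hw : w ∈ V) :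
    ‖x - V.starProjection x‖ ≤ ‖x - w‖ := by
  rw [Submodule.starProjection_minimal]
  exact ciInf_le ⟨0, by rintro _ ⟨y, rfl⟩; exact norm_nonneg _⟩ (⟨w, hw⟩ : V)

theorem norm_sub_starProjection_sq {E : Type*} [NormedAddCommGroup E] [InnerProductSpace ℝ E]
    (V : Submodule ℝ E) [V.HasOrthogonalProjection] (x : E) :
    ‖x - V.starProjection x‖ ^ 2 = ‖x‖ ^ 2 - ‖V.starProjection x‖ ^ 2 := by
  have h : inner ℝ (V.starProjection x) (x - V.starProjection x) = 0 :=
    (Submodule.mem_orthogonal _ _).mp (V.sub_starProjection_mem_orthogonal x) _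
      (V.starProjection_apply_mem x)
  have h1 := norm_add_sq_eq_norm_sq_add_norm_sq_of_inner_eq_zero _ _ h
  rw [add_sub_cancel] at h1
  nlinarith

/-- The trace of the projection bounds the sum: expand in an orthonormal basis of X, exchange the
sums, and apply Bessel's inequality to each basis vector. -/
theorem sum_norm_starProjection_sq_le {E : Type*} [NormedAddCommGroup E] [InnerProductSpace ℝ E]
    (X : Submodule ℝ E) [FiniteDimensional ℝ X] {ι : Type*} [Fintype ι] {u : ι → E}
    (hu : Orthonormal ℝ u) :
    ∑ k, ‖X.starProjection (u k)‖ ^ 2 ≤ Module.finrank ℝ X := by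
  let b := stdOrthonormalBasis ℝ X
  have h1 : ∀ k, ‖X.starProjection (u k)‖ ^ 2 = ∑ i, (inner ℝ (u k) (b i : E)) ^ 2 := by
    intro k
    have h2 : ‖X.starProjection (u k)‖ = ‖X.orthogonalProjectionOnto (u k)‖ := rfl
    rw [h2, ← b.sum_sq_norm_inner_right]
    refine Finset.sum_congr rfl fun i _ => ?_
    rw [Submodule.inner_orthogonalProjectionOnto_eq_of_mem_left, Real.norm_eq_abs, sq_abs,
      real_inner_comm]
  simp only [h1]
  rw [Finset.sum_comm]
  calc ∑ i, ∑ k, (inner ℝ (u k) (b i : E)) ^ 2 ≤ ∑ i, ‖(b i : E)‖ ^ 2 := by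
        refine Finset.sum_le_sum fun i _ => ?_
        have := hu.sum_inner_products_le (s := Finset.univ) (b i : E)
        simpa [Real.norm_eq_abs, sq_abs] using this
    _ = Module.finrank ℝ X := by
        have : ∀ i, ‖(b i : E)‖ = 1 := fun i => b.orthonormal.1 i
        simp [this]

/-- Weights `p k ∈ [0, 1]` of total mass at most `R` collect the least from a decreasing sequence
if they are concentrated on its tail. -/
theorem sum_Ico_le_sum_mul_one_sub {a p : ℕ → ℝ} (ha : Antitone a) (ha0 : ∀ k, 0 ≤ a k)
    (hp1 : ∀ k, p k ≤ 1) {R N : ℕ} (hRN : R ≤ N) (hp0 : ∀ k, 0 ≤ p k)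
    (hp : ∑ k ∈ Finset.range N, p k ≤ R) :
    ∑ k ∈ Finset.Ico R N, a k ≤ ∑ k ∈ Finset.range N, a k * (1 - p k) := by
  -- Subtracting a R makes the terms before R nonnegative and those from R on nonpositive, so the
  -- left side is largest for the weights 1 before R and 0 afterwards.
  have h1 : ∑ k ∈ Finset.range N, (a k - a R) * p k ≤ ∑ k ∈ Finset.range R, (a k - a R) := by
    rw [← Finset.sum_range_add_sum_Ico _ hRN]
    have h2 : ∑ k ∈ Finset.Ico R N, (a k - a R) * p k ≤ 0 :=
      Finset.sum_nonpos fun k hk => mul_nonpos_of_nonpos_of_nonneg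
        (sub_nonpos.mpr (ha (Finset.mem_Ico.mp hk).1)) (hp0 k)
    have h3 : ∑ k ∈ Finset.range R, (a k - a R) * p k ≤ ∑ k ∈ Finset.range R, (a k - a R) :=
      Finset.sum_le_sum fun k hk => mul_le_of_le_one_right
        (sub_nonneg.mpr (ha (Finset.mem_range.mp hk).le)) (hp1 k)
    linarith
  simp only [sub_mul, Finset.sum_sub_distrib, ← Finset.mul_sum, Finset.sum_const,
    Finset.card_range, nsmul_eq_mul, mul_sub, mul_one] at h1 ⊢
  have h4 := Finset.sum_range_add_sum_Ico a hRN
  have h5 := mul_le_mul_of_nonneg_left hp (ha0 R)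
  linarith

namespace IsCross

variable {E F H : Type*} [NormedAddCommGroup E] [InnerProductSpace ℝ E]
    [NormedAddCommGroup F] [InnerProductSpace ℝ F] [NormedAddCommGroup H] [InnerProductSpace ℝ H]
    {t : E →ₗ[ℝ] F →ₗ[ℝ] H}

/-- If the left singular functions are close to a subspace of dimension at most `R`, then so is
the tensor to its singular value decomposition with `R` terms. -/
theorem norm_sub_sum_range_le (ht : IsCross t) {f : H} {σ : ℕ → ℝ} {u : ℕ → E} {v : ℕ → F}
    (hσ : ∀ k, 0 ≤ σ k) (hanti : Antitone σ) (hu : Orthonormal ℝ u) (hv : Orthonormal ℝ v)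
    (hf : HasSum (fun k => σ k • t (u k) (v k)) f) (X : Submodule ℝ E) [FiniteDimensional ℝ X]
    {R : ℕ} (hR : Module.finrank ℝ X ≤ R) {D : ℝ} (hD : 0 ≤ D)
    (h : ∀ N, ∑ k ∈ Finset.range N, ‖σ k • (u k - X.starProjection (u k))‖ ^ 2 ≤ D ^ 2) :
    ‖f - ∑ k ∈ Finset.range R, σ k • t (u k) (v k)‖ ≤ D := by
  -- Only finite partial sums are controlled by the hypothesis; the estimate is proved for them and
  -- passed to the limit.
  have h1 : Filter.Tendsto (fun N => ‖∑ k ∈ Finset.range N, σ k • t (u k) (v k) -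
      ∑ k ∈ Finset.range R, σ k • t (u k) (v k)‖) Filter.atTop
      (nhds ‖f - ∑ k ∈ Finset.range R, σ k • t (u k) (v k)‖) :=
    (hf.tendsto_sum_nat.sub_const _).norm
  refine le_of_tendsto h1 (Filter.eventually_atTop.mpr ⟨R, fun N hN => ?_⟩)
  rw [← Finset.sum_range_add_sum_Ico _ hN, add_sub_cancel_left]
  refine le_of_sq_le_sq ?_ hD
  have h2 : ‖∑ k ∈ Finset.Ico R N, σ k • t (u k) (v k)‖ ^ 2 = ∑ k ∈ Finset.Ico R N, σ k ^ 2 := by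
    rw [← real_inner_self_eq_norm_sq, (ht.orthonormal hu hv).inner_sum]
    exact Finset.sum_congr rfl fun k _ => by simp [sq]
  rw [h2]
  have hP : ∀ k, ‖u k - X.starProjection (u k)‖ ^ 2 = 1 - ‖X.starProjection (u k)‖ ^ 2 :=
    fun k => by rw [norm_sub_starProjection_sq, hu.1, one_pow]
  -- The weights are the squared norms of the projections of the uₖ to X. Their total is at most dim
  -- X ≤ R, so the tail of σₖ² is bounded by ∑ σₖ² (1 - weight), the weighted squared distance of
  -- the uₖ to X.
  refine (sum_Ico_le_sum_mul_one_sub (a := fun k => σ k ^ 2)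
    (p := fun k => ‖X.starProjection (u k)‖ ^ 2) (fun k l hkl => ?_) (fun k => sq_nonneg _)
    (fun k => ?_) hN (fun k => sq_nonneg _) ?_).trans ?_
  · have := hanti hkl
    have := hσ l
    dsimp only
    gcongr
  · linarith [hP k, sq_nonneg ‖u k - X.starProjection (u k)‖]
  · have := sum_norm_starProjection_sq_le X (hu.comp _ (Fin.val_injective (n := N)))
    rw [Finset.sum_range]
    exact this.trans (by exact_mod_cast hR)
  · refine le_trans (Finset.sum_le_sum fun k _ => ?_) (h N)
    rw [norm_smul, mul_pow, hP, Real.norm_eq_abs, sq_abs]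

/-- The bound on the combinations of the zᵢ says that the operator from Euclidean space sending unit
vectors to the zᵢ has norm at most C₂; it acts on a tensor with orthonormal second factors. No
orthogonality of the eᵢ is needed, which matters because L²-orthonormal functions are not orthogonal
in the Sobolev norm. -/
theorem norm_sum_le_of_forall (ht : IsCross t) {m : ℕ} {e : Fin m → E} {z : Fin m → F}
    {C₁ C₂ : ℝ} (hC₂ : 0 ≤ C₂) (he : ∀ i, ‖e i‖ ≤ C₁)
    (hz : ∀ c : Fin m → ℝ, ‖∑ i, c i • z i‖ ^ 2 ≤ C₂ ^ 2 * ∑ i, c i ^ 2) :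
    ‖∑ i, t (e i) (z i)‖ ^ 2 ≤ m * (C₁ ^ 2 * C₂ ^ 2) := by
  classical
  let B : EuclideanSpace ℝ (Fin m) →L[ℝ] F :=
    LinearMap.mkContinuous
      { toFun := fun c => ∑ i, c i • z i
        map_add' := fun c d => by simp [add_smul, Finset.sum_add_distrib]
        map_smul' := fun c d => by simp [mul_smul, Finset.smul_sum] } C₂ fun c => by
        refine le_of_sq_le_sq ?_ (by positivity)
        rw [mul_pow, EuclideanSpace.norm_sq_eq]
        simpa using hz c
  have hB : ‖B‖ ≤ C₂ := LinearMap.mkContinuous_norm_le _ hC₂ _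
  have hBe : ∀ i, B (EuclideanSpace.single i 1) = z i := fun i => by
    change ∑ k, (EuclideanSpace.single i (1 : ℝ)) k • z k = z i
    simp [ite_smul]
  have h1 := ht.norm_sum_sq_le B (EuclideanSpace.orthonormal_single (𝕜 := ℝ) (ι := Fin m)) e
  simp only [hBe] at h1
  refine h1.trans ?_
  have h2 : ∑ i, ‖e i‖ ^ 2 ≤ m * C₁ ^ 2 := by
    refine (Finset.sum_le_sum fun i _ => ?_).trans
      (b := ∑ i : Fin m, C₁ ^ 2) (by simp)
    have := he i
    gcongr
  calc ‖B‖ ^ 2 * ∑ i, ‖e i‖ ^ 2 ≤ C₂ ^ 2 * (m * C₁ ^ 2) := by gcongr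
    _ = _ := by ring

theorem map_mem_closure_span {G₁ G₂ K : Type*} [NormedAddCommGroup G₁]
    [InnerProductSpace ℝ G₁] [NormedAddCommGroup G₂] [InnerProductSpace ℝ G₂]
    [NormedAddCommGroup K] [InnerProductSpace ℝ K] {τ : G₁ →ₗ[ℝ] G₂ →ₗ[ℝ] K} {i₁ : G₁ →L[ℝ] E}
    {i₂ : G₂ →L[ℝ] F} {j : K →L[ℝ] H} (hj : ∀ x y, j (τ x y) = t (i₁ x) (i₂ y))
    (hd : Dense (Submodule.span ℝ {h | ∃ x y, h = τ x y} : Set K)) (φ : K) :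
    j φ ∈ (Submodule.span ℝ {h | ∃ x y, h = t x y}).topologicalClosure := by
  refine map_mem_closure j.continuous (hd φ) fun z hz => ?_
  induction hz using Submodule.span_induction with
  | mem z hz =>
    obtain ⟨x, y, rfl⟩ := hz
    rw [hj]
    exact Submodule.subset_span ⟨_, _, rfl⟩
  | zero => rw [map_zero]; exact Submodule.zero_mem _
  | add x y _ _ hx hy => rw [map_add]; exact Submodule.add_mem _ hx hy
  | smul c x _ hx => rw [map_smul]; exact Submodule.smul_mem _ _ hx

variable [CompleteSpace E] [CompleteSpace H]

/-- Elements of finite rank that are close to a tensor with `m` equal singular values. -/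
theorem sq_mul_sub_le (ht : IsCross t) {f : H} {m : ℕ} {a : ℝ} {e : Fin m → E} {z : Fin m → F}
    (he : Orthonormal ℝ e) (hz : Orthonormal ℝ z) (hf : ∀ i, ht.op f (z i) = a • e i)
    {R : ℕ} (x : ℕ → E) (y : ℕ → F) {ε : ℝ}
    (h : ‖f - ∑ k ∈ Finset.range R, t (x k) (y k)‖ ≤ ε) : a ^ 2 * (m - R) ≤ ε ^ 2 := by
  classical
  set g := ∑ k ∈ Finset.range R, t (x k) (y k) with hg
  -- The operator of g has its range in X, whose dimension is at most the number of terms.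
  let X := Submodule.span ℝ ((Finset.range R).image x : Set E)
  have hX : Module.finrank ℝ X ≤ R :=
    (finrank_span_finset_le_card _).trans (Finset.card_image_le.trans (Finset.card_range R).le)
  have hgX : ∀ y', ht.op g y' ∈ X := fun y' => by
    rw [hg, op_sum, sum_apply]
    refine Submodule.sum_mem _ fun k hk => ?_
    rw [op_apply_cross]
    exact Submodule.smul_mem _ _
      (Submodule.subset_span (Finset.mem_coe.mpr (Finset.mem_image_of_mem x hk)))
  -- The error at zᵢ is a eᵢ minus an element of X, hence at least the distance of a eᵢ to X.
  -- Summing over i, the projections account for at most dim X ≤ R of the total m.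
  have h1 : ∀ i, a ^ 2 * (1 - ‖X.starProjection (e i)‖ ^ 2) ≤ ‖ht.op (f - g) (z i)‖ ^ 2 := by
    intro i
    have h2 : ht.op (f - g) (z i) = a • e i - ht.op g (z i) := by
      rw [op_sub, sub_apply, hf]
    have h3 := norm_sub_starProjection_le X (a • e i) (hgX (z i))
    have h4 := norm_sub_starProjection_sq X (e i)
    rw [he.1, one_pow] at h4
    rw [h2, ← h4]
    calc a ^ 2 * ‖e i - X.starProjection (e i)‖ ^ 2
        = ‖a • e i - X.starProjection (a • e i)‖ ^ 2 := by
          rw [map_smul, ← smul_sub, norm_smul, mul_pow, Real.norm_eq_abs, sq_abs]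
      _ ≤ _ := by gcongr
  have h5 := Finset.sum_le_sum fun i (_ : i ∈ Finset.univ) => h1 i
  rw [← Finset.mul_sum, Finset.sum_sub_distrib] at h5
  have h6 := sum_norm_starProjection_sq_le X he
  have h7 : (Module.finrank ℝ X : ℝ) ≤ R := by exact_mod_cast hX
  have h8 := ht.sum_norm_op_sq_le' hz (f - g)
  have h9 : ‖f - g‖ ^ 2 ≤ ε ^ 2 := by gcongr
  simp only [Finset.sum_const, Finset.card_univ, Fintype.card_fin, nsmul_eq_mul, mul_one] at h5
  nlinarith [sq_nonneg a]

/-- The operator of the approximating sum maps z to a linear combination of the left factors, which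
stays in V, and the operator norm of the error is at most its norm as a tensor. -/
theorem exists_mem_norm_op_sub_le (ht : IsCross t) {f : H} {z : F} (hz : ‖z‖ = 1) {R : ℕ}
    (V : Submodule ℝ E) (x : ℕ → E) (hx : ∀ k < R, x k ∈ V) (y : ℕ → F) {ε : ℝ}
    (h : ‖f - ∑ k ∈ Finset.range R, t (x k) (y k)‖ ≤ ε) : ∃ w ∈ V, ‖ht.op f z - w‖ ≤ ε := by
  refine ⟨ht.op (∑ k ∈ Finset.range R, t (x k) (y k)) z, ?_, ?_⟩
  · rw [op_sum, sum_apply]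
    refine Submodule.sum_mem _ fun k hk => ?_
    rw [op_apply_cross]
    exact Submodule.smul_mem _ _ (hx k (Finset.mem_range.mp hk))
  · rw [← sub_apply, ← op_sub]
    refine (ContinuousLinearMap.le_opNorm _ _).trans ?_
    rw [hz, mul_one]
    exact (ht.norm_op_le _).trans h

/-! ### Tensors that factor through two inclusions -/

section Sobolev

variable {G₁ G₂ K : Type*} [NormedAddCommGroup G₁] [InnerProductSpace ℝ G₁]
    [NormedAddCommGroup G₂] [InnerProductSpace ℝ G₂]
    [NormedAddCommGroup K] [InnerProductSpace ℝ K]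
    {τ : G₁ →ₗ[ℝ] G₂ →ₗ[ℝ] K} {i₁ : G₁ →L[ℝ] E} {i₂ : G₂ →L[ℝ] F} {j : K →L[ℝ] H}

variable [CompleteSpace F] [CompleteSpace G₁] [CompleteSpace G₂] [CompleteSpace K]

/-- Both sides are continuous and linear in φ and agree on elementary tensors. This factorization is
how smoothness enters: images under the operator of a smooth tensor lie in the range of i₁, with a
quantitative preimage. -/
theorem op_map (ht : IsCross t) (hτ : IsCross τ) (hj : ∀ x y, j (τ x y) = t (i₁ x) (i₂ y))
    (hd : Dense (Submodule.span ℝ {h | ∃ x y, h = τ x y} : Set K)) (φ : K) (y : F) :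
    ht.op (j φ) y = i₁ (hτ.op φ (ContinuousLinearMap.adjoint i₂ y)) := by
  have h : (ContinuousLinearMap.apply ℝ E y).comp (ht.opL.comp j) =
      i₁.comp ((ContinuousLinearMap.apply ℝ G₁ (ContinuousLinearMap.adjoint i₂ y)).comp
        hτ.opL) := by
    refine ContinuousLinearMap.ext_on hd ?_
    rintro _ ⟨x, y', rfl⟩
    simp only [ContinuousLinearMap.comp_apply, ContinuousLinearMap.apply_apply, opL_apply, hj,
      op_apply_cross, map_smul, ContinuousLinearMap.adjoint_inner_left]
  exact DFunLike.congr_fun h φ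

/-- The error of the best approximation of the left singular functions in a subspace. -/
theorem sum_norm_smul_sub_sq_le (ht : IsCross t) (hτ : IsCross τ)
    (hj : ∀ x y, j (τ x y) = t (i₁ x) (i₂ y))
    (hd : Dense (Submodule.span ℝ {h | ∃ x y, h = τ x y} : Set K)) {φ : K} (hφ : ‖φ‖ ≤ 1)
    (hi₂ : ‖i₂‖ ≤ 1) (V : Submodule ℝ E) [V.HasOrthogonalProjection] {η : ℝ}
    (hV : ∀ x, ∃ w ∈ V, ‖i₁ x - w‖ ≤ η * ‖x‖) {N : ℕ} {σ : Fin N → ℝ}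
    {u : Fin N → E} {v : Fin N → F} (hv : Orthonormal ℝ v)
    (h : ∀ k, ht.op (j φ) (v k) = σ k • u k) :
    ∑ k, ‖σ k • (u k - V.starProjection (u k))‖ ^ 2 ≤ η ^ 2 := by
  have h1 : ∀ k, ‖σ k • (u k - V.starProjection (u k))‖ ^ 2 ≤
      η ^ 2 * ‖hτ.op φ (ContinuousLinearMap.adjoint i₂ (v k))‖ ^ 2 := by
    intro k
    -- The product σₖuₖ, and not uₖ alone, is the i₁-image of a vector of controlled norm, so no
    -- division by a small σₖ occurs.
    rw [smul_sub, ← map_smul, ← h k, ht.op_map hτ hj hd, ← mul_pow]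
    obtain ⟨w, hw, hw'⟩ := hV (hτ.op φ (ContinuousLinearMap.adjoint i₂ (v k)))
    have := (norm_sub_starProjection_le V _ hw).trans hw'
    gcongr
  refine (Finset.sum_le_sum fun k _ => h1 k).trans ?_
  rw [← Finset.mul_sum]
  refine mul_le_of_le_one_right (sq_nonneg _) ?_
  refine (hτ.sum_norm_op_sq_le (ContinuousLinearMap.adjoint i₂) hv φ).trans ?_
  rw [LinearIsometryEquiv.norm_map]
  exact mul_le_one₀ (pow_le_one₀ (norm_nonneg _) hi₂) (sq_nonneg _)
    (pow_le_one₀ (norm_nonneg _) hφ)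

/-- The truncation error of the singular value decomposition. -/
theorem norm_sub_truncation_le (ht : IsCross t) (hτ : IsCross τ)
    (hj : ∀ x y, j (τ x y) = t (i₁ x) (i₂ y))
    (hd : Dense (Submodule.span ℝ {h | ∃ x y, h = τ x y} : Set K)) {φ : K} (hφ : ‖φ‖ ≤ 1)
    {σ : ℕ → ℝ} {u : ℕ → E} {v : ℕ → F}
    (hσ : ∀ k, 0 ≤ σ k) (hanti : Antitone σ) (hu : Orthonormal ℝ u) (hv : Orthonormal ℝ v)
    (hf : HasSum (fun k => σ k • t (u k) (v k)) (j φ)) (W₁ : Submodule ℝ E)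
    [FiniteDimensional ℝ W₁] (W₂ : Submodule ℝ F) [FiniteDimensional ℝ W₂] {δ₁ δ₂ : ℝ}
    (hδ₁ : 0 ≤ δ₁) (hδ₂ : 0 ≤ δ₂)
    (hW₁ : ∀ x, ∃ w ∈ W₁, ‖i₁ x - w‖ ≤ δ₁ * ‖x‖) (hW₂ : ∀ y, ∃ w ∈ W₂, ‖i₂ y - w‖ ≤ δ₂ * ‖y‖)
    {R : ℕ} (hR : Module.finrank ℝ W₁ + Module.finrank ℝ W₂ ≤ R) :
    ‖j φ - ∑ k ∈ Finset.range R, σ k • t (u k) (v k)‖ ≤ δ₁ * δ₂ := by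
  set A := ht.op (j φ) with hA
  -- The component of vₖ in W₂ is mapped into X without error. The remaining component passes
  -- through the adjoint of the error of W₂, which gives δ₂, and its image is then approximated in
  -- W₁, which gives δ₁; therefore the errors multiply while the dimensions add.
  let X := W₁ ⊔ W₂.map A.toLinearMap
  have hX : Module.finrank ℝ X ≤ R := by
    refine (Submodule.finrank_add_le_finrank_add_finrank _ _).trans (le_trans ?_ hR)
    gcongr
    exact Submodule.finrank_map_le _ _
  -- The adjoint of this error operator is i₂* applied after the projection to the complement of W₂.
  let B : G₂ →L[ℝ] F := i₂ - W₂.starProjection.comp i₂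
  have hB : ‖B‖ ≤ δ₂ := ContinuousLinearMap.opNorm_le_bound _ hδ₂ fun y => by
    obtain ⟨w, hw, hw'⟩ := hW₂ y
    exact (norm_sub_starProjection_le W₂ _ hw).trans hw'
  have hB' : ∀ y, ContinuousLinearMap.adjoint B y =
      ContinuousLinearMap.adjoint i₂ (y - W₂.starProjection y) := fun y =>
    ext_inner_left ℝ fun z => by
      rw [ContinuousLinearMap.adjoint_inner_right, ContinuousLinearMap.adjoint_inner_right,
        inner_sub_right, ← Submodule.inner_starProjection_left_eq_right, ← inner_sub_left]
      rfl
  refine ht.norm_sub_sum_range_le hσ hanti hu hv hf X hX (by positivity) fun N => ?_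
  rw [Finset.sum_range]
  have h1 : ∀ k, ‖σ k • (u k - X.starProjection (u k))‖ ^ 2 ≤
      δ₁ ^ 2 * ‖hτ.op φ (ContinuousLinearMap.adjoint B (v k))‖ ^ 2 := by
    intro k
    rw [smul_sub, ← map_smul, ← ht.op_apply_of_hasSum hv hf k, ← mul_pow, hB']
    set q := hτ.op φ (ContinuousLinearMap.adjoint i₂ (v k - W₂.starProjection (v k))) with hq
    have hq' : A (v k) - A (W₂.starProjection (v k)) = i₁ q := by
      rw [← map_sub]
      exact ht.op_map hτ hj hd φ _
    obtain ⟨w, hw, hw'⟩ := hW₁ q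
    have hmem : A (W₂.starProjection (v k)) + w ∈ X :=
      Submodule.add_mem _ (Submodule.mem_sup_right (Submodule.mem_map_of_mem
        (f := A.toLinearMap) (W₂.starProjection_apply_mem (v k)))) (Submodule.mem_sup_left hw)
    have h2 := norm_sub_starProjection_le X (A (v k)) hmem
    rw [← sub_sub, hq'] at h2
    have := h2.trans hw'
    gcongr
  refine (Finset.sum_le_sum fun (k : Fin N) _ => h1 k).trans ?_
  rw [← Finset.mul_sum, mul_pow]
  gcongr
  refine (hτ.sum_norm_op_sq_le (ContinuousLinearMap.adjoint B)
    (hv.comp _ (Fin.val_injective (n := N))) φ).trans ?_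
  rw [LinearIsometryEquiv.norm_map]
  calc ‖B‖ ^ 2 * ‖φ‖ ^ 2 ≤ δ₂ ^ 2 * 1 := by
        gcongr
        exact pow_le_one₀ (norm_nonneg _) hφ
    _ = _ := mul_one _

/-- The error of the fully discrete singular value decomposition. -/
theorem norm_sub_discrete_le (ht : IsCross t) (hτ : IsCross τ)
    (hj : ∀ x y, j (τ x y) = t (i₁ x) (i₂ y))
    (hd : Dense (Submodule.span ℝ {h | ∃ x y, h = τ x y} : Set K)) {φ : K} (hφ : ‖φ‖ ≤ 1)
    (hi₁ : ‖i₁‖ ≤ 1) (hi₂ : ‖i₂‖ ≤ 1)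
    {σ : ℕ → ℝ} {u : ℕ → E} {v : ℕ → F}
    (hσ : ∀ k, 0 ≤ σ k) (hanti : Antitone σ) (hu : Orthonormal ℝ u) (hv : Orthonormal ℝ v)
    (hf : HasSum (fun k => σ k • t (u k) (v k)) (j φ)) (W₁ : Submodule ℝ E)
    [FiniteDimensional ℝ W₁] (W₂ : Submodule ℝ F) [FiniteDimensional ℝ W₂] {δ₁ δ₂ : ℝ}
    (hδ₁ : 0 ≤ δ₁) (hδ₂ : 0 ≤ δ₂)
    (hW₁ : ∀ x, ∃ w ∈ W₁, ‖i₁ x - w‖ ≤ δ₁ * ‖x‖) (hW₂ : ∀ y, ∃ w ∈ W₂, ‖i₂ y - w‖ ≤ δ₂ * ‖y‖)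
    {R : ℕ} (hR : Module.finrank ℝ W₁ + Module.finrank ℝ W₂ ≤ R)
    (V₁ : Submodule ℝ E) [V₁.HasOrthogonalProjection] (V₂ : Submodule ℝ F)
    [V₂.HasOrthogonalProjection] {η₁ η₂ : ℝ} (hη₁ : 0 ≤ η₁) (hη₂ : 0 ≤ η₂)
    (hV₁ : ∀ x, ∃ w ∈ V₁, ‖i₁ x - w‖ ≤ η₁ * ‖x‖) (hV₂ : ∀ y, ∃ w ∈ V₂, ‖i₂ y - w‖ ≤ η₂ * ‖y‖) :
    ‖j φ - ∑ k ∈ Finset.range R, σ k • t (V₁.starProjection (u k)) (V₂.starProjection (v k))‖ ≤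
      δ₁ * δ₂ + η₁ + η₂ := by
  have h0 := ht.norm_sub_truncation_le hτ hj hd hφ hσ hanti hu hv hf W₁ W₂ hδ₁ hδ₂ hW₁ hW₂ hR
  have hv' := hv.comp _ (Fin.val_injective (n := R))
  have hu' := hu.comp _ (Fin.val_injective (n := R))
  have hd' : Dense (Submodule.span ℝ {h | ∃ x y, h = τ.flip x y} : Set K) := by
    convert hd using 4
    ext h
    constructor
    · rintro ⟨x, y, rfl⟩; exact ⟨y, x, rfl⟩
    · rintro ⟨x, y, rfl⟩; exact ⟨y, x, rfl⟩
  have h1 : ‖∑ k : Fin R, t (σ k • (u k - V₁.starProjection (u k))) (v k)‖ ≤ η₁ := by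
    refine le_of_sq_le_sq ?_ hη₁
    have h2 := ht.norm_sum_sq hv' fun k : Fin R => σ k • (u k - V₁.starProjection (u k))
    refine h2.trans_le ?_
    exact ht.sum_norm_smul_sub_sq_le hτ hj hd hφ hi₂ V₁ hV₁ hv' (u := u ∘ Fin.val)
      (σ := σ ∘ Fin.val) fun k => ht.op_apply_of_hasSum hv hf k
  have h2 : ‖∑ k : Fin R, t (V₁.starProjection (u k))
      (σ k • (v k - V₂.starProjection (v k)))‖ ≤ η₂ := by
    refine le_of_sq_le_sq ?_ hη₂
    -- The projected uₖ are no longer orthonormal, but they are images of an orthonormal system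
    -- under a contraction, which is enough.
    have h3 := ht.flip.norm_sum_sq_le V₁.starProjection hu'
      fun k : Fin R => σ k • (v k - V₂.starProjection (v k))
    refine h3.trans ?_
    have h4 := ht.flip.sum_norm_smul_sub_sq_le hτ.flip (fun x y => hj y x) hd' hφ hi₁ V₂ hV₂ hu'
      (u := v ∘ Fin.val) (σ := σ ∘ Fin.val) fun k =>
        ht.flip.op_apply_of_hasSum hu (by simpa using hf) k
    refine (mul_le_of_le_one_left (Finset.sum_nonneg fun _ _ => sq_nonneg _) ?_).trans h4
    exact pow_le_one₀ (norm_nonneg _) V₁.starProjection_norm_le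
  -- The error is split into truncation, replacement of the uₖ next to the exact vₖ, and replacement
  -- of the vₖ next to the already projected uₖ.
  have h3 : j φ - ∑ k ∈ Finset.range R,
      σ k • t (V₁.starProjection (u k)) (V₂.starProjection (v k)) =
      (j φ - ∑ k ∈ Finset.range R, σ k • t (u k) (v k)) +
      ∑ k : Fin R, t (σ k • (u k - V₁.starProjection (u k))) (v k) +
      ∑ k : Fin R, t (V₁.starProjection (u k)) (σ k • (v k - V₂.starProjection (v k))) := by
    rw [Finset.sum_range, Finset.sum_range, add_assoc, ← Finset.sum_add_distrib,
      sub_add, ← Finset.sum_sub_distrib]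
    congr 1
    refine Finset.sum_congr rfl fun k _ => ?_
    simp only [map_smul, map_sub, LinearMap.smul_apply, LinearMap.sub_apply, smul_sub]
    abel
  rw [h3]
  exact (norm_add_le _ _).trans (add_le_add ((norm_add_le _ _).trans (add_le_add h0 h1)) h2)

end Sobolev

end IsCross

/-! ### Sobolev functions on the Fourier side -/

section Fourier

open scoped BoundedContinuousFunction FourierTransform SchwartzMap

/-- A function in `Hˢ(ℝⁿ)` as a complex-valued function. -/
def HsRn.toComplex {n : ℕ} {s : ℝ} (U : HsRn n s) : Lp ℂ 2 (volume : Measure (Eucl n)) :=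
  Complex.ofRealCLM.compLp (HsRn.incl n s U)

theorem HsRn.coeFn_toComplex {n : ℕ} {s : ℝ} (U : HsRn n s) :
    U.toComplex =ᵐ[volume] fun x => ((HsRn.incl n s U x : ℝ) : ℂ) :=
  Complex.ofRealCLM.coeFn_compLp (HsRn.incl n s U)

theorem HsRn.coeFn_restrict {n : ℕ} (Ω : Set (Eucl n)) {s : ℝ} (U : HsRn n s) :
    HsRn.restrict Ω s U =ᵐ[volume.restrict Ω] HsRn.incl n s U :=
  LpToLpRestrictCLM_coeFn ℝ Ω (HsRn.incl n s U)

/-- The Bessel potential is inverted by the multiplier of order -s. For s ≥ 0 this multiplier is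
bounded by 1, so the identity of distributions becomes one of L² functions that can be read
pointwise almost everywhere. -/
theorem HsRn.fourier_toComplex {n : ℕ} {s : ℝ} (hs : 0 ≤ s) (U : HsRn n s) :
    (𝓕 U.toComplex : Lp ℂ 2 (volume : Measure (Eucl n))) =ᵐ[volume]
      fun ξ => (((1 + ‖ξ‖ ^ 2) ^ (-s / 2) : ℝ) : ℂ) *
        (𝓕 (HsRn.potential n s U) : Lp ℂ 2 (volume : Measure (Eucl n))) ξ := by
  let g : Eucl n → ℂ := fun x => ((1 + ‖x‖ ^ 2) ^ (-s / 2) : ℝ)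
  have hg : g.HasTemperateGrowth := by
    change Function.HasTemperateGrowth fun x : Eucl n => (((1 + ‖x‖ ^ 2) ^ (-s / 2) : ℝ) : ℂ)
    fun_prop
  have hg1 : ∀ x, ‖g x‖ ≤ 1 := by
    intro x
    rw [Complex.norm_real, Real.norm_eq_abs, abs_eq_self.mpr (by positivity)]
    exact Real.rpow_le_one_of_one_le_of_nonpos (by simp) (by linarith)
  let g' : Eucl n →ᵇ ℂ := BoundedContinuousFunction.ofNormedAddCommGroup g hg.1.continuous 1 hg1
  let G := HsRn.potential n s U
  have e : U.toComplex = 𝓕⁻ ((g'.memLp_top.toLp _ (μ := volume)) • 𝓕 G) := by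
    apply toTemperedDistribution_injective n
    have h1 := congrArg (besselPotential (Eucl n) ℂ (-s)) (HsRn.potentialFun_spec U)
    rw [besselPotential_besselPotential_apply, add_neg_cancel, besselPotential_zero,
      ContinuousLinearMap.id_apply] at h1
    refine h1.trans ?_
    rw [Lp.toTemperedDistributionCLM_apply, Lp.toTemperedDistributionCLM_apply,
      ← Lp.fourierInv_toTemperedDistribution_eq,
      Lp.toTemperedDistribution_smul_eq (by apply hg), ← Lp.fourier_toTemperedDistribution_eq,
      besselPotential, TemperedDistribution.fourierMultiplierCLM_apply]
    rfl
  have e' : 𝓕 U.toComplex = (g'.memLp_top.toLp _ (μ := volume)) • 𝓕 G := by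
    rw [e]
    exact FourierTransform.fourier_fourierInv_eq _
  rw [e']
  have e2 := Lp.coeFn_lpSMul (r := 2) (g'.memLp_top.toLp _ (μ := volume)) (𝓕 G)
  filter_upwards [e2, g'.memLp_top.coeFn_toLp (μ := volume)] with ξ h1 h2
  rw [h1, Pi.smul_apply', h2]
  rfl

theorem norm_sq_eq_integral {α E : Type*} [MeasurableSpace α] {μ : Measure α}
    [NormedAddCommGroup E] (f : Lp E 2 μ) : ‖f‖ ^ 2 = ∫ x, ‖f x‖ ^ 2 ∂μ := by
  rw [Lp.norm_def, (Lp.memLp f).eLpNorm_eq_integral_rpow_norm two_ne_zero ENNReal.ofNat_ne_top,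
    ENNReal.toReal_ofReal (by positivity)]
  simp only [ENNReal.toReal_ofNat, Real.rpow_two]
  rw [← Real.rpow_two, ← Real.rpow_mul (integral_nonneg fun _ => by positivity)]
  norm_num

theorem integrable_norm_sq {α E : Type*} [MeasurableSpace α] {μ : Measure α}
    [NormedAddCommGroup E] (f : Lp E 2 μ) : Integrable (fun x => ‖f x‖ ^ 2) μ :=
  (memLp_two_iff_integrable_sq_norm (Lp.aestronglyMeasurable f)).mp (Lp.memLp f)

theorem HsRn.norm_sq_fourier_potential {n : ℕ} {s : ℝ} (hs : 0 ≤ s) (U : HsRn n s) :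
    (fun ξ => ‖(𝓕 (HsRn.potential n s U) : Lp ℂ 2 (volume : Measure (Eucl n))) ξ‖ ^ 2) =ᵐ[volume]
      fun ξ => (1 + ‖ξ‖ ^ 2) ^ s * ‖(𝓕 U.toComplex : Lp ℂ 2 (volume : Measure (Eucl n))) ξ‖ ^ 2 := by
  filter_upwards [HsRn.fourier_toComplex hs U] with ξ h
  have h0 : (0 : ℝ) < 1 + ‖ξ‖ ^ 2 := by positivity
  rw [h, norm_mul, mul_pow, Complex.norm_real, Real.norm_of_nonneg (by positivity), ← mul_assoc,
    ← Real.rpow_natCast (_ ^ (-s / 2)), ← Real.rpow_mul h0.le, ← Real.rpow_add h0]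
  simp

theorem HsRn.integrable_fourier {n : ℕ} {s : ℝ} (hs : 0 ≤ s) (U : HsRn n s) :
    Integrable (fun ξ => (1 + ‖ξ‖ ^ 2) ^ s * ‖(𝓕 U.toComplex : Lp ℂ 2 (volume : Measure (Eucl n))) ξ‖ ^ 2) volume :=
  (integrable_norm_sq _).congr (HsRn.norm_sq_fourier_potential hs U)

theorem HsRn.norm_sq_eq {n : ℕ} {s : ℝ} (hs : 0 ≤ s) (U : HsRn n s) :
    ‖U‖ ^ 2 = ∫ ξ, (1 + ‖ξ‖ ^ 2) ^ s * ‖(𝓕 U.toComplex : Lp ℂ 2 (volume : Measure (Eucl n))) ξ‖ ^ 2 := by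
  rw [HsRn.norm_def, ← Lp.norm_fourier_eq, norm_sq_eq_integral]
  exact integral_congr_ae (HsRn.norm_sq_fourier_potential hs U)

theorem HsRn.exists_incl_eq {n : ℕ} {s : ℝ} (R : Lp ℝ 2 (volume : Measure (Eucl n)))
    (hR : MemSobolev s 2 (toDistribution n R)) : ∃ U : HsRn n s, HsRn.incl n s U = R :=
  ⟨⟨R, hR⟩, rfl⟩

/-- The source of the explicit test functions: both the waves of the inverse estimate and the
cut-off coordinate powers enter the Sobolev space this way. -/
theorem HsRn.exists_toComplex_eq {n : ℕ} (s : ℝ) (φ : 𝓢(Eucl n, ℂ)) (hφ : ∀ x, (φ x).im = 0) :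
    ∃ U : HsRn n s, U.toComplex = φ.toLp 2 := by
  let R : Lp ℝ 2 (volume : Measure (Eucl n)) := Complex.reCLM.compLp (φ.toLp 2)
  have h1 : Complex.ofRealCLM.compLp R = φ.toLp 2 := by
    apply Lp.ext
    filter_upwards [Complex.ofRealCLM.coeFn_compLp R,
      Complex.reCLM.coeFn_compLp (φ.toLp 2 (volume : Measure (Eucl n))),
      φ.coeFn_toLp 2 (volume : Measure (Eucl n))] with x h1 h2 h3
    rw [h1, h2, h3]
    exact Complex.ext rfl (hφ x).symm
  obtain ⟨U, hU⟩ := HsRn.exists_incl_eq (s := s) R (by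
    change MemSobolev s 2 (Lp.toTemperedDistribution (Complex.ofRealCLM.compLp R))
    rw [h1, Lp.toTemperedDistribution_toLp_eq]
    exact φ.memSobolev)
  exact ⟨U, (congrArg _ hU).trans h1⟩

/-- The inclusion `Hˢ(ℝⁿ) ⊂ Hᵗ(ℝⁿ)` for `t ≤ s`. -/
theorem HsRn.exists_of_le {n : ℕ} {s t : ℝ} (ht : 0 ≤ t) (hts : t ≤ s) (U : HsRn n s) :
    ∃ U' : HsRn n t, HsRn.incl n t U' = HsRn.incl n s U ∧ ‖U'‖ ≤ ‖U‖ := by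
  have hU : MemSobolev s 2 (toDistribution n (HsRn.incl n s U)) := U.2
  obtain ⟨U', hU'⟩ := HsRn.exists_incl_eq _ (hU.mono hts)
  refine ⟨U', hU', ?_⟩
  have h0 : U'.toComplex = U.toComplex := congrArg _ hU'
  refine le_of_sq_le_sq ?_ (norm_nonneg _)
  rw [HsRn.norm_sq_eq ht, HsRn.norm_sq_eq (ht.trans hts), h0]
  refine integral_mono_ae (h0 ▸ HsRn.integrable_fourier ht U')
    (HsRn.integrable_fourier (ht.trans hts) U) (Filter.Eventually.of_forall fun ξ => ?_)
  dsimp only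
  gcongr
  simp

end Fourier

/-! ### Sobolev functions on Ω and their approximation in the single-scale spaces -/

theorem HsRn.restrict_apply {n : ℕ} (Ω : Set (Eucl n)) {s : ℝ} (U : HsRn n s) :
    HsRn.restrict Ω s U = LpToLpRestrictCLM (Eucl n) ℝ ℝ volume 2 Ω (HsRn.incl n s U) := rfl

theorem Hs.exists_extension {n : ℕ} {Ω : Set (Eucl n)} {s : ℝ} (u : Hs Ω s) :
    ∃ U : HsRn n s, HsRn.restrict Ω s U = Hs.toL2 Ω s u ∧ ‖U‖ = ‖u‖ :=
  ⟨u.1, rfl, rfl⟩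

/-- The inclusion `Hˢ(Ω) ⊂ Hᵗ(Ω)` for `t ≤ s`. -/
theorem Hs.exists_of_le {n : ℕ} {Ω : Set (Eucl n)} {s t : ℝ} (ht : 0 ≤ t) (hts : t ≤ s)
    (u : Hs Ω s) : ∃ u' : Hs Ω t, Hs.toL2 Ω t u' = Hs.toL2 Ω s u ∧ ‖u'‖ ≤ ‖u‖ := by
  obtain ⟨U, h1, h2⟩ := Hs.exists_extension u
  obtain ⟨U', h3, h4⟩ := HsRn.exists_of_le ht hts U
  obtain ⟨u', h5, h6⟩ := Hs.exists_of_extension Ω ht U'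
  refine ⟨u', ?_, ?_⟩
  · rw [h5, ← h1, HsRn.restrict_apply, HsRn.restrict_apply, h3]
  · rw [← h2]
    exact h6.trans h4

theorem norm_sub_starProjection_le_infDist {E : Type*} [NormedAddCommGroup E]
    [InnerProductSpace ℝ E] (V : Submodule ℝ E) [V.HasOrthogonalProjection] (x : E) :
    ‖x - V.starProjection x‖ ≤ Metric.infDist x (V : Set E) :=
  (Metric.le_infDist ⟨0, V.zero_mem⟩).2 fun v hv => by
    rw [dist_eq_norm]
    exact norm_sub_starProjection_le _ _ hv

theorem meshWidth_pos (j : ℕ) : 0 < meshWidth j := by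
  unfold meshWidth
  positivity

/-- Smoothness beyond the polynomial exactness r cannot be used: for s > r the function is first
regarded as an element of the space of order r. -/
theorem IsMultiscale.exists_close {n : ℕ} {Ω : Set (Eucl n)} {r : ℕ}
    {V : ℕ → Submodule ℝ (L2 Ω)} (hV : IsMultiscale Ω r V) {s : ℝ} (hs : 0 < s) :
    ∃ C : ℝ, 0 < C ∧ ∀ (j : ℕ) (u : Hs Ω s), ∃ v ∈ V j,
      ‖Hs.toL2 Ω s u - v‖ ≤ C * meshWidth j ^ min s r * ‖u‖ := by
  have ht : 0 ≤ min s r := le_min hs.le r.cast_nonneg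
  obtain ⟨C, hC⟩ := hV.approx (min s r) ht (min_le_right _ _)
  have hC1 : 0 < max C 1 := lt_max_of_lt_right one_pos
  refine ⟨max C 1, hC1, fun j u => ?_⟩
  obtain ⟨u', h1, h2⟩ := Hs.exists_of_le ht (min_le_left s r) u
  have := hV.finiteDimensional j
  refine ⟨(V j).starProjection (Hs.toL2 Ω s u), Submodule.starProjection_apply_mem _ _, ?_⟩
  have h3 := norm_sub_starProjection_le_infDist (V j) (Hs.toL2 Ω s u)
  have h4 := hC j u'
  rw [h1] at h4
  refine h3.trans (h4.trans ?_)
  have h5 : 0 ≤ meshWidth j ^ min s (r : ℝ) := Real.rpow_nonneg (meshWidth_pos j).le _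
  exact mul_le_mul (mul_le_mul_of_nonneg_right (le_max_left _ _) h5) h2 (norm_nonneg _)
    (mul_nonneg hC1.le h5)

/-! ### Fourier series on cubes -/

section Cube

open scoped FourierTransform RealInnerProductSpace
open UnitAddTorus

attribute [local instance] instMeasureSpaceUnitAddCircle

/-- The half-open cube with corner `a` and side length `T`. -/
def cube {n : ℕ} (T : ℝ) (a : Fin n → ℝ) : Set (Eucl n) :=
  {x | ∀ i, x i ∈ Set.Ioc (a i) (a i + T)}

/-- The frequencies of the functions of period `T`. -/
def freq {n : ℕ} (T : ℝ) (k : Fin n → ℤ) : Eucl n :=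
  WithLp.toLp 2 fun i => k i / T

theorem measurableSet_cube {n : ℕ} (T : ℝ) (a : Fin n → ℝ) : MeasurableSet (cube T a) := by
  have : cube T a = ⋂ i, (fun x : Eucl n => x i) ⁻¹' Set.Ioc (a i) (a i + T) := by
    ext x
    simp [cube]
  rw [this]
  exact MeasurableSet.iInter fun i =>
    (by fun_prop : Measurable fun x : Eucl n => x i) measurableSet_Ioc

/-- Carries Fourier series from the unit torus to a cube: h takes the representative in the unit box
with corner a / T and dilates it by T. Haar measure becomes normalized Lebesgue measure, and the
characters become plane waves with frequencies in ℤⁿ / T. -/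
theorem exists_torus_map {n : ℕ} {T : ℝ} (hT : 0 < T) (a : Fin n → ℝ) :
    ∃ h : UnitAddTorus (Fin n) → Eucl n, Measurable h ∧
      Measure.map h volume = ENNReal.ofReal (T ^ n)⁻¹ • volume.restrict (cube T a) ∧
      ∀ (k : Fin n → ℤ) (y : UnitAddTorus (Fin n)),
        mFourier (-k) y = (𝐞 (-⟪h y, freq T k⟫) : ℂ) := by
  let b : Fin n → ℝ := fun i => a i / T
  let D : (Fin n → ℝ) → Eucl n := fun z => T • WithLp.toLp 2 z
  have hD : Measurable D := by
    change Measurable fun z : Fin n → ℝ => T • (WithLp.toLp 2 z : Eucl n)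
    fun_prop
  let S : Set (Fin n → ℝ) := {x | ∀ i, x i ∈ Set.Ioc (b i) (b i + 1)}
  have hS : MeasurableSet S := MeasurableSet.univ_pi' fun i => measurableSet_Ioc
  have hDS : D ⁻¹' cube T a = S := by
    ext z
    refine forall_congr' fun i => ?_
    change T * z i ∈ Set.Ioc (a i) (a i + T) ↔ z i ∈ Set.Ioc (a i / T) (a i / T + 1)
    rw [Set.mem_Ioc, Set.mem_Ioc, div_lt_iff₀' hT, div_add_one hT.ne', le_div_iff₀' hT]
  have hvol : Measure.map D volume = ENNReal.ofReal (T ^ n)⁻¹ • volume := by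
    have h1 := Measure.map_addHaar_smul (volume : Measure (Eucl n)) hT.ne'
    rw [finrank_euclideanSpace_fin, abs_of_pos (by positivity)] at h1
    rw [← h1, ← (PiLp.volume_preserving_toLp (Fin n)).map_eq,
      Measure.map_map (by fun_prop) (by fun_prop)]
    rfl
  have hmp := measurePreserving_equivPiIoc b
  refine ⟨fun y => D (measurableEquivPiIoc b y).1,
    hD.comp (measurable_subtype_coe.comp (measurableEquivPiIoc b).measurable), ?_, fun k y => ?_⟩
  · have h1 : (fun y => D (measurableEquivPiIoc b y).1) =
        D ∘ (Subtype.val ∘ measurableEquivPiIoc b) := rfl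
    rw [h1, ← Measure.map_map hD (measurable_subtype_coe.comp (measurableEquivPiIoc b).measurable),
      ← Measure.map_map measurable_subtype_coe (measurableEquivPiIoc b).measurable, hmp.map_eq]
    have h2 := map_comap_subtype_coe hS volume
    refine (congrArg (Measure.map D) h2).trans ?_
    rw [← hDS, ← Measure.restrict_map hD (measurableSet_cube T a), hvol, Measure.restrict_smul]
  · have h1 : ∀ i, y i = (((measurableEquivPiIoc b y).1 i : ℝ) : UnitAddCircle) := fun i =>
      AddCircle.coe_equivIoc.symm
    have h2 : ⟪D (measurableEquivPiIoc b y).1, freq T k⟫ =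
        ∑ i, k i * (measurableEquivPiIoc b y).1 i := by
      simp only [D, freq, PiLp.inner_apply, PiLp.smul_apply, RCLike.inner_apply, conj_trivial,
        smul_eq_mul]
      exact Finset.sum_congr rfl fun i _ => by field_simp
    rw [h2, Real.fourierChar_apply]
    change ∏ i, fourier (-k i) (y i) = _
    rw [Finset.prod_congr rfl fun i _ => congrArg (fourier (-k i)) (h1 i)]
    simp only [fourier_coe_apply]
    rw [← Complex.exp_sum]
    congr 1
    push_cast
    rw [mul_neg, neg_mul, Finset.mul_sum, Finset.sum_mul, ← Finset.sum_neg_distrib]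
    exact Finset.sum_congr rfl fun i _ => by ring

/-- Parseval's identity on the torus for g ∘ h. The integrals are not normalized here; the
coefficients contribute (Tⁿ)² and the norm T⁻ⁿ, which leaves the factor Tⁿ. -/
theorem hasSum_norm_sq_cube {n : ℕ} {T : ℝ} (hT : 0 < T) (a : Fin n → ℝ) {g : Eucl n → ℂ}
    (hg : MemLp g 2 (volume.restrict (cube T a))) :
    HasSum (fun k : Fin n → ℤ => ‖∫ x in cube T a, 𝐞 (-⟪x, freq T k⟫) • g x‖ ^ 2)
      (T ^ n * ∫ x in cube T a, ‖g x‖ ^ 2) := by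
  obtain ⟨h, hm, hmap, hF⟩ := exists_torus_map hT a
  have hc : ENNReal.ofReal (T ^ n)⁻¹ ≠ ∞ := ENNReal.ofReal_ne_top
  have hT0 : (0 : ℝ) < T ^ n := by positivity
  have hr : (ENNReal.ofReal (T ^ n)⁻¹).toReal = (T ^ n)⁻¹ :=
    ENNReal.toReal_ofReal (by positivity)
  have hg' : MemLp g 2 (Measure.map h volume) := by
    rw [hmap]
    exact hg.smul_measure hc
  have hf : MemLp (g ∘ h) 2 volume := (memLp_map_measure_iff hg'.1 hm.aemeasurable).mp hg'
  have key := hasSum_sq_mFourierCoeff (hf.toLp (g ∘ h))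
  have h1 : ∫ t, ‖(hf.toLp (g ∘ h)) t‖ ^ 2 = (T ^ n)⁻¹ * ∫ x in cube T a, ‖g x‖ ^ 2 := by
    have e1 : ∫ t, ‖(hf.toLp (g ∘ h)) t‖ ^ 2 = ∫ t, ‖g (h t)‖ ^ 2 := by
      refine integral_congr_ae ?_
      filter_upwards [hf.coeFn_toLp] with t ht
      rw [ht]
      rfl
    have e2 := integral_map (μ := volume) hm.aemeasurable (f := fun x => ‖g x‖ ^ 2)
      (hg'.1.norm.pow 2)
    rw [e1, ← e2, hmap, integral_smul_measure, hr, smul_eq_mul]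
  have h2 : ∀ k, mFourierCoeff (hf.toLp (g ∘ h)) k =
      (T ^ n)⁻¹ • ∫ x in cube T a, 𝐞 (-⟪x, freq T k⟫) • g x := by
    intro k
    have e1 : mFourierCoeff (hf.toLp (g ∘ h)) k = ∫ t, 𝐞 (-⟪h t, freq T k⟫) • g (h t) := by
      refine integral_congr_ae ?_
      filter_upwards [hf.coeFn_toLp] with t ht
      rw [ht, hF, Circle.smul_def]
      rfl
    have e2 := integral_map (μ := volume) hm.aemeasurable
      (f := fun x => 𝐞 (-⟪x, freq T k⟫) • g x) (by
        have : Continuous fun x : Eucl n => 𝐞 (-⟪x, freq T k⟫) := by fun_prop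
        exact this.aestronglyMeasurable.smul hg'.1)
    rw [e1, ← e2, hmap, integral_smul_measure, hr]
  rw [h1] at key
  have h3 : T ^ n * ∫ x in cube T a, ‖g x‖ ^ 2 =
      (T ^ n) ^ 2 * ((T ^ n)⁻¹ * ∫ x in cube T a, ‖g x‖ ^ 2) := by
    field_simp
  rw [h3]
  refine (key.mul_left ((T ^ n) ^ 2)).congr_fun fun k => ?_
  rw [h2, norm_smul, mul_pow, norm_inv, inv_pow, Real.norm_of_nonneg hT0.le]
  field_simp

theorem volume_real_cube {n : ℕ} {T : ℝ} (hT : 0 < T) (a : Fin n → ℝ) :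
    volume.real (cube T a) = T ^ n := by
  obtain ⟨h, hm, hmap, hF⟩ := exists_torus_map hT a
  have h1 := congrArg (fun μ : Measure (Eucl n) => μ.real Set.univ) hmap
  have : IsProbabilityMeasure (volume : Measure (UnitAddTorus (Fin n))) := by
    have : IsProbabilityMeasure (volume : Measure UnitAddCircle) :=
      inferInstanceAs (IsProbabilityMeasure AddCircle.haarAddCircle)
    infer_instance
  simp only [measureReal_ennreal_smul_apply, measureReal_restrict_apply_univ] at h1
  rw [map_measureReal_apply hm MeasurableSet.univ, Set.preimage_univ, probReal_univ,
    ENNReal.toReal_ofReal (by positivity)] at h1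
  field_simp at h1
  exact h1.symm

theorem isFiniteMeasure_cube {n : ℕ} {T : ℝ} (hT : 0 < T) (a : Fin n → ℝ) :
    IsFiniteMeasure (volume.restrict (cube T a)) := by
  have hvol := volume_real_cube hT a
  refine ⟨?_⟩
  rw [Measure.restrict_apply_univ]
  refine lt_top_iff_ne_top.mpr fun h => ?_
  rw [measureReal_def, h, ENNReal.toReal_top] at hvol
  exact absurd hvol.symm (by positivity)

/-- Orthogonality comes from Parseval without computing an exponential integral: the l-th
coefficient of the l-th wave already exhausts its norm, so all other coefficients vanish. -/
theorem integral_cube {n : ℕ} {T : ℝ} (hT : 0 < T) (a : Fin n → ℝ) (k l : Fin n → ℤ) :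
    ∫ x in cube T a, 𝐞 (-⟪x, freq T k⟫) • (𝐞 ⟪x, freq T l⟫ : ℂ) =
      if k = l then (T : ℂ) ^ n else 0 := by
  have hvol := volume_real_cube hT a
  have := isFiniteMeasure_cube hT a
  have hdiag : ∀ k : Fin n → ℤ,
      ∫ x in cube T a, 𝐞 (-⟪x, freq T k⟫) • (𝐞 ⟪x, freq T k⟫ : ℂ) = (T : ℂ) ^ n := by
    intro k
    have h1 : ∀ x : Eucl n, 𝐞 (-⟪x, freq T k⟫) • (𝐞 ⟪x, freq T k⟫ : ℂ) = 1 := by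
      intro x
      rw [Circle.smul_def, smul_eq_mul, ← Circle.coe_mul, ← AddChar.map_add_eq_mul]
      simp
    simp only [h1]
    rw [setIntegral_const, hvol]
    simp
  split_ifs with hkl
  · rw [← hkl]
    exact hdiag k
  · have hmem : MemLp (fun x : Eucl n => (𝐞 ⟪x, freq T l⟫ : ℂ)) 2 (volume.restrict (cube T a)) := by
      refine MemLp.of_bound ?_ 1 (Filter.Eventually.of_forall fun x => (Circle.norm_coe _).le)
      exact (by fun_prop : Continuous fun x : Eucl n => (𝐞 ⟪x, freq T l⟫ : ℂ)).aestronglyMeasurable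
    have key := hasSum_norm_sq_cube hT a hmem
    have h1 : T ^ n * ∫ x in cube T a, ‖(𝐞 ⟪x, freq T l⟫ : ℂ)‖ ^ 2 = (T ^ n) ^ 2 := by
      simp only [Circle.norm_coe, one_pow]
      rw [setIntegral_const, hvol]
      simp [sq]
    rw [h1] at key
    have h2 := sum_le_hasSum {k, l} (fun i _ => by positivity) key
    rw [Finset.sum_pair hkl, hdiag l] at h2
    have h3 : ‖(T : ℂ) ^ n‖ ^ 2 = (T ^ n) ^ 2 := by
      rw [norm_pow, Complex.norm_real, Real.norm_of_nonneg hT.le]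
    rw [h3] at h2
    exact norm_eq_zero.mp (pow_eq_zero_iff two_ne_zero |>.mp
      (le_antisymm (by linarith) (by positivity)))

end Cube

/-! ### Band-limited waves -/

section Waves

open scoped FourierTransform RealInnerProductSpace SchwartzMap

theorem HsRn.toComplex_sum {n : ℕ} {s : ℝ} {ι : Type*} [Fintype ι] (c : ι → ℝ)
    (U : ι → HsRn n s) :
    HsRn.toComplex (∑ k, c k • U k) = ∑ k, c k • (U k).toComplex := by
  have h1 : HsRn.incl n s (∑ k, c k • U k) = ∑ k, c k • HsRn.incl n s (U k) := by
    simp only [map_sum, map_smul]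
  have h2 := map_sum (Complex.ofRealCLM.compLpL 2 (volume : Measure (Eucl n)))
    (fun k => c k • HsRn.incl n s (U k)) Finset.univ
  simp only [map_smul] at h2
  rw [HsRn.toComplex, h1]
  exact h2

theorem fourier_sum {n : ℕ} {ι : Type*} [Fintype ι] (c : ι → ℝ)
    (f : ι → Lp ℂ 2 (volume : Measure (Eucl n))) :
    𝓕 (∑ k, c k • f k) = ∑ k, c k • 𝓕 (f k) := by
  have h1 := map_sum (Lp.fourierTransformₗᵢ (Eucl n) ℂ) (fun k => (c k : ℂ) • f k) Finset.univ
  simp only [map_smul] at h1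
  exact h1

theorem coeFn_sum_smul {α E : Type*} [MeasurableSpace α] {μ : Measure α} [NormedAddCommGroup E]
    [NormedSpace ℝ E] {ι : Type*} [Fintype ι] (c : ι → ℝ) (f : ι → Lp E 2 μ) :
    (∑ k, c k • f k : Lp E 2 μ) =ᵐ[μ] fun x => ∑ k, c k • f k x := by
  classical
  have h1 : ∀ t : Finset ι, (∑ k ∈ t, c k • f k : Lp E 2 μ) =ᵐ[μ] fun x => ∑ k ∈ t, c k • f k x := by
    intro t
    induction t using Finset.induction_on with
    | empty =>
      simp only [Finset.sum_empty]
      exact Lp.coeFn_zero E 2 μ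
    | insert k t hk ih =>
      rw [Finset.sum_insert hk]
      filter_upwards [Lp.coeFn_add (c k • f k) (∑ k ∈ t, c k • f k), Lp.coeFn_smul (c k) (f k),
        ih] with x h1 h2 h3
      rw [h1, Pi.add_apply, h2, h3, Finset.sum_insert hk, Pi.smul_apply]
  exact h1 Finset.univ

/-- The inverse Fourier transform of an even function. -/
def cosTransform {n : ℕ} (b : Eucl n → ℝ) (x : Eucl n) : ℝ :=
  ∫ ξ, Real.cos (2 * Real.pi * ⟪ξ, x⟫) * b ξ

theorem integrable_fourierChar_bump {n : ℕ} (b : ContDiffBump (0 : Eucl n)) (x : Eucl n) :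
    Integrable fun ξ => 𝐞 ⟪ξ, x⟫ • (b ξ : ℂ) := by
  refine Continuous.integrable_of_hasCompactSupport ?_ ?_
  · have := b.continuous
    fun_prop
  · refine b.hasCompactSupport.mono fun ξ hξ => ?_
    rw [Function.mem_support] at hξ ⊢
    rintro h
    simp [h] at hξ

theorem fourierChar_eq (t : ℝ) : (𝐞 t : ℂ) =
    (Real.cos (2 * Real.pi * t) : ℂ) + (Real.sin (2 * Real.pi * t) : ℂ) * Complex.I := by
  rw [Real.fourierChar_apply, Complex.exp_mul_I, Complex.ofReal_cos, Complex.ofReal_sin]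

/-- The bump is even, so the sine part integrates to zero. -/
theorem integral_fourierChar_bump {n : ℕ} (b : ContDiffBump (0 : Eucl n)) (x : Eucl n) :
    ∫ ξ, 𝐞 ⟪ξ, x⟫ • (b ξ : ℂ) = cosTransform b x := by
  have hre : ∀ ξ, RCLike.re (𝐞 ⟪ξ, x⟫ • (b ξ : ℂ)) = Real.cos (2 * Real.pi * ⟪ξ, x⟫) * b ξ := by
    intro ξ
    rw [Circle.smul_def, smul_eq_mul, fourierChar_eq]
    simp [-Complex.ofReal_cos, -Complex.ofReal_sin]
  have him : ∀ ξ, RCLike.im (𝐞 ⟪ξ, x⟫ • (b ξ : ℂ)) = Real.sin (2 * Real.pi * ⟪ξ, x⟫) * b ξ := by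
    intro ξ
    rw [Circle.smul_def, smul_eq_mul, fourierChar_eq]
    simp [-Complex.ofReal_cos, -Complex.ofReal_sin]
  rw [← integral_re_add_im (integrable_fourierChar_bump b x)]
  simp only [hre, him]
  have hodd : ∫ ξ, Real.sin (2 * Real.pi * ⟪ξ, x⟫) * b ξ = 0 := by
    have h1 := integral_neg_eq_self (fun ξ => Real.sin (2 * Real.pi * ⟪ξ, x⟫) * b ξ)
      (volume : Measure (Eucl n))
    simp only [inner_neg_left, mul_neg, Real.sin_neg, b.neg, neg_mul] at h1
    rw [integral_neg] at h1
    linarith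
  rw [hodd]
  simp [cosTransform]

/-- On the support of b the phase is at most π/3 in absolute value, where the cosine is at least
1/2. The envelope of the waves is thus bounded below near the origin. -/
theorem le_cosTransform {n : ℕ} (b : ContDiffBump (0 : Eucl n)) {x : Eucl n}
    (hx : b.rOut * ‖x‖ ≤ 1 / 6) : (1 / 2) * ∫ ξ, b ξ ≤ cosTransform b x := by
  rw [← integral_const_mul]
  refine integral_mono_of_nonneg (Filter.Eventually.of_forall fun ξ => ?_) ?_
    (Filter.Eventually.of_forall fun ξ => ?_)
  · exact mul_nonneg (by norm_num) b.nonneg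
  · refine Continuous.integrable_of_hasCompactSupport ?_ b.hasCompactSupport.mul_left
    have := b.continuous
    fun_prop
  · dsimp only
    by_cases hξ : b ξ = 0
    · simp [hξ]
    · have h1 : ξ ∈ Metric.ball (0 : Eucl n) b.rOut := by
        rw [← b.support_eq]
        exact hξ
      rw [mem_ball_zero_iff] at h1
      have h2 : |⟪ξ, x⟫| ≤ 1 / 6 := (abs_real_inner_le_norm ξ x).trans
        ((mul_le_mul_of_nonneg_right h1.le (norm_nonneg x)).trans hx)
      have h3 : Real.cos (Real.pi / 3) ≤ Real.cos (2 * Real.pi * ⟪ξ, x⟫) := by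
        rw [← Real.cos_abs (2 * Real.pi * ⟪ξ, x⟫), abs_mul,
          abs_of_pos (by positivity : 0 < 2 * Real.pi)]
        refine Real.cos_le_cos_of_nonneg_of_le_pi (by positivity) ?_ ?_ <;>
        nlinarith [Real.pi_pos]
      rw [Real.cos_pi_div_three] at h3
      exact mul_le_mul_of_nonneg_right h3 b.nonneg

/-- Placing bumps at p and at -p makes the inverse transform real. The function is compactly
supported in frequency and is a fixed envelope times a plane wave in space, so both sides can be
estimated explicitly. -/
theorem HsRn.exists_wave {n : ℕ} (s : ℝ) (b : ContDiffBump (0 : Eucl n)) (p : Eucl n) :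
    ∃ U : HsRn n s,
      ((𝓕 U.toComplex : Lp ℂ 2 (volume : Measure (Eucl n))) =ᵐ[volume]
        fun ξ => ((b (ξ - p) + b (ξ + p) : ℝ) : ℂ)) ∧
      U.toComplex =ᵐ[volume] fun x => (cosTransform b x : ℂ) * (𝐞 ⟪x, p⟫ + 𝐞 ⟪x, -p⟫) := by
  let f : Eucl n → ℂ := fun ξ => ((b (ξ - p) + b (ξ + p) : ℝ) : ℂ)
  have hcs : HasCompactSupport f := by
    have h1 : HasCompactSupport fun ξ => b (ξ - p) + b (ξ + p) :=
      (b.hasCompactSupport.comp_homeomorph (Homeomorph.subRight p)).add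
        (b.hasCompactSupport.comp_homeomorph (Homeomorph.addRight p))
    exact h1.comp_left Complex.ofReal_zero
  have hcd : ContDiff ℝ (↑(⊤ : ℕ∞)) f := by
    have hb : ContDiff ℝ (↑(⊤ : ℕ∞)) b := b.contDiff
    have h1 : ContDiff ℝ (↑(⊤ : ℕ∞)) fun ξ => b (ξ - p) + b (ξ + p) :=
      (hb.comp (contDiff_id.sub contDiff_const)).add (hb.comp (contDiff_id.add contDiff_const))
    exact Complex.ofRealCLM.contDiff.comp h1
  let ψ : 𝓢(Eucl n, ℂ) := hcs.toSchwartzMap hcd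
  have hψ : ∀ x, (𝓕⁻ ψ) x = (cosTransform b x : ℂ) * (𝐞 ⟪x, p⟫ + 𝐞 ⟪x, -p⟫) := by
    intro x
    rw [SchwartzMap.fourierInv_coe, Real.fourierInv_eq]
    have e1 : ∀ q : Eucl n, (fun ξ => 𝐞 ⟪ξ, x⟫ • ((b (ξ - q) : ℝ) : ℂ)) =
        fun ξ => (fun η => (𝐞 ⟪x, q⟫ : ℂ) * (𝐞 ⟪η, x⟫ • (b η : ℂ))) (ξ - q) := by
      intro q
      funext ξ
      simp only [Circle.smul_def, smul_eq_mul]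
      rw [← mul_assoc, ← Circle.coe_mul, ← AddChar.map_add_eq_mul, inner_sub_left,
        real_inner_comm q x]
      congr 3
      ring
    have e2 : ∀ q : Eucl n, Integrable fun ξ => 𝐞 ⟪ξ, x⟫ • ((b (ξ - q) : ℝ) : ℂ) := by
      intro q
      rw [e1]
      exact ((integrable_fourierChar_bump b x).const_mul _).comp_sub_right q
    have e3 : ∀ q : Eucl n, ∫ ξ, 𝐞 ⟪ξ, x⟫ • ((b (ξ - q) : ℝ) : ℂ) =
        (𝐞 ⟪x, q⟫ : ℂ) * cosTransform b x := by
      intro q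
      rw [e1, integral_sub_right_eq_self (fun η => (𝐞 ⟪x, q⟫ : ℂ) * (𝐞 ⟪η, x⟫ • (b η : ℂ))) q,
        integral_const_mul, integral_fourierChar_bump]
    have e4 : ∀ ξ, 𝐞 ⟪ξ, x⟫ • ψ ξ =
        𝐞 ⟪ξ, x⟫ • ((b (ξ - p) : ℝ) : ℂ) + 𝐞 ⟪ξ, x⟫ • ((b (ξ - -p) : ℝ) : ℂ) := by
      intro ξ
      rw [← smul_add, sub_neg_eq_add, ← Complex.ofReal_add]
      rfl
    simp only [e4]
    rw [integral_add (e2 p) (e2 (-p)), e3, e3]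
    ring
  obtain ⟨U, hU⟩ := HsRn.exists_toComplex_eq s (𝓕⁻ ψ) fun x => by
    rw [hψ, fourierChar_eq, fourierChar_eq, inner_neg_right, mul_neg, Real.sin_neg, Real.cos_neg]
    simp [-Complex.ofReal_cos, -Complex.ofReal_sin]
  refine ⟨U, ?_, ?_⟩
  · have h1 : 𝓕 U.toComplex = ψ.toLp 2 := by
      rw [hU, ← SchwartzMap.toLp_fourierInv_eq]
      exact FourierTransform.fourier_fourierInv_eq _
    rw [h1]
    exact ψ.coeFn_toLp 2
  · rw [hU]
    filter_upwards [(𝓕⁻ ψ).coeFn_toLp 2 (volume : Measure (Eucl n))] with x hx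
    rw [hx, hψ]

end Waves

/-! ### Inverse estimates -/

section Inverse

open scoped FourierTransform RealInnerProductSpace SchwartzMap

theorem freq_neg {n : ℕ} (T : ℝ) (k : Fin n → ℤ) : freq T (-k) = -freq T k := by
  ext i
  simp [freq, neg_div]

theorem eq_of_norm_freq_sub_lt {n : ℕ} {T : ℝ} (hT : 0 < T) {k l : Fin n → ℤ}
    (h : ‖freq T k - freq T l‖ < 1 / T) : k = l := by
  funext i
  have h1 : |(k i : ℝ) / T - l i / T| ≤ ‖freq T k - freq T l‖ :=
    PiLp.norm_apply_le (freq T k - freq T l) i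
  have h2 := h1.trans_lt h
  rw [← sub_div, abs_div, abs_of_pos hT, div_lt_div_iff_of_pos_right hT] at h2
  have h3 : |k i - l i| < 1 := by exact_mod_cast h2
  exact sub_eq_zero.mp (Int.abs_lt_one_iff.mp h3)

theorem exists_norm_freq_le (n : ℕ) : ∃ K : ℝ, 0 < K ∧ ∀ {T : ℝ}, 0 < T → ∀ (k : Fin n → ℤ) {L : ℝ},
    0 ≤ L → (∀ i, |(k i : ℝ)| ≤ L) → ‖freq T k‖ ≤ K * L / T := by
  let e := (EuclideanSpace.equiv (Fin n) ℝ).symm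
  refine ⟨‖(e : (Fin n → ℝ) →L[ℝ] Eucl n)‖ + 1, by positivity, fun {T} hT k {L} hL hk => ?_⟩
  have h1 := (e : (Fin n → ℝ) →L[ℝ] Eucl n).le_opNorm fun i => (k i : ℝ) / T
  refine h1.trans ?_
  rw [mul_div_assoc]
  gcongr
  · linarith
  · refine (pi_norm_le_iff_of_nonneg (by positivity)).mpr fun i => ?_
    rw [Real.norm_eq_abs, abs_div, abs_of_pos hT]
    gcongr
    exact hk i

theorem exists_cube_subset {n : ℕ} {Ω : Set (Eucl n)} (hΩ : IsOpen Ω) (hne : Ω.Nonempty) :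
    ∃ (T : ℝ) (a : Fin n → ℝ) (M : ℝ), 0 < T ∧ cube T a ⊆ Ω ∧ 0 < M ∧ ∀ x ∈ cube T a, ‖x‖ ≤ M := by
  obtain ⟨x₀, hx₀⟩ := hne
  let S : Set (Fin n → ℝ) := (fun z => (WithLp.toLp 2 z : Eucl n)) ⁻¹' (Ω ∩ Metric.ball x₀ 1)
  have hS : IsOpen S := (hΩ.inter Metric.isOpen_ball).preimage (by fun_prop)
  have hxS : WithLp.ofLp x₀ ∈ S := ⟨hx₀, Metric.mem_ball_self one_pos⟩
  obtain ⟨ρ, hρ, hball⟩ := Metric.isOpen_iff.mp hS _ hxS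
  have key : ∀ x ∈ cube (ρ / 2) (WithLp.ofLp x₀), x ∈ Ω ∩ Metric.ball x₀ 1 := by
    intro x hx
    have h1 : WithLp.ofLp x ∈ Metric.ball (WithLp.ofLp x₀) ρ := by
      rw [Metric.mem_ball, dist_pi_lt_iff hρ]
      intro i
      have := hx i
      rw [Real.dist_eq, abs_lt]
      constructor <;> linarith [this.1, this.2]
    exact hball h1
  refine ⟨ρ / 2, WithLp.ofLp x₀, ‖x₀‖ + 1, by positivity, fun x hx => (key x hx).1, by positivity,
    fun x hx => ?_⟩
  have h1 := (key x hx).2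
  rw [mem_ball_iff_norm] at h1
  have h2 := norm_le_norm_add_norm_sub' x x₀
  linarith

/-- Bessel's inequality for the coefficients with indices k j. The indices are positive, so k j
never equals some -k l, and the coefficient at k j is exactly c j Tⁿ. -/
theorem le_integral_cube_sum {n : ℕ} (hn : 0 < n) {T : ℝ} (hT : 0 < T) (a : Fin n → ℝ) {ι : Type*}
    [Fintype ι] [DecidableEq ι] (k : ι → Fin n → ℤ) (hk : Function.Injective k)
    (hpos : ∀ j i, 0 < k j i) (c : ι → ℝ) :
    T ^ n * ∑ j, c j ^ 2 ≤ ∫ x in cube T a,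
      ‖∑ j, (c j : ℂ) * ((𝐞 ⟪x, freq T (k j)⟫ : ℂ) + 𝐞 ⟪x, -freq T (k j)⟫)‖ ^ 2 := by
  have := isFiniteMeasure_cube hT a
  let g : Eucl n → ℂ := fun x =>
    ∑ j, (c j : ℂ) * ((𝐞 ⟪x, freq T (k j)⟫ : ℂ) + 𝐞 ⟪x, -freq T (k j)⟫)
  have hgc : Continuous g := by fun_prop
  have hg : MemLp g 2 (volume.restrict (cube T a)) := by
    refine MemLp.of_bound hgc.aestronglyMeasurable (∑ j, |c j| * 2)
      (Filter.Eventually.of_forall fun x => (norm_sum_le _ _).trans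
        (Finset.sum_le_sum fun j _ => ?_))
    rw [norm_mul, Complex.norm_real, Real.norm_eq_abs]
    gcongr
    refine (norm_add_le _ _).trans ?_
    rw [Circle.norm_coe, Circle.norm_coe]
    norm_num
  have hne : ∀ j l, k j ≠ -k l := by
    intro j l h
    have h1 := congrFun h ⟨0, hn⟩
    have h2 := hpos j ⟨0, hn⟩
    have h3 := hpos l ⟨0, hn⟩
    rw [Pi.neg_apply] at h1
    omega
  have hint : ∀ p q : Fin n → ℤ, Integrable
      (fun x : Eucl n => 𝐞 (-⟪x, freq T p⟫) • (𝐞 ⟪x, freq T q⟫ : ℂ)) (volume.restrict (cube T a)) := by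
    intro p q
    have hc : Continuous fun x : Eucl n => 𝐞 (-⟪x, freq T p⟫) • (𝐞 ⟪x, freq T q⟫ : ℂ) := by
      fun_prop
    refine Integrable.of_bound hc.aestronglyMeasurable 1 (Filter.Eventually.of_forall fun x => ?_)
    rw [Circle.smul_def, norm_smul, Circle.norm_coe, Circle.norm_coe, mul_one]
  have hcoef : ∀ j, ∫ x in cube T a, 𝐞 (-⟪x, freq T (k j)⟫) • g x = c j * (T : ℂ) ^ n := by
    intro j
    have e1 : ∀ x : Eucl n, 𝐞 (-⟪x, freq T (k j)⟫) • g x =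
        ∑ l, (c l : ℂ) * (𝐞 (-⟪x, freq T (k j)⟫) • (𝐞 ⟪x, freq T (k l)⟫ : ℂ) +
          𝐞 (-⟪x, freq T (k j)⟫) • (𝐞 ⟪x, freq T (-k l)⟫ : ℂ)) := by
      intro x
      simp only [g, freq_neg, Circle.smul_def, smul_eq_mul, Finset.mul_sum]
      exact Finset.sum_congr rfl fun l _ => by ring
    simp only [e1]
    rw [integral_finsetSum]
    swap
    · exact fun l _ => ((hint _ _).add (hint _ _)).const_mul _
    have e2 : ∀ l, ∫ x in cube T a, (c l : ℂ) *
        (𝐞 (-⟪x, freq T (k j)⟫) • (𝐞 ⟪x, freq T (k l)⟫ : ℂ) +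
          𝐞 (-⟪x, freq T (k j)⟫) • (𝐞 ⟪x, freq T (-k l)⟫ : ℂ)) =
        if j = l then (c l : ℂ) * (T : ℂ) ^ n else 0 := by
      intro l
      rw [integral_const_mul, integral_add (hint _ _) (hint _ _), integral_cube hT, integral_cube hT,
        if_neg (hne j l), add_zero]
      by_cases hjl : j = l
      · rw [if_pos hjl, if_pos (congrArg k hjl)]
      · rw [if_neg hjl, if_neg (hk.ne hjl), mul_zero]
    simp only [e2]
    rw [Finset.sum_ite_eq, if_pos (Finset.mem_univ j)]
  have key := sum_le_hasSum (Finset.univ.image k) (fun i _ => by positivity)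
    (hasSum_norm_sq_cube hT a hg)
  rw [Finset.sum_image fun i _ j _ h => hk h] at key
  have h1 : ∀ j, ‖(c j : ℂ) * (T : ℂ) ^ n‖ ^ 2 = T ^ n * (T ^ n * c j ^ 2) := by
    intro j
    rw [norm_mul, norm_pow, Complex.norm_real, Complex.norm_real, Real.norm_of_nonneg hT.le,
      mul_pow, Real.norm_eq_abs, sq_abs]
    ring
  simp only [hcoef, h1] at key
  rw [← Finset.mul_sum, ← Finset.mul_sum] at key
  exact le_of_mul_le_mul_left key (by positivity)

/-- Distinct frequencies are at least 1/T apart and the bumps have radius at most 1/(2T), so bumps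
of different waves have disjoint supports and all cross terms vanish. -/
theorem sq_sum_bump {n : ℕ} (hn : 0 < n) {T : ℝ} (hT : 0 < T) {ι : Type*}
    [Fintype ι] [DecidableEq ι] (k : ι → Fin n → ℤ) (hk : Function.Injective k)
    (hpos : ∀ j i, 0 < k j i) (c : ι → ℝ) (b : ContDiffBump (0 : Eucl n))
    (hb : b.rOut ≤ 1 / (2 * T)) (ξ : Eucl n) :
    (∑ j, c j * (b (ξ - freq T (k j)) + b (ξ + freq T (k j)))) ^ 2 =
      ∑ j, c j ^ 2 * (b (ξ - freq T (k j)) + b (ξ + freq T (k j))) ^ 2 := by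
  have hmem : ∀ x : Eucl n, b x ≠ 0 → ‖x‖ < 1 / (2 * T) := by
    intro x hx
    have h1 : x ∈ Metric.ball (0 : Eucl n) b.rOut := by
      rw [← b.support_eq]
      exact hx
    exact (mem_ball_zero_iff.mp h1).trans_le hb
  have hsep : ∀ p q : Fin n → ℤ, p ≠ q → b (ξ - freq T p) = 0 ∨ b (ξ - freq T q) = 0 := by
    intro p q hpq
    by_contra! h
    refine hpq (eq_of_norm_freq_sub_lt hT ?_)
    have h1 := norm_sub_le (ξ - freq T q) (ξ - freq T p)
    rw [sub_sub_sub_cancel_left] at h1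
    have h2 := hmem _ h.1
    have h3 := hmem _ h.2
    have h4 : 1 / (2 * T) + 1 / (2 * T) = 1 / T := by field_simp; norm_num
    linarith
  have hplus : ∀ j, ξ + freq T (k j) = ξ - freq T (-k j) := fun j => by
    rw [freq_neg, sub_neg_eq_add]
  have hne : ∀ j l, k j ≠ -k l := by
    intro j l h
    have h1 := congrFun h ⟨0, hn⟩
    have h2 := hpos j ⟨0, hn⟩
    have h3 := hpos l ⟨0, hn⟩
    rw [Pi.neg_apply] at h1
    omega
  have hdisj : ∀ j l, j ≠ l → (b (ξ - freq T (k j)) + b (ξ + freq T (k j))) *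
      (b (ξ - freq T (k l)) + b (ξ + freq T (k l))) = 0 := by
    intro j l hjl
    rw [hplus, hplus]
    have h1 := hsep _ _ (hk.ne hjl)
    have h2 := hsep _ _ (hne j l)
    have h3 := hsep _ _ (hne l j).symm
    have h4 := hsep (-k j) (-k l) (neg_injective.ne (hk.ne hjl))
    rcases h1 with h1 | h1 <;> rcases h2 with h2 | h2 <;> rcases h3 with h3 | h3 <;>
      rcases h4 with h4 | h4 <;> simp [h1, h2, h3, h4]
  rw [sq, Finset.sum_mul_sum]
  refine Finset.sum_congr rfl fun j _ => ?_
  rw [Finset.sum_eq_single j]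
  · ring
  · intro l _ hl
    have := hdisj j l hl.symm
    linear_combination c j * c l * this
  · intro h
    exact absurd (Finset.mem_univ j) h

theorem integrable_bump_sq {n : ℕ} (b : ContDiffBump (0 : Eucl n)) (p : Eucl n) :
    Integrable fun ξ => b (ξ - p) ^ 2 := by
  have h1 : Integrable fun ξ => b ξ ^ 2 := by
    have := b.continuous
    refine Continuous.integrable_of_hasCompactSupport (by fun_prop) ?_
    exact b.hasCompactSupport.comp_left (g := fun t : ℝ => t ^ 2) (by norm_num)
  exact h1.comp_sub_right p

theorem integrable_sq_add_bump {n : ℕ} (b : ContDiffBump (0 : Eucl n)) (p : Eucl n) :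
    Integrable fun ξ => (b (ξ - p) + b (ξ + p)) ^ 2 := by
  have h1 := integrable_bump_sq b p
  have h2 := integrable_bump_sq b (-p)
  have hc := b.continuous
  refine ((h1.const_mul 2).add (h2.const_mul 2)).mono' (by fun_prop)
    (Filter.Eventually.of_forall fun ξ => ?_)
  rw [Real.norm_of_nonneg (by positivity)]
  simp only [sub_neg_eq_add, Pi.add_apply]
  nlinarith [sq_nonneg (b (ξ - p) - b (ξ + p))]

theorem integral_sq_add_bump_le {n : ℕ} (b : ContDiffBump (0 : Eucl n)) (p : Eucl n) :
    ∫ ξ, (b (ξ - p) + b (ξ + p)) ^ 2 ≤ 4 * ∫ ξ, b ξ ^ 2 := by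
  have h1 := integrable_bump_sq b p
  have h2 := integrable_bump_sq b (-p)
  have e1 := integral_sub_right_eq_self (μ := volume) (fun ξ => b ξ ^ 2) p
  have e2 := integral_sub_right_eq_self (μ := volume) (fun ξ => b ξ ^ 2) (-p)
  calc ∫ ξ, (b (ξ - p) + b (ξ + p)) ^ 2
      ≤ ∫ ξ, (2 * b (ξ - p) ^ 2 + 2 * b (ξ - -p) ^ 2) := by
        refine integral_mono (integrable_sq_add_bump b p)
          ((h1.const_mul 2).add (h2.const_mul 2)) fun ξ => ?_
        simp only [sub_neg_eq_add]
        nlinarith [sq_nonneg (b (ξ - p) - b (ξ + p))]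
    _ = 4 * ∫ ξ, b ξ ^ 2 := by
        rw [integral_add (h1.const_mul 2) (h2.const_mul 2), integral_const_mul,
          integral_const_mul, e1, e2]
        ring

/-- Modulated copies of one band-limited function satisfy an inverse estimate. -/
theorem exists_wave_family {n : ℕ} (hn : 0 < n) {Ω : Set (Eucl n)} (hΩ : IsOpen Ω)
    (hne : Ω.Nonempty) {s : ℝ} (hs : 0 ≤ s) :
    ∃ c C : ℝ, 0 < c ∧ 0 < C ∧ ∀ L : ℕ, 1 ≤ L → ∃ U : (Fin n → Fin L) → HsRn n s,
      ∀ a : (Fin n → Fin L) → ℝ,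
        ‖∑ k, a k • U k‖ ^ 2 ≤ C * ((L : ℝ) ^ 2) ^ s * ∑ k, a k ^ 2 ∧
        c * ∑ k, a k ^ 2 ≤ ‖HsRn.restrict Ω s (∑ k, a k • U k)‖ ^ 2 := by
  obtain ⟨T, q, M, hT, hQ, hM, hQM⟩ := exists_cube_subset hΩ hne
  obtain ⟨K, hK, hfreq⟩ := exists_norm_freq_le n
  -- The first entry separates the bumps in frequency, the second bounds the envelope below on the
  -- cube, where ‖x‖ ≤ M, and the third keeps ‖ξ‖ below a multiple of L.
  set δ := min (1 / (2 * T)) (min (1 / (6 * M)) 1) with hδ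
  have hδ0 : 0 < δ := by positivity
  have hδ1 : δ ≤ 1 / (2 * T) := min_le_left _ _
  have hδ2 : δ ≤ 1 / (6 * M) := (min_le_right _ _).trans (min_le_left _ _)
  have hδ3 : δ ≤ 1 := (min_le_right _ _).trans (min_le_right _ _)
  let b : ContDiffBump (0 : Eucl n) := ⟨δ / 2, δ, by positivity, by linarith⟩
  have hbO : b.rOut = δ := rfl
  have hB0 : 0 < ∫ ξ, b ξ := b.integral_pos
  have hB : 0 ≤ ∫ ξ, b ξ ^ 2 := integral_nonneg fun ξ => by positivity
  have hD : 0 < K / T + 2 := by positivity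
  refine ⟨((1 / 2) * ∫ ξ, b ξ) ^ 2 * T ^ n, ((K / T + 2) ^ 2) ^ s * (4 * (∫ ξ, b ξ ^ 2) + 1),
    by positivity, by positivity, fun L hL => ?_⟩
  have hL1 : (1 : ℝ) ≤ L := by exact_mod_cast hL
  -- The shift by one makes all indices positive, between 1 and L.
  let k : (Fin n → Fin L) → Fin n → ℤ := fun j i => (j i : ℕ) + 1
  have hk : Function.Injective k := by
    intro j l h
    funext i
    have := congrFun h i
    simp only [k] at this
    exact Fin.ext (by omega)
  have hpos : ∀ j i, 0 < k j i := fun j i => by simp only [k]; omega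
  have hkL : ∀ j i, |(k j i : ℝ)| ≤ L := fun j i => by
    have h1 : (0 : ℝ) < k j i := by exact_mod_cast hpos j i
    rw [abs_of_pos h1]
    have h2 : k j i ≤ (L : ℤ) := by
      have := (j i).2
      simp only [k]
      omega
    exact_mod_cast h2
  choose U hU1 hU2 using fun j => HsRn.exists_wave s b (freq T (k j))
  refine ⟨U, fun a => ⟨?_, ?_⟩⟩
  · have hF : (𝓕 (HsRn.toComplex (∑ j, a j • U j)) : Lp ℂ 2 (volume : Measure (Eucl n))) =ᵐ[volume]
        fun ξ => ((∑ j, a j * (b (ξ - freq T (k j)) + b (ξ + freq T (k j))) : ℝ) : ℂ) := by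
      rw [HsRn.toComplex_sum, fourier_sum]
      filter_upwards [coeFn_sum_smul a fun j => 𝓕 (U j).toComplex, ae_all_iff.mpr hU1] with ξ h1 h2
      rw [h1, Complex.ofReal_sum]
      refine Finset.sum_congr rfl fun j _ => ?_
      rw [h2, Complex.real_smul, ← Complex.ofReal_mul]
    rw [HsRn.norm_sq_eq hs]
    -- All frequencies that occur have length at most (K/T + 1) L, so the Sobolev weight is at most
    -- of order L^(2s).
    have hbound : ∀ j ξ, (1 + ‖ξ‖ ^ 2) ^ s * (b (ξ - freq T (k j)) + b (ξ + freq T (k j))) ^ 2 ≤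
        (((K / T + 2) * L) ^ 2) ^ s * (b (ξ - freq T (k j)) + b (ξ + freq T (k j))) ^ 2 := by
      intro j ξ
      by_cases h0 : b (ξ - freq T (k j)) + b (ξ + freq T (k j)) = 0
      · simp [h0]
      have h1 : ‖ξ‖ ≤ (K / T + 1) * L := by
        have hmem : ∀ x : Eucl n, b x ≠ 0 → ‖x‖ < δ := fun x hx => by
          have h1 : x ∈ Metric.ball (0 : Eucl n) b.rOut := by
            rw [← b.support_eq]
            exact hx
          exact mem_ball_zero_iff.mp h1
        have hp := hfreq hT (k j) (by positivity) (hkL j)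
        have h3 : ‖ξ‖ ≤ K * L / T + δ := by
          by_cases h2 : b (ξ - freq T (k j)) = 0
          · have h4 : b (ξ + freq T (k j)) ≠ 0 := fun h => h0 (by rw [h2, h, add_zero])
            have h5 := norm_sub_le (ξ + freq T (k j)) (freq T (k j))
            rw [add_sub_cancel_right] at h5
            linarith [hmem _ h4]
          · have h5 := norm_add_le (ξ - freq T (k j)) (freq T (k j))
            rw [sub_add_cancel] at h5
            linarith [hmem _ h2]
        have h4 : K * L / T = K / T * L := by ring
        rw [h4] at h3
        linarith
      have h2 : 1 + ‖ξ‖ ^ 2 ≤ ((K / T + 2) * L) ^ 2 := by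
        have h3 : 1 + ‖ξ‖ ≤ (K / T + 2) * L := by linarith
        nlinarith [norm_nonneg ξ]
      gcongr
    have hint : Integrable fun ξ => (((K / T + 2) * L) ^ 2) ^ s *
        ∑ j, a j ^ 2 * (b (ξ - freq T (k j)) + b (ξ + freq T (k j))) ^ 2 :=
      (integrable_finsetSum _ fun j _ => (integrable_sq_add_bump b _).const_mul _).const_mul _
    calc ∫ ξ, (1 + ‖ξ‖ ^ 2) ^ s *
          ‖(𝓕 (HsRn.toComplex (∑ j, a j • U j)) : Lp ℂ 2 (volume : Measure (Eucl n))) ξ‖ ^ 2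
        ≤ ∫ ξ, (((K / T + 2) * L) ^ 2) ^ s *
          ∑ j, a j ^ 2 * (b (ξ - freq T (k j)) + b (ξ + freq T (k j))) ^ 2 := by
          refine integral_mono_ae (HsRn.integrable_fourier hs _) hint ?_
          filter_upwards [hF] with ξ h1
          rw [h1, Complex.norm_real, Real.norm_eq_abs, sq_abs,
            sq_sum_bump hn hT k hk hpos a b hδ1, Finset.mul_sum, Finset.mul_sum]
          refine Finset.sum_le_sum fun j _ => ?_
          have := mul_le_mul_of_nonneg_left (hbound j ξ) (sq_nonneg (a j))
          linarith
      _ = (((K / T + 2) * L) ^ 2) ^ s *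
          ∑ j, a j ^ 2 * ∫ ξ, (b (ξ - freq T (k j)) + b (ξ + freq T (k j))) ^ 2 := by
          rw [integral_const_mul, integral_finsetSum _ fun j _ =>
            (integrable_sq_add_bump b _).const_mul _]
          simp only [integral_const_mul]
      _ ≤ (((K / T + 2) * L) ^ 2) ^ s * ∑ j, a j ^ 2 * (4 * (∫ ξ, b ξ ^ 2) + 1) := by
          gcongr with j _
          linarith [integral_sq_add_bump_le b (freq T (k j))]
      _ = _ := by
          rw [← Finset.sum_mul, mul_pow, Real.mul_rpow (by positivity) (by positivity)]
          ring
  · have hx : HsRn.toComplex (∑ j, a j • U j) =ᵐ[volume] fun x => (cosTransform b x : ℂ) *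
        ∑ j, (a j : ℂ) * ((𝐞 ⟪x, freq T (k j)⟫ : ℂ) + 𝐞 ⟪x, -freq T (k j)⟫) := by
      rw [HsRn.toComplex_sum]
      filter_upwards [coeFn_sum_smul a fun j => (U j).toComplex, ae_all_iff.mpr hU2] with x h1 h2
      rw [h1, Finset.mul_sum]
      refine Finset.sum_congr rfl fun j _ => ?_
      rw [h2, Complex.real_smul]
      ring
    set W := ∑ j, a j • U j with hW
    have hr : (fun x => ‖HsRn.restrict Ω s W x‖ ^ 2) =ᵐ[volume.restrict Ω]
        fun x => ‖W.toComplex x‖ ^ 2 := by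
      filter_upwards [HsRn.coeFn_restrict Ω W, ae_restrict_of_ae W.coeFn_toComplex] with x h1 h2
      rw [h1, h2, Complex.norm_real]
    have := isFiniteMeasure_cube hT q
    rw [norm_sq_eq_integral, integral_congr_ae hr]
    calc _ = ((1 / 2) * ∫ ξ, b ξ) ^ 2 * (T ^ n * ∑ j, a j ^ 2) := by ring
      _ ≤ ((1 / 2) * ∫ ξ, b ξ) ^ 2 * ∫ x in cube T q,
          ‖∑ j, (a j : ℂ) * ((𝐞 ⟪x, freq T (k j)⟫ : ℂ) + 𝐞 ⟪x, -freq T (k j)⟫)‖ ^ 2 := by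
          gcongr
          exact le_integral_cube_sum hn hT q k hk hpos a
      _ ≤ ∫ x in cube T q, ‖W.toComplex x‖ ^ 2 := by
          rw [← integral_const_mul]
          refine integral_mono_of_nonneg (Filter.Eventually.of_forall fun x => by positivity)
            (integrable_norm_sq W.toComplex).integrableOn ?_
          filter_upwards [ae_restrict_of_ae hx, ae_restrict_mem (measurableSet_cube T q)] with x h1 h2
          rw [h1, norm_mul, mul_pow ‖(cosTransform b x : ℂ)‖, Complex.norm_real, Real.norm_eq_abs,
            sq_abs]
          have h3 : b.rOut * ‖x‖ ≤ 1 / 6 := by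
            calc b.rOut * ‖x‖ ≤ 1 / (6 * M) * M := by
                  rw [hbO]
                  gcongr
                  exact hQM x h2
              _ = 1 / 6 := by field_simp
          have h4 := le_cosTransform b h3
          gcongr
      _ ≤ ∫ x in Ω, ‖W.toComplex x‖ ^ 2 :=
          setIntegral_mono_set (integrable_norm_sq W.toComplex).integrableOn
            (Filter.Eventually.of_forall fun x => by positivity) hQ.eventuallyLE

/-- A Bernstein inequality: about m^(1/n) frequencies in each direction give at least m waves, and
their combinations have Sobolev norm at most a multiple of m^(s/n) times their L² norm on Ω. The
lower L² bound also yields linear independence. -/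
theorem exists_inverse_subspace {n : ℕ} (hn : 0 < n) {Ω : Set (Eucl n)} (hΩ : IsOpen Ω)
    (hne : Ω.Nonempty) {s : ℝ} (hs : 0 ≤ s) :
    ∃ C : ℝ, 0 < C ∧ ∀ m : ℕ, 1 ≤ m → ∃ X : Submodule ℝ (Hs Ω s), FiniteDimensional ℝ X ∧
      m ≤ Module.finrank ℝ X ∧ ∀ u ∈ X, ‖u‖ ≤ C * (m : ℝ) ^ (s / n) * ‖Hs.toL2 Ω s u‖ := by
  obtain ⟨c, C, hc, hC, hfam⟩ := exists_wave_family hn hΩ hne hs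
  have hn0 : (0 : ℝ) < n := by exact_mod_cast hn
  refine ⟨√(C / c) * 2 ^ s, by positivity, fun m hm => ?_⟩
  have hm1 : (1 : ℝ) ≤ m := by exact_mod_cast hm
  have hx1 : 1 ≤ (m : ℝ) ^ (1 / n : ℝ) := Real.one_le_rpow hm1 (by positivity)
  set L := ⌈(m : ℝ) ^ (1 / n : ℝ)⌉₊ with hL
  have hL0 : 1 ≤ L := Nat.one_le_ceil_iff.mpr (by linarith)
  have hL1 : (m : ℝ) ^ (1 / n : ℝ) ≤ L := Nat.le_ceil _
  have hL2 : (L : ℝ) ≤ 2 * (m : ℝ) ^ (1 / n : ℝ) := by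
    have := (Nat.ceil_lt_add_one (zero_le_one.trans hx1)).le
    linarith
  have hmL : m ≤ L ^ n := by
    have h1 : ((m : ℝ) ^ (1 / n : ℝ)) ^ n ≤ (L : ℝ) ^ n := by gcongr
    rw [← Real.rpow_natCast, ← Real.rpow_mul (by positivity), one_div, inv_mul_cancel₀ hn0.ne',
      Real.rpow_one] at h1
    exact_mod_cast h1
  obtain ⟨U, hU⟩ := hfam L hL0
  choose u hu _ using fun k => Hs.exists_of_extension Ω hs (U k)
  have hsum : ∀ a : (Fin n → Fin L) → ℝ, Hs.toL2 Ω s (∑ k, a k • u k) =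
      HsRn.restrict Ω s (∑ k, a k • U k) := by
    intro a
    simp only [map_sum, map_smul, hu]
  have hlow : ∀ a : (Fin n → Fin L) → ℝ,
      c * ∑ k, a k ^ 2 ≤ ‖Hs.toL2 Ω s (∑ k, a k • u k)‖ ^ 2 := by
    intro a
    rw [hsum]
    exact (hU a).2
  have hup : ∀ a : (Fin n → Fin L) → ℝ,
      ‖∑ k, a k • u k‖ ^ 2 ≤ C * ((L : ℝ) ^ 2) ^ s * ∑ k, a k ^ 2 := by
    intro a
    obtain ⟨u', h1, h2⟩ := Hs.exists_of_extension Ω hs (∑ k, a k • U k)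
    -- The norm of the combination is bounded through the combined extension, since the separate
    -- minimal extensions carry no almost-orthogonality.
    have h3 : u' = ∑ k, a k • u k := Hs.toL2_injective Ω s (h1.trans (hsum a).symm)
    rw [← h3]
    exact (pow_le_pow_left₀ (norm_nonneg _) h2 2).trans (hU a).1
  have hli : LinearIndependent ℝ u := by
    refine Fintype.linearIndependent_iff.mpr fun a ha k => ?_
    have h1 := hlow a
    rw [ha, map_zero, norm_zero] at h1
    have h2 : ∑ k, a k ^ 2 ≤ 0 := by
      by_contra! h
      nlinarith
    have h3 := (Finset.sum_eq_zero_iff_of_nonneg fun k _ => sq_nonneg (a k)).mp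
      (le_antisymm h2 (Finset.sum_nonneg fun k _ => sq_nonneg (a k))) k (Finset.mem_univ k)
    exact pow_eq_zero_iff two_ne_zero |>.mp h3
  refine ⟨Submodule.span ℝ (Set.range u), FiniteDimensional.span_of_finite ℝ (Set.finite_range u),
    ?_, fun v hv => ?_⟩
  · rw [finrank_span_eq_card hli]
    simpa using hmL
  · obtain ⟨a, rfl⟩ := (Submodule.mem_span_range_iff_exists_fun ℝ).mp hv
    have hLs : (L : ℝ) ^ s ≤ 2 ^ s * (m : ℝ) ^ (s / n) := by
      calc (L : ℝ) ^ s ≤ (2 * (m : ℝ) ^ (1 / n : ℝ)) ^ s := by gcongr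
        _ = _ := by
          rw [Real.mul_rpow (by positivity) (by positivity), ← Real.rpow_mul (by positivity)]
          congr 2
          ring
    have h1 : ‖∑ k, a k • u k‖ ^ 2 ≤ (√(C / c) * (L : ℝ) ^ s * ‖Hs.toL2 Ω s (∑ k, a k • u k)‖) ^ 2 := by
      have e : ((L : ℝ) ^ s) ^ 2 = ((L : ℝ) ^ 2) ^ s := Real.rpow_pow_comm (by positivity) s 2
      rw [mul_pow, mul_pow, Real.sq_sqrt (by positivity), e]
      calc _ ≤ C * ((L : ℝ) ^ 2) ^ s * ∑ k, a k ^ 2 := hup a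
        _ = C / c * ((L : ℝ) ^ 2) ^ s * (c * ∑ k, a k ^ 2) := by field_simp
        _ ≤ _ := by
          gcongr
          exact hlow a
    calc ‖∑ k, a k • u k‖ ≤ √(C / c) * (L : ℝ) ^ s * ‖Hs.toL2 Ω s (∑ k, a k • u k)‖ :=
          le_of_sq_le_sq h1 (by positivity)
      _ ≤ √(C / c) * (2 ^ s * (m : ℝ) ^ (s / n)) * ‖Hs.toL2 Ω s (∑ k, a k • u k)‖ := by gcongr
      _ = _ := by ring

end Inverse

/-! ### Approximation by finite-dimensional subspaces -/

/-- Take W as the image of the orthogonal complement of ker Φ, on which Φ is injective. The error is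
then A applied to the component in the kernel, and this component is no longer than u. -/
theorem exists_subspace_of_forall_ker {G E Z : Type*} [NormedAddCommGroup G]
    [InnerProductSpace ℝ G] [CompleteSpace G] [NormedAddCommGroup E] [InnerProductSpace ℝ E]
    [NormedAddCommGroup Z] [NormedSpace ℝ Z] [FiniteDimensional ℝ Z] (A : G →ₗ[ℝ] E)
    (Φ : G →L[ℝ] Z) {δ : ℝ} (h : ∀ u, Φ u = 0 → ‖A u‖ ≤ δ * ‖u‖) (hδ : 0 ≤ δ) :
    ∃ W : Submodule ℝ E, FiniteDimensional ℝ W ∧ Module.finrank ℝ W ≤ Module.finrank ℝ Z ∧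
      ∀ u, ∃ w ∈ W, ‖A u - w‖ ≤ δ * ‖u‖ := by
  let N : Submodule ℝ G := LinearMap.ker (Φ : G →ₗ[ℝ] Z)
  have hN : IsClosed (N : Set G) := Φ.isClosed_ker
  have : CompleteSpace N := hN.completeSpace_coe
  have hinj : Function.Injective ((Φ : G →ₗ[ℝ] Z) ∘ₗ Nᗮ.subtype) := by
    refine (injective_iff_map_eq_zero _).mpr fun u hu => Subtype.ext ?_
    have h1 : (u : G) ∈ N := LinearMap.mem_ker.mpr hu
    exact inner_self_eq_zero.mp (u.2 u h1)
  have : FiniteDimensional ℝ Nᗮ := FiniteDimensional.of_injective _ hinj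
  refine ⟨Nᗮ.map A, inferInstance,
    (Submodule.finrank_map_le A Nᗮ).trans (LinearMap.finrank_le_finrank_of_injective hinj),
    fun u => ?_⟩
  obtain ⟨y, hy, z, hz, rfl⟩ := N.exists_add_mem_mem_orthogonal u
  refine ⟨A z, Submodule.mem_map_of_mem hz, ?_⟩
  rw [map_add, add_sub_cancel_right]
  refine (h y (LinearMap.mem_ker.mp hy)).trans ?_
  have h1 := norm_add_sq_eq_norm_sq_add_norm_sq_of_inner_eq_zero y z (hz y hy)
  have h2 : ‖y‖ ≤ ‖y + z‖ := by
    nlinarith [norm_nonneg y, norm_nonneg (y + z), mul_self_nonneg ‖z‖]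
  gcongr

section Approx

open scoped FourierTransform RealInnerProductSpace SchwartzMap

theorem summable_norm_freq_rpow {n : ℕ} {T : ℝ} (hT : 0 < T) {r : ℝ} (hr : r < -n) :
    Summable fun k : Fin n → ℤ => ‖freq T k‖ ^ r := by
  let b := (EuclideanSpace.basisFun (Fin n) ℝ).toBasis
  let Λ : Submodule ℤ (Eucl n) := Submodule.span ℤ (Set.range b)
  have hrank : Module.finrank ℤ Λ = n := by
    rw [ZLattice.rank ℝ Λ, finrank_euclideanSpace_fin]
  have h1 := ZLattice.summable_norm_rpow Λ r (by rw [hrank]; exact hr)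
  have hmem : ∀ k : Fin n → ℤ, freq 1 k ∈ Λ := by
    intro k
    have : freq 1 k = ∑ i, k i • b i := by
      ext j
      simp [freq, b, Finset.sum_apply, Pi.single_apply]
    rw [this]
    exact Submodule.sum_mem _ fun i _ =>
      Submodule.smul_mem _ _ (Submodule.subset_span (Set.mem_range_self i))
  have hinj : Function.Injective fun k : Fin n → ℤ => (⟨freq 1 k, hmem k⟩ : Λ) := by
    intro k l h
    have h2 : freq 1 k = freq 1 l := congrArg Subtype.val h
    exact eq_of_norm_freq_sub_lt one_pos (by rw [h2, sub_self, norm_zero]; norm_num)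
  have h2 := (h1.comp_injective hinj).mul_left (T⁻¹ ^ r)
  refine h2.congr fun k => ?_
  have h3 : freq T k = T⁻¹ • freq 1 k := by
    ext i
    simp [freq, div_eq_inv_mul]
  rw [h3, norm_smul, Real.norm_of_nonneg (by positivity), Real.mul_rpow (by positivity)
    (norm_nonneg _)]
  rfl

theorem le_norm_freq {n : ℕ} {T : ℝ} (hT : 0 < T) (k : Fin n → ℤ) (i : Fin n) :
    |(k i : ℝ)| / T ≤ ‖freq T k‖ := by
  have h1 := PiLp.norm_apply_le (freq T k) i
  rwa [freq, Real.norm_eq_abs, abs_div, abs_of_pos hT] at h1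

/-- In the ball ξ is at distance at least ‖p‖/2 from p. In ‖X‖² one factor is bounded by Schwartz
decay of order M, while the other, weighted with a power M, is integrated. -/
theorem exists_integral_tail_le {n : ℕ} (X : 𝓢(Eucl n, ℂ)) (M : ℕ) :
    ∃ I : ℝ, 0 ≤ I ∧ ∀ (R : ℝ) (p : Eucl n), p ≠ 0 → 2 * R ≤ ‖p‖ →
      ∫ ξ in Metric.closedBall 0 R, ‖X (ξ - p)‖ ^ 2 ≤ I * ‖p‖ ^ (-(2 * M : ℝ)) := by
  obtain ⟨C, hC, hdecay⟩ := X.decay M 0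
  simp only [norm_iteratedFDeriv_zero] at hdecay
  have hint : Integrable (fun η => ‖η‖ ^ M * ‖X η‖) (volume : Measure (Eucl n)) :=
    X.integrable_pow_mul volume M
  set J := ∫ η, ‖η‖ ^ M * ‖X η‖ with hJ
  have hJ0 : 0 ≤ J := integral_nonneg fun η => by positivity
  refine ⟨2 ^ (2 * M) * C * J, by positivity, fun R p hp hR => ?_⟩
  have hp0 : 0 < ‖p‖ := norm_pos_iff.mpr hp
  have key : ∀ ξ ∈ Metric.closedBall (0 : Eucl n) R, ‖X (ξ - p)‖ ^ 2 ≤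
      (‖p‖ / 2) ^ (-(2 * M : ℝ)) * C * (‖ξ - p‖ ^ M * ‖X (ξ - p)‖) := by
    intro ξ hξ
    have h1 : ‖p‖ / 2 ≤ ‖ξ - p‖ := by
      have h2 := norm_sub_norm_le p ξ
      rw [norm_sub_rev] at h2
      have h3 := mem_closedBall_zero_iff.mp hξ
      linarith
    have h2 : 1 ≤ (‖p‖ / 2) ^ (-(2 * M : ℝ)) * (‖ξ - p‖ ^ M * ‖ξ - p‖ ^ M) := by
      rw [Real.rpow_neg (by positivity), ← pow_add, ← two_mul]
      have h3 : (‖p‖ / 2) ^ (2 * M : ℝ) = (‖p‖ / 2) ^ (2 * M) := by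
        rw [← Real.rpow_natCast]
        push_cast
        rfl
      rw [h3, ← div_eq_inv_mul, one_le_div (by positivity)]
      gcongr
    calc ‖X (ξ - p)‖ ^ 2 = 1 * (‖X (ξ - p)‖ * ‖X (ξ - p)‖) := by ring
      _ ≤ ((‖p‖ / 2) ^ (-(2 * M : ℝ)) * (‖ξ - p‖ ^ M * ‖ξ - p‖ ^ M)) *
          (‖X (ξ - p)‖ * ‖X (ξ - p)‖) := by gcongr
      _ = (‖p‖ / 2) ^ (-(2 * M : ℝ)) * (‖ξ - p‖ ^ M * ‖X (ξ - p)‖) *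
          (‖ξ - p‖ ^ M * ‖X (ξ - p)‖) := by ring
      _ ≤ _ := by
        gcongr
        exact hdecay _
  have hint' := (hint.comp_sub_right p).const_mul ((‖p‖ / 2) ^ (-(2 * M : ℝ)) * C)
  calc ∫ ξ in Metric.closedBall 0 R, ‖X (ξ - p)‖ ^ 2
      ≤ ∫ ξ in Metric.closedBall 0 R,
          (‖p‖ / 2) ^ (-(2 * M : ℝ)) * C * (‖ξ - p‖ ^ M * ‖X (ξ - p)‖) := by
        refine integral_mono_of_nonneg (Filter.Eventually.of_forall fun ξ => by positivity)
          hint'.integrableOn ?_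
        filter_upwards [ae_restrict_mem Metric.isClosed_closedBall.measurableSet] with ξ hξ
        exact key ξ hξ
    _ ≤ ∫ ξ, (‖p‖ / 2) ^ (-(2 * M : ℝ)) * C * (‖ξ - p‖ ^ M * ‖X (ξ - p)‖) :=
        setIntegral_le_integral hint' (Filter.Eventually.of_forall fun ξ => by positivity)
    _ = (‖p‖ / 2) ^ (-(2 * M : ℝ)) * C * J := by
        rw [integral_const_mul, integral_sub_right_eq_self (fun η => ‖η‖ ^ M * ‖X η‖) p]
    _ = _ := by
        rw [Real.div_rpow (by positivity) (by positivity), Real.rpow_neg (by norm_num : (0:ℝ) ≤ 2)]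
        have h3 : (2 : ℝ) ^ (2 * M : ℝ) = 2 ^ (2 * M) := by
          rw [← Real.rpow_natCast]
          push_cast
          rfl
        rw [h3]
        field_simp

/-- The decomposition of a function into its low and high frequencies. -/
theorem exists_frequency_split {n : ℕ} (f : Lp ℂ 2 (volume : Measure (Eucl n))) (R : ℝ) :
    ∃ lo : Lp ℂ 2 (volume : Measure (Eucl n)),
      ‖f - lo‖ ^ 2 = ∫ ξ in (Metric.closedBall 0 R)ᶜ,
        ‖(𝓕 f : Lp ℂ 2 (volume : Measure (Eucl n))) ξ‖ ^ 2 ∧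
      ∀ H : Lp ℂ 2 (volume : Measure (Eucl n)), ‖inner ℂ H lo‖ ^ 2 ≤
        (∫ ξ in Metric.closedBall 0 R, ‖(𝓕 H : Lp ℂ 2 (volume : Measure (Eucl n))) ξ‖ ^ 2) *
          ‖f‖ ^ 2 := by
  let B : Set (Eucl n) := Metric.closedBall 0 R
  have hB : MeasurableSet B := Metric.isClosed_closedBall.measurableSet
  let F := Lp.fourierTransformₗᵢ (Eucl n) ℂ
  have hF : ∀ g : Lp ℂ 2 (volume : Measure (Eucl n)), F g = 𝓕 g := fun g => rfl
  let cut : Lp ℂ 2 (volume : Measure (Eucl n)) → Lp ℂ 2 (volume : Measure (Eucl n)) := fun g =>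
    ((Lp.memLp g).indicator hB).toLp _
  have hcut : ∀ g, cut g =ᵐ[volume] B.indicator g := fun g => MemLp.coeFn_toLp _
  have hcutn : ∀ g, ‖cut g‖ ^ 2 = ∫ ξ in B, ‖g ξ‖ ^ 2 := by
    intro g
    rw [norm_sq_eq_integral, ← integral_indicator hB]
    refine integral_congr_ae ?_
    filter_upwards [hcut g] with ξ h
    rw [h]
    by_cases hξ : ξ ∈ B <;> simp [hξ]
  have hcutc : ∀ g, ‖g - cut g‖ ^ 2 = ∫ ξ in Bᶜ, ‖g ξ‖ ^ 2 := by
    intro g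
    rw [norm_sq_eq_integral, ← integral_indicator hB.compl]
    refine integral_congr_ae ?_
    filter_upwards [hcut g, Lp.coeFn_sub g (cut g)] with ξ h h'
    rw [h', Pi.sub_apply, h]
    by_cases hξ : ξ ∈ B <;> simp [hξ]
  have hinner : ∀ g g', inner ℂ g (cut g') = inner ℂ (cut g) (cut g') := by
    intro g g'
    rw [L2.inner_def, L2.inner_def]
    refine integral_congr_ae ?_
    filter_upwards [hcut g, hcut g'] with ξ h h'
    rw [h, h']
    by_cases hξ : ξ ∈ B <;> simp [hξ]
  have hlo : F (F.symm (cut (F f))) = cut (F f) := F.apply_symm_apply _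
  refine ⟨F.symm (cut (F f)), ?_, fun H => ?_⟩
  · rw [← F.norm_map, map_sub, hlo, hcutc]
    rfl
  · rw [← F.inner_map_map, hlo, hinner]
    have h1 := norm_inner_le_norm (𝕜 := ℂ) (cut (F H)) (cut (F f))
    have h2 : ‖cut (F f)‖ ^ 2 ≤ ‖f‖ ^ 2 := by
      rw [hcutn, ← F.norm_map f, norm_sq_eq_integral]
      exact setIntegral_le_integral (integrable_norm_sq _)
        (Filter.Eventually.of_forall fun ξ => by positivity)
    calc _ ≤ (‖cut (F H)‖ * ‖cut (F f)‖) ^ 2 := by gcongr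
      _ = (∫ ξ in B, ‖F H ξ‖ ^ 2) * ‖cut (F f)‖ ^ 2 := by rw [mul_pow, hcutn]
      _ ≤ _ := mul_le_mul_of_nonneg_left h2 (integral_nonneg fun ξ => by positivity)

theorem contDiff_fourierChar_mul {n : ℕ} (χ : ContDiffBump (0 : Eucl n)) (p : Eucl n) :
    ContDiff ℝ (↑(⊤ : ℕ∞)) fun x : Eucl n => (𝐞 ⟪x, p⟫ : ℂ) * (χ x : ℂ) := by
  have hχ : ContDiff ℝ (↑(⊤ : ℕ∞)) χ := χ.contDiff
  have h1 : ContDiff ℝ (↑(⊤ : ℕ∞)) fun x : Eucl n => (χ x : ℂ) := Complex.ofRealCLM.contDiff.comp hχ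
  have h2 : ContDiff ℝ (↑(⊤ : ℕ∞)) fun x : Eucl n => ((2 * Real.pi * ⟪x, p⟫ : ℝ) : ℂ) :=
    Complex.ofRealCLM.contDiff.comp (contDiff_const.mul (contDiff_id.inner ℝ contDiff_const))
  simp only [Real.fourierChar_apply]
  exact (h2.mul contDiff_const).cexp.mul h1

theorem hasCompactSupport_fourierChar_mul {n : ℕ} (χ : ContDiffBump (0 : Eucl n)) (p : Eucl n) :
    HasCompactSupport fun x : Eucl n => (𝐞 ⟪x, p⟫ : ℂ) * (χ x : ℂ) :=
  (χ.hasCompactSupport.comp_left (g := fun t : ℝ => (t : ℂ)) Complex.ofReal_zero).mul_left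

/-- A smooth cutoff function, modulated with the frequency `p`. -/
def modulatedBump {n : ℕ} (χ : ContDiffBump (0 : Eucl n)) (p : Eucl n) : 𝓢(Eucl n, ℂ) :=
  (hasCompactSupport_fourierChar_mul χ p).toSchwartzMap (contDiff_fourierChar_mul χ p)

theorem modulatedBump_apply {n : ℕ} (χ : ContDiffBump (0 : Eucl n)) (p x : Eucl n) :
    modulatedBump χ p x = (𝐞 ⟪x, p⟫ : ℂ) * (χ x : ℂ) := rfl

theorem fourier_modulatedBump {n : ℕ} (χ : ContDiffBump (0 : Eucl n)) (p ξ : Eucl n) :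
    𝓕 (modulatedBump χ p) ξ = 𝓕 (modulatedBump χ 0) (ξ - p) := by
  rw [SchwartzMap.fourier_coe, SchwartzMap.fourier_coe, Real.fourier_eq, Real.fourier_eq]
  refine integral_congr_ae (Filter.Eventually.of_forall fun x => ?_)
  simp only [modulatedBump_apply, Circle.smul_def, smul_eq_mul]
  rw [← mul_assoc, ← mul_assoc, ← Circle.coe_mul, ← Circle.coe_mul, ← AddChar.map_add_eq_mul,
    ← AddChar.map_add_eq_mul, inner_sub_right, inner_zero_right]
  congr 3
  ring

theorem inner_modulatedBump {n : ℕ} (χ : ContDiffBump (0 : Eucl n)) (p : Eucl n)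
    (f : Lp ℂ 2 (volume : Measure (Eucl n))) :
    inner ℂ ((modulatedBump χ p).toLp 2 volume) f = ∫ x, 𝐞 (-⟪x, p⟫) • ((χ x : ℂ) * f x) := by
  rw [L2.inner_def]
  refine integral_congr_ae ?_
  filter_upwards [(modulatedBump χ p).coeFn_toLp 2 (volume : Measure (Eucl n))] with x hx
  rw [hx, modulatedBump_apply, RCLike.inner_apply, Circle.smul_def, smul_eq_mul, map_mul,
    Complex.conj_ofReal, AddChar.map_neg_eq_inv, Circle.coe_inv_eq_conj]
  ring

/-- The inner products are the Fourier coefficients of χ f, which is supported in a cube of side 2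
`rOut`; Parseval applies although f itself is not periodic. -/
theorem hasSum_inner_modulatedBump {n : ℕ} (χ : ContDiffBump (0 : Eucl n))
    (f : Lp ℂ 2 (volume : Measure (Eucl n))) :
    HasSum (fun k : Fin n → ℤ =>
        ‖inner ℂ ((modulatedBump χ (freq (2 * χ.rOut) k)).toLp 2 volume) f‖ ^ 2)
      ((2 * χ.rOut) ^ n * ∫ x, ‖(χ x : ℂ) * f x‖ ^ 2) := by
  have hr := χ.rOut_pos
  have hT : 0 < 2 * χ.rOut := by positivity
  set Q : Set (Eucl n) := cube (2 * χ.rOut) fun _ => -χ.rOut with hQ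
  have hQm : MeasurableSet Q := measurableSet_cube _ _
  have hsupp : ∀ x ∉ Q, χ x = 0 := by
    intro x hx
    by_contra h
    have h1 : x ∈ Metric.ball (0 : Eucl n) χ.rOut := by
      rw [← χ.support_eq]
      exact h
    refine hx fun i => ?_
    have h2 := (PiLp.norm_apply_le x i).trans_lt (mem_ball_zero_iff.mp h1)
    rw [Real.norm_eq_abs, abs_lt] at h2
    constructor <;> linarith [h2.1, h2.2]
  have hmem : MemLp (fun x => (χ x : ℂ) * f x) 2 volume := by
    refine (Lp.memLp f).of_le ?_ (Filter.Eventually.of_forall fun x => ?_)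
    · have hc : Continuous fun x => (χ x : ℂ) := Complex.continuous_ofReal.comp χ.continuous
      exact hc.aestronglyMeasurable.mul (Lp.aestronglyMeasurable f)
    · rw [norm_mul, Complex.norm_real, Real.norm_of_nonneg χ.nonneg]
      exact mul_le_of_le_one_left (norm_nonneg _) χ.le_one
  have key := hasSum_norm_sq_cube hT (fun _ => -χ.rOut) (hmem.restrict Q)
  have h1 : ∫ x in Q, ‖(χ x : ℂ) * f x‖ ^ 2 = ∫ x, ‖(χ x : ℂ) * f x‖ ^ 2 :=
    setIntegral_eq_integral_of_forall_compl_eq_zero fun x hx => by simp [hsupp x hx]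
  rw [← hQ, h1] at key
  refine key.congr_fun fun k => ?_
  rw [inner_modulatedBump, setIntegral_eq_integral_of_forall_compl_eq_zero]
  intro x hx
  simp [hsupp x hx]

theorem HsRn.norm_toComplex_le {n : ℕ} {s : ℝ} (hs : 0 ≤ s) (U : HsRn n s) :
    ‖U.toComplex‖ ≤ ‖U‖ := by
  refine le_trans (le_of_eq ?_) (HsRn.norm_incl_le hs U)
  rw [Lp.norm_def, Lp.norm_def]
  congr 1
  apply eLpNorm_congr_norm_ae
  filter_upwards [U.coeFn_toComplex] with x hx
  rw [hx, Complex.norm_real]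

theorem HsRn.integral_high_le {n : ℕ} {s : ℝ} (hs : 0 ≤ s) (U : HsRn n s) {R : ℝ} (hR : 0 < R) :
    ∫ ξ in (Metric.closedBall 0 R)ᶜ,
      ‖(𝓕 U.toComplex : Lp ℂ 2 (volume : Measure (Eucl n))) ξ‖ ^ 2 ≤ (R ^ 2) ^ (-s) * ‖U‖ ^ 2 := by
  rw [HsRn.norm_sq_eq hs, ← integral_const_mul]
  have hint := (HsRn.integrable_fourier hs U).const_mul ((R ^ 2) ^ (-s))
  refine le_trans ?_ (setIntegral_le_integral hint
    (Filter.Eventually.of_forall fun ξ => by positivity) (s := (Metric.closedBall 0 R)ᶜ))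
  refine integral_mono_of_nonneg (Filter.Eventually.of_forall fun ξ => by positivity)
    hint.integrableOn ?_
  filter_upwards [ae_restrict_mem Metric.isClosed_closedBall.measurableSet.compl] with ξ hξ
  have h1 : R < ‖ξ‖ := by
    rwa [Set.mem_compl_iff, mem_closedBall_zero_iff, not_le] at hξ
  rw [← mul_assoc, Real.rpow_neg (by positivity), ← div_eq_inv_mul]
  refine le_mul_of_one_le_left (by positivity) ?_
  rw [one_le_div (by positivity)]
  gcongr
  nlinarith

/-- Since χ = 1 on Ω, it suffices to sum the Fourier coefficients of χ f with large index. The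
high-frequency part of f is small by Sobolev smoothness, and its low-frequency part barely meets the
modulated bumps of large frequency, because the transform of χ decays rapidly. No boundary
regularity of Ω is involved. -/
theorem HsRn.exists_norm_restrict_le {n : ℕ} {Ω : Set (Eucl n)} (χ : ContDiffBump (0 : Eucl n))
    (hΩ : Ω ⊆ Metric.closedBall 0 χ.rIn) {s : ℝ} (hs : 0 ≤ s) :
    ∃ C : ℝ, 0 < C ∧ ∀ L : ℝ, 0 < L → ∀ U : HsRn n s,
      (∀ k : Fin n → ℤ, (∀ i, |(k i : ℝ)| ≤ L) →
        inner ℂ ((modulatedBump χ (freq (2 * χ.rOut) k)).toLp 2 volume) U.toComplex = 0) →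
      ‖HsRn.restrict Ω s U‖ ^ 2 ≤ C * (L ^ 2) ^ (-s) * ‖U‖ ^ 2 := by
  set T := 2 * χ.rOut with hTdef
  have hT : 0 < T := mul_pos two_pos χ.rOut_pos
  -- The decay order must leave a summable exponent 2s - 2M < -n after ‖freq‖^(-2s) has been spent
  -- on the rate.
  obtain ⟨M, hM⟩ := exists_nat_gt ((n + 2 * s) / 2)
  have hr : 2 * s - 2 * M < -(n : ℝ) := by linarith
  obtain ⟨I, hI, htail⟩ := exists_integral_tail_le (𝓕 (modulatedBump χ 0)) M
  have hsummable := summable_norm_freq_rpow (n := n) hT hr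
  set S := ∑' k : Fin n → ℤ, ‖freq T k‖ ^ (2 * s - 2 * M) with hS
  have hS0 : 0 ≤ S := tsum_nonneg fun k => by positivity
  refine ⟨2 * ((2 * T) ^ 2) ^ s + 2 * I * (T ^ 2) ^ s * S / T ^ n, by positivity,
    fun L hL U hU => ?_⟩
  set f := U.toComplex with hf
  -- The cut is at half of L/T, a lower bound for the frequencies whose coefficients survive, so the
  -- two are well separated.
  obtain ⟨lo, hhi, hlo⟩ := exists_frequency_split f (L / (2 * T))
  let H : (Fin n → ℤ) → Lp ℂ 2 (volume : Measure (Eucl n)) := fun k =>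
    (modulatedBump χ (freq T k)).toLp 2 volume
  have hFH : ∀ k, (𝓕 (H k) : Lp ℂ 2 (volume : Measure (Eucl n))) =ᵐ[volume]
      fun ξ => 𝓕 (modulatedBump χ 0) (ξ - freq T k) := by
    intro k
    have h1 : 𝓕 (H k) = (𝓕 (modulatedBump χ (freq T k))).toLp 2 volume :=
      SchwartzMap.toLp_fourier_eq _
    rw [h1]
    filter_upwards [(𝓕 (modulatedBump χ (freq T k))).coeFn_toLp 2 (volume : Measure (Eucl n))]
      with ξ hξ
    rw [hξ, fourier_modulatedBump]
  have hbound : ∀ k, ‖inner ℂ (H k) f‖ ^ 2 ≤ 2 * ‖inner ℂ (H k) (f - lo)‖ ^ 2 +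
      2 * I * ((L / T) ^ 2) ^ (-s) * ‖U‖ ^ 2 * ‖freq T k‖ ^ (2 * s - 2 * M) := by
    intro k
    by_cases hk : ∀ i, |(k i : ℝ)| ≤ L
    · have h0 : inner ℂ (H k) f = 0 := hU k hk
      rw [h0, norm_zero, zero_pow two_ne_zero]
      positivity
    · push Not at hk
      obtain ⟨i, hi⟩ := hk
      have hp : L / T < ‖freq T k‖ := lt_of_lt_of_le (by gcongr) (le_norm_freq hT k i)
      have hp0 : 0 < ‖freq T k‖ := lt_trans (by positivity) hp
      have h1 : ‖inner ℂ (H k) lo‖ ^ 2 ≤ I * ‖freq T k‖ ^ (-(2 * M : ℝ)) * ‖f‖ ^ 2 := by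
        refine (hlo (H k)).trans ?_
        gcongr
        have h2 := htail (L / (2 * T)) (freq T k) (norm_pos_iff.mp hp0) (by
          refine le_trans (le_of_eq ?_) hp.le
          field_simp)
        refine le_trans (le_of_eq ?_) h2
        refine setIntegral_congr_ae Metric.isClosed_closedBall.measurableSet ?_
        filter_upwards [hFH k] with ξ hξ _
        rw [hξ]
      have h3 : ‖freq T k‖ ^ (-(2 * M : ℝ)) ≤
          ((L / T) ^ 2) ^ (-s) * ‖freq T k‖ ^ (2 * s - 2 * M) := by
        have e1 : ‖freq T k‖ ^ (-(2 * M : ℝ)) =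
            (‖freq T k‖ ^ 2) ^ (-s) * ‖freq T k‖ ^ (2 * s - 2 * M) := by
          rw [← Real.rpow_natCast, ← Real.rpow_mul hp0.le, ← Real.rpow_add hp0]
          congr 1
          push_cast
          ring
        rw [e1]
        refine mul_le_mul_of_nonneg_right ?_ (by positivity)
        exact Real.rpow_le_rpow_of_nonpos (by positivity) (by gcongr) (by linarith)
      have h4 : ‖f‖ ^ 2 ≤ ‖U‖ ^ 2 := by
        gcongr
        exact HsRn.norm_toComplex_le hs U
      have h5 : ‖inner ℂ (H k) lo‖ ^ 2 ≤
          I * (((L / T) ^ 2) ^ (-s) * ‖freq T k‖ ^ (2 * s - 2 * M)) * ‖U‖ ^ 2 :=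
        h1.trans (by gcongr)
      have h6 : inner ℂ (H k) f = inner ℂ (H k) (f - lo) + inner ℂ (H k) lo := by
        rw [← inner_add_right, sub_add_cancel]
      have h7 := norm_add_le (inner ℂ (H k) (f - lo)) (inner ℂ (H k) lo)
      rw [← h6] at h7
      have h8 : ‖inner ℂ (H k) f‖ ^ 2 ≤
          2 * ‖inner ℂ (H k) (f - lo)‖ ^ 2 + 2 * ‖inner ℂ (H k) lo‖ ^ 2 := by
        have h9 := pow_le_pow_left₀ (norm_nonneg _) h7 2
        nlinarith [sq_nonneg (‖inner ℂ (H k) (f - lo)‖ - ‖inner ℂ (H k) lo‖)]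
      linarith
  have hle := hasSum_le hbound (hasSum_inner_modulatedBump χ f)
    (((hasSum_inner_modulatedBump χ (f - lo)).mul_left 2).add
      (hsummable.hasSum.mul_left (2 * I * ((L / T) ^ 2) ^ (-s) * ‖U‖ ^ 2)))
  rw [← hTdef, ← hS] at hle
  have hχhi : ∫ x, ‖(χ x : ℂ) * (f - lo : Lp ℂ 2 (volume : Measure (Eucl n))) x‖ ^ 2 ≤
      ((L / (2 * T)) ^ 2) ^ (-s) * ‖U‖ ^ 2 := by
    refine le_trans ?_ (HsRn.integral_high_le hs U (by positivity : 0 < L / (2 * T)))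
    rw [← hf, ← hhi, norm_sq_eq_integral]
    refine integral_mono_of_nonneg (Filter.Eventually.of_forall fun x => by positivity)
      (integrable_norm_sq _) (Filter.Eventually.of_forall fun x => ?_)
    dsimp only
    rw [norm_mul, Complex.norm_real, Real.norm_of_nonneg χ.nonneg]
    exact pow_le_pow_left₀ (mul_nonneg χ.nonneg (norm_nonneg _))
      (mul_le_of_le_one_left (norm_nonneg _) χ.le_one) 2
  have hχf : ‖HsRn.restrict Ω s U‖ ^ 2 ≤ ∫ x, ‖(χ x : ℂ) * f x‖ ^ 2 := by
    have hint : Integrable (fun x => ‖(χ x : ℂ) * f x‖ ^ 2) volume := by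
      refine (integrable_norm_sq f).mono' ?_ (Filter.Eventually.of_forall fun x => ?_)
      · have hc : Continuous fun x => (χ x : ℂ) := Complex.continuous_ofReal.comp χ.continuous
        exact (hc.aestronglyMeasurable.mul (Lp.aestronglyMeasurable f)).norm.pow 2
      · rw [Real.norm_of_nonneg (by positivity), norm_mul, Complex.norm_real,
          Real.norm_of_nonneg χ.nonneg]
        exact pow_le_pow_left₀ (mul_nonneg χ.nonneg (norm_nonneg _))
          (mul_le_of_le_one_left (norm_nonneg _) χ.le_one) 2
    have hE : ∫ x in Metric.closedBall 0 χ.rIn, ‖f x‖ ^ 2 =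
        ∫ x in Metric.closedBall 0 χ.rIn, ‖(χ x : ℂ) * f x‖ ^ 2 :=
      setIntegral_congr_fun Metric.isClosed_closedBall.measurableSet fun x hx => by
        simp only [χ.one_of_mem_closedBall hx, Complex.ofReal_one, one_mul]
    have hr : (fun x => ‖HsRn.restrict Ω s U x‖ ^ 2) =ᵐ[volume.restrict Ω] fun x => ‖f x‖ ^ 2 := by
      filter_upwards [HsRn.coeFn_restrict Ω U, ae_restrict_of_ae U.coeFn_toComplex] with x h1 h2
      rw [h1, h2, Complex.norm_real]
    rw [norm_sq_eq_integral, integral_congr_ae hr]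
    calc ∫ x in Ω, ‖f x‖ ^ 2 ≤ ∫ x in Metric.closedBall 0 χ.rIn, ‖f x‖ ^ 2 :=
          setIntegral_mono_set (integrable_norm_sq f).integrableOn
            (Filter.Eventually.of_forall fun x => by positivity) hΩ.eventuallyLE
      _ ≤ _ := by
          rw [hE]
          exact setIntegral_le_integral hint (Filter.Eventually.of_forall fun x => by positivity)
  have e1 : ∀ t : ℝ, 0 < t → ((L / t) ^ 2) ^ (-s) = (t ^ 2) ^ s * (L ^ 2) ^ (-s) := by
    intro t ht
    rw [div_pow, Real.div_rpow (by positivity) (by positivity), Real.rpow_neg (sq_nonneg t),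
      div_inv_eq_mul, mul_comm]
  rw [e1 _ (by positivity)] at hχhi hle
  have hTn : 0 < T ^ n := by positivity
  have h2 : T ^ n * ∫ x, ‖(χ x : ℂ) * f x‖ ^ 2 ≤ T ^ n *
      ((2 * ((2 * T) ^ 2) ^ s + 2 * I * (T ^ 2) ^ s * S / T ^ n) * (L ^ 2) ^ (-s) * ‖U‖ ^ 2) := by
    refine hle.trans ?_
    have h3 := mul_le_mul_of_nonneg_left hχhi hTn.le
    have h4 : T ^ n * ((2 * ((2 * T) ^ 2) ^ s + 2 * I * (T ^ 2) ^ s * S / T ^ n) *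
        (L ^ 2) ^ (-s) * ‖U‖ ^ 2) =
        2 * (T ^ n * (((2 * T) ^ 2) ^ s * (L ^ 2) ^ (-s) * ‖U‖ ^ 2)) +
          2 * I * ((T ^ 2) ^ s * (L ^ 2) ^ (-s)) * ‖U‖ ^ 2 * S := by
      field_simp
    rw [h4]
    linarith
  exact hχf.trans (le_of_mul_le_mul_left h2 hTn)

/-- The widths of the Sobolev inclusion: killing the windowed Fourier coefficients up to L imposes 2
(2L+1)ⁿ real conditions, and L is about m^(1/n). -/
theorem exists_approx_subspace {n : ℕ} (hn : 0 < n) {Ω : Set (Eucl n)}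
    (hb : Bornology.IsBounded Ω) {s : ℝ} (hs : 0 < s) :
    ∃ C : ℝ, 0 < C ∧ ∀ m : ℕ, 1 ≤ m → ∃ W : Submodule ℝ (L2 Ω), FiniteDimensional ℝ W ∧
      Module.finrank ℝ W ≤ m ∧
      ∀ u : Hs Ω s, ∃ w ∈ W, ‖Hs.toL2 Ω s u - w‖ ≤ C * (m : ℝ) ^ (-(s / n)) * ‖u‖ := by
  have := HsRn.completeSpace (n := n) hs.le
  obtain ⟨ρ, hρ, hΩρ⟩ := hb.subset_closedBall_lt 0 0
  let χ : ContDiffBump (0 : Eucl n) := ⟨ρ, 2 * ρ, hρ, by linarith⟩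
  obtain ⟨C, hC, hmain⟩ := HsRn.exists_norm_restrict_le χ hΩρ hs.le
  have hn0 : (0 : ℝ) < n := by exact_mod_cast hn
  refine ⟨(√C + 1) * 12 ^ s, by positivity, fun m hm => ?_⟩
  have hm1 : (1 : ℝ) ≤ m := by exact_mod_cast hm
  set x := (m : ℝ) ^ (1 / n : ℝ) with hx
  have hx0 : 0 < x := by positivity
  have hxn : x ^ n = m := by
    rw [hx, ← Real.rpow_natCast, ← Real.rpow_mul (by positivity), one_div, inv_mul_cancel₀ hn0.ne',
      Real.rpow_one]
  have hxs : x ^ (-s) = (m : ℝ) ^ (-(s / n)) := by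
    rw [hx, ← Real.rpow_mul (by positivity)]
    congr 1
    ring
  -- Below 6 no cutoff L ≥ 1 is available, and the zero space suffices thanks to the factor 12^s.
  -- Otherwise L ≤ x/6 gives 2L + 1 ≤ x/2, so that the doubled count is still at most xⁿ = m.
  rcases lt_or_ge x 6 with hx6 | hx6
  · refine ⟨⊥, inferInstance, by simp, fun u => ⟨0, Submodule.zero_mem _, ?_⟩⟩
    have h1 : ‖Hs.toL2 Ω s u‖ ≤ ‖u‖ := HsRn.norm_restrict_le Ω hs.le u.1
    have h2 : 1 ≤ (√C + 1) * 12 ^ s * (m : ℝ) ^ (-(s / n)) := by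
      have h3 : (1 : ℝ) ≤ 12 ^ s * x ^ (-s) := by
        rw [Real.rpow_neg hx0.le, ← div_eq_mul_inv, ← Real.div_rpow (by norm_num) hx0.le]
        exact Real.one_le_rpow (by rw [one_le_div hx0]; linarith) hs.le
      rw [← hxs, mul_assoc]
      have := Real.sqrt_nonneg C
      nlinarith
    rw [sub_zero]
    exact h1.trans (le_mul_of_one_le_left (norm_nonneg _) h2)
  · set L := ⌊x / 6⌋₊ with hL
    have hL1 : 1 ≤ L := (Nat.one_le_floor_iff _).mpr (by linarith)
    have hL1' : (1 : ℝ) ≤ L := by exact_mod_cast hL1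
    have hLx : (L : ℝ) ≤ x / 6 := Nat.floor_le (by positivity)
    have hxL : x / 12 ≤ L := by
      have := Nat.lt_floor_add_one (x / 6)
      rw [← hL] at this
      linarith
    let K : Finset (Fin n → ℤ) := Fintype.piFinset fun _ => Finset.Icc (-(L : ℤ)) L
    let toC : HsRn n s →ₗ[ℝ] Lp ℂ 2 (volume : Measure (Eucl n)) :=
      ((Complex.ofRealCLM.compLpL 2 (volume : Measure (Eucl n))).toLinearMap) ∘ₗ HsRn.incl n s
    let toC' : HsRn n s →L[ℝ] Lp ℂ 2 (volume : Measure (Eucl n)) :=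
      toC.mkContinuous 1 fun U => by
        rw [one_mul]
        exact HsRn.norm_toComplex_le hs.le U
    let Φ : HsRn n s →L[ℝ] (K → ℂ) := ContinuousLinearMap.pi fun k =>
      ((innerSL ℂ ((modulatedBump χ (freq (2 * χ.rOut) k)).toLp 2 volume)).restrictScalars ℝ) ∘L toC'
    have hΦ : ∀ U k, Φ U k =
        inner ℂ ((modulatedBump χ (freq (2 * χ.rOut) k)).toLp 2 volume) U.toComplex :=
      fun U k => rfl
    have hLs : (√C * (L : ℝ) ^ (-s)) ^ 2 = C * ((L : ℝ) ^ 2) ^ (-s) := by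
      rw [mul_pow, Real.sq_sqrt hC.le, Real.rpow_pow_comm (by positivity)]
    obtain ⟨W, hW1, hW2, hW3⟩ := exists_subspace_of_forall_ker (HsRn.restrict Ω s) Φ
      (δ := √C * (L : ℝ) ^ (-s)) (fun U hU => by
        refine le_of_sq_le_sq ?_ (by positivity)
        rw [mul_pow, hLs]
        refine hmain L (by positivity) U fun k hk => ?_
        have hkK : k ∈ K := Fintype.mem_piFinset.mpr fun i => by
          rw [Finset.mem_Icc, ← abs_le]
          exact_mod_cast hk i
        have h1 := congrFun hU ⟨k, hkK⟩
        rw [hΦ] at h1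
        exact h1) (by positivity)
    refine ⟨W, hW1, hW2.trans ?_, fun u => ?_⟩
    · have h1 : Module.finrank ℝ (K → ℂ) = K.card * 2 := by
        rw [Module.finrank_pi_fintype]
        simp [Complex.finrank_real_complex]
      have h2 : K.card = (2 * L + 1) ^ n := by
        rw [Fintype.card_piFinset]
        simp only [Int.card_Icc, Finset.prod_const, Finset.card_univ, Fintype.card_fin]
        congr 1
        omega
      rw [h1, h2]
      have h3 : ((2 * L + 1 : ℝ)) ^ n * 2 ≤ m := by
        have h4 : (2 * L + 1 : ℝ) ≤ x / 2 := by linarith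
        have h5 : (2 : ℝ) ≤ 2 ^ n := by
          calc (2 : ℝ) = 2 ^ 1 := by norm_num
            _ ≤ 2 ^ n := pow_le_pow_right₀ (by norm_num) hn
        calc ((2 * L + 1 : ℝ)) ^ n * 2 ≤ (x / 2) ^ n * 2 ^ n := by gcongr
          _ = m := by rw [← mul_pow, div_mul_cancel₀ _ two_ne_zero, hxn]
      exact_mod_cast h3
    · obtain ⟨U, hU1, hU2⟩ := Hs.exists_extension u
      obtain ⟨w, hw, hw'⟩ := hW3 U
      refine ⟨w, hw, ?_⟩
      rw [← hU1, ← hU2]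
      refine hw'.trans ?_
      have h1 : (L : ℝ) ^ (-s) ≤ 12 ^ s * (m : ℝ) ^ (-(s / n)) := by
        calc (L : ℝ) ^ (-s) ≤ (x / 12) ^ (-s) :=
              Real.rpow_le_rpow_of_nonpos (by positivity) hxL (by linarith)
          _ = 12 ^ s * (m : ℝ) ^ (-(s / n)) := by
              rw [Real.div_rpow hx0.le (by norm_num), hxs, Real.rpow_neg (by norm_num : (0:ℝ) ≤ 12),
                div_inv_eq_mul, mul_comm]
      calc √C * (L : ℝ) ^ (-s) * ‖U‖
          ≤ (√C + 1) * (12 ^ s * (m : ℝ) ^ (-(s / n))) * ‖U‖ := by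
            refine mul_le_mul_of_nonneg_right (mul_le_mul (by linarith) h1 ?_ ?_) (norm_nonneg _)
            · exact Real.rpow_nonneg L.cast_nonneg _
            · exact add_nonneg (Real.sqrt_nonneg C) zero_le_one
        _ = _ := by ring

end Approx

/-! ### Saturation of the approximation order -/

/-- The r-th difference with step τ annihilates Q and sends the r-th power to r! τ^r. Cauchy-Schwarz
bounds this by the values at the r + 1 sample points. -/
theorem exists_fwdDiff_le (r : ℕ) : ∃ D : ℝ, 0 < D ∧ ∀ (Q : Polynomial ℝ), Q.natDegree < r →
    ∀ t τ : ℝ, 0 < τ → (τ ^ r) ^ 2 ≤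
      D * ∑ i ∈ Finset.range (r + 1), ((t + i * τ) ^ r - Q.eval (t + i * τ)) ^ 2 := by
  let c : ℕ → ℝ := fun i => (-1) ^ (r - i) * r.choose i
  refine ⟨∑ i ∈ Finset.range (r + 1), c i ^ 2 + 1, by positivity, fun Q hQ t τ hτ => ?_⟩
  let ℓ : Polynomial ℝ := Polynomial.C τ * Polynomial.X + Polynomial.C t
  have hℓ : ℓ.natDegree = 1 := Polynomial.natDegree_linear hτ.ne'
  have hℓl : ℓ.leadingCoeff = τ := Polynomial.leadingCoeff_linear hτ.ne'
  have hℓe : ∀ x, ℓ.eval x = t + x * τ := fun x => by simp [ℓ]; ring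
  have hA : (ℓ ^ r).natDegree = r := by rw [Polynomial.natDegree_pow, hℓ, mul_one]
  have hB : (Q.comp ℓ).natDegree < (ℓ ^ r).natDegree := by
    rw [hA, Polynomial.natDegree_comp, hℓ, mul_one]
    exact hQ
  have hdeg : (ℓ ^ r - Q.comp ℓ).natDegree = r := by
    rw [Polynomial.natDegree_sub_eq_left_of_natDegree_lt hB, hA]
  have hlead : (ℓ ^ r - Q.comp ℓ).leadingCoeff = τ ^ r := by
    rw [Polynomial.leadingCoeff_sub_of_degree_lt (Polynomial.degree_lt_degree hB),
      Polynomial.leadingCoeff_pow, hℓl]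
  have key := congrFun (Polynomial.fwdDiff_iter_degree_eq_factorial (ℓ ^ r - Q.comp ℓ)) 0
  rw [hdeg, fwdDiff_iter_eq_sum_shift, hlead] at key
  have hsum : ∑ i ∈ Finset.range (r + 1), c i * ((t + i * τ) ^ r - Q.eval (t + i * τ)) =
      τ ^ r * (r.factorial : ℝ) := by
    refine Eq.trans ?_ (key.trans ?_)
    · refine Finset.sum_congr rfl fun i _ => ?_
      rw [Polynomial.eval_sub, Polynomial.eval_pow, Polynomial.eval_comp, hℓe, zsmul_eq_mul]
      simp [c]
    · simp
  have h1 : (1 : ℝ) ≤ r.factorial := by exact_mod_cast r.factorial_pos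
  calc (τ ^ r) ^ 2 ≤ (τ ^ r * (r.factorial : ℝ)) ^ 2 := by
        gcongr
        exact le_mul_of_one_le_right (by positivity) h1
    _ ≤ (∑ i ∈ Finset.range (r + 1), c i ^ 2) *
        ∑ i ∈ Finset.range (r + 1), ((t + i * τ) ^ r - Q.eval (t + i * τ)) ^ 2 := by
        rw [← hsum]
        exact Finset.sum_mul_sq_le_sq_mul_sq _ _ _
    _ ≤ _ := by
        gcongr
        linarith

/-- Freezing all other variables reduces to one variable. The coordinate is the first one because
`MvPolynomial.finSuccEquiv` splits off variable 0. -/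
theorem exists_fwdDiff_mvPolynomial_le {n : ℕ} (i₀ : Fin n) (h0 : (i₀ : ℕ) = 0) (r : ℕ) :
    ∃ D : ℝ, 0 < D ∧ ∀ p : MvPolynomial (Fin n) ℝ, p.degreeOf i₀ < r → ∀ (y : Eucl n) (τ : ℝ),
      0 < τ → (τ ^ r) ^ 2 ≤ D * ∑ i ∈ Finset.range (r + 1),
        ((y + EuclideanSpace.single i₀ (i * τ)) i₀ ^ r -
          MvPolynomial.eval (fun l => (y + EuclideanSpace.single i₀ (i * τ)) l) p) ^ 2 := by
  obtain ⟨D, hD, h⟩ := exists_fwdDiff_le r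
  refine ⟨D, hD, fun p hp y τ hτ => ?_⟩
  cases n with
  | zero => exact i₀.elim0
  | succ n =>
    obtain rfl : i₀ = 0 := Fin.ext h0
    let Q := Polynomial.map (MvPolynomial.eval fun l : Fin n => y l.succ)
      (MvPolynomial.finSuccEquiv ℝ n p)
    have hQ : Q.natDegree < r := by
      refine lt_of_le_of_lt Polynomial.natDegree_map_le ?_
      rwa [MvPolynomial.natDegree_finSuccEquiv]
    have he : ∀ a : ℝ, MvPolynomial.eval
        (fun l => (y + EuclideanSpace.single 0 a : Eucl (n + 1)) l) p = Q.eval (y 0 + a) := by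
      intro a
      rw [← MvPolynomial.eval_eq_eval_mv_eval']
      congr 2
      funext l
      refine Fin.cases ?_ (fun l => ?_) l <;> simp
    refine (h Q hQ (y 0) τ hτ).trans (le_of_eq ?_)
    congr 1
    refine Finset.sum_congr rfl fun i _ => ?_
    rw [he]
    simp

/-- Integrate the difference estimate over the ball of half the radius. The step R / (2(r+1)) keeps
all shifted points in the full ball, and the constant does not depend on R. -/
theorem exists_ball_polynomial_le {n : ℕ} (i₀ : Fin n) (h0 : (i₀ : ℕ) = 0) (r : ℕ) :
    ∃ κ : ℝ, 0 < κ ∧ ∀ p : MvPolynomial (Fin n) ℝ, p.degreeOf i₀ < r → ∀ (x : Eucl n) (R : ℝ),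
      0 < R → κ * (R ^ r) ^ 2 * R ^ n ≤
        ∫ y in Metric.ball x R, (y i₀ ^ r - MvPolynomial.eval (fun l => y l) p) ^ 2 := by
  obtain ⟨D, hD, hdiff⟩ := exists_fwdDiff_mvPolynomial_le i₀ h0 r
  have : Nonempty (Fin n) := ⟨i₀⟩
  set ω := volume.real (Metric.ball (0 : Eucl n) 1) with hω
  have hω0 : 0 < ω := by
    rw [hω, measureReal_def]
    exact ENNReal.toReal_pos (Metric.measure_ball_pos _ _ one_pos).ne' measure_ball_lt_top.ne
  have hvol : ∀ (x : Eucl n) {R : ℝ}, 0 ≤ R → volume.real (Metric.ball x R) = R ^ n * ω := by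
    intro x R hR
    rw [measureReal_def, Measure.addHaar_ball _ _ hR, finrank_euclideanSpace_fin, ENNReal.toReal_mul,
      ENNReal.toReal_ofReal (by positivity)]
    rfl
  refine ⟨((2 * (r + 1 : ℝ)) ^ r)⁻¹ ^ 2 * ω * 2⁻¹ ^ n / (D * (r + 1)), by positivity,
    fun p hp x R hR => ?_⟩
  set g : Eucl n → ℝ := fun y => (y i₀ ^ r - MvPolynomial.eval (fun l => y l) p) ^ 2 with hg
  have hgc : Continuous g := by
    have h1 : Continuous fun y : Eucl n => MvPolynomial.eval (fun l => y l) p :=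
      (MvPolynomial.continuous_eval p).comp (by fun_prop)
    fun_prop
  have hint : ∀ (z : Eucl n) (R : ℝ), IntegrableOn g (Metric.ball z R) := fun z R =>
    (hgc.continuousOn.integrableOn_compact (isCompact_closedBall z R)).mono_set
      Metric.ball_subset_closedBall
  set τ := R / (2 * (r + 1)) with hτ
  have hτ0 : 0 < τ := by positivity
  have hshift : ∀ i ∈ Finset.range (r + 1),
      IntegrableOn (fun y => g (y + EuclideanSpace.single i₀ (i * τ))) (Metric.ball x (R / 2)) ∧
      ∫ y in Metric.ball x (R / 2), g (y + EuclideanSpace.single i₀ (i * τ)) ≤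
        ∫ y in Metric.ball x R, g y := by
    intro i hi
    set a : Eucl n := EuclideanSpace.single i₀ (i * τ) with ha
    have hna : ‖a‖ ≤ R / 2 := by
      rw [ha, PiLp.norm_single, Real.norm_of_nonneg (by positivity), hτ]
      have : (i : ℝ) ≤ r + 1 := by exact_mod_cast (Finset.mem_range.mp hi).le
      calc (i : ℝ) * (R / (2 * (r + 1))) ≤ (r + 1) * (R / (2 * (r + 1))) := by gcongr
        _ = R / 2 := by field_simp
    have hpre : (fun y => y + a) ⁻¹' Metric.ball (x + a) (R / 2) = Metric.ball x (R / 2) := by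
      ext y
      simp
    refine ⟨((hgc.comp (continuous_add_const a)).continuousOn.integrableOn_compact
      (isCompact_closedBall x (R / 2))).mono_set Metric.ball_subset_closedBall, ?_⟩
    rw [← hpre, (measurePreserving_add_right volume a).setIntegral_preimage_emb
      (measurableEmbedding_addRight a) g]
    refine setIntegral_mono_set (hint x R) (Filter.Eventually.of_forall fun y => sq_nonneg _)
      (Metric.ball_subset_ball' ?_).eventuallyLE
    rw [dist_eq_norm, add_sub_cancel_left]
    linarith
  have key : (τ ^ r) ^ 2 * volume.real (Metric.ball x (R / 2)) ≤
      D * ((r + 1) * ∫ y in Metric.ball x R, g y) := by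
    calc (τ ^ r) ^ 2 * volume.real (Metric.ball x (R / 2))
        = ∫ _ in Metric.ball x (R / 2), (τ ^ r) ^ 2 := by
          rw [setIntegral_const, smul_eq_mul, mul_comm]
      _ ≤ ∫ y in Metric.ball x (R / 2),
          D * ∑ i ∈ Finset.range (r + 1), g (y + EuclideanSpace.single i₀ (i * τ)) :=
          integral_mono_of_nonneg (Filter.Eventually.of_forall fun y => by positivity)
            ((integrable_finsetSum _ fun i hi => (hshift i hi).1).const_mul D)
            (Filter.Eventually.of_forall fun y => hdiff p hp y τ hτ0)
      _ = D * ∑ i ∈ Finset.range (r + 1),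
          ∫ y in Metric.ball x (R / 2), g (y + EuclideanSpace.single i₀ (i * τ)) := by
          rw [integral_const_mul, integral_finsetSum _ fun i hi => (hshift i hi).1]
      _ ≤ D * ∑ i ∈ Finset.range (r + 1), ∫ y in Metric.ball x R, g y := by
          gcongr with i hi
          exact (hshift i hi).2
      _ = _ := by
          rw [Finset.sum_const, Finset.card_range, nsmul_eq_mul]
          push_cast
          ring
  rw [hvol x (by positivity)] at key
  have h1 : (τ ^ r) ^ 2 * ((R / 2) ^ n * ω) =
      (R ^ r) ^ 2 * R ^ n * (((2 * (r + 1 : ℝ)) ^ r)⁻¹ ^ 2 * ω * 2⁻¹ ^ n) := by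
    rw [hτ, div_pow, div_pow, div_pow, inv_pow, inv_pow]
    ring
  rw [h1] at key
  rw [div_mul_eq_mul_div, div_mul_eq_mul_div, div_le_iff₀ (by positivity)]
  linarith

theorem Hs.exists_coordinate_pow {n : ℕ} {Ω : Set (Eucl n)} (hΩ : MeasurableSet Ω)
    (hb : Bornology.IsBounded Ω) {s : ℝ} (hs : 0 ≤ s) (i : Fin n) (r : ℕ) :
    ∃ w : Hs Ω s, Hs.toL2 Ω s w =ᵐ[volume.restrict Ω] fun x => x i ^ r := by
  obtain ⟨ρ, hρ, hΩρ⟩ := hb.subset_closedBall_lt 0 0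
  let χ : ContDiffBump (0 : Eucl n) := ⟨ρ, 2 * ρ, hρ, by linarith⟩
  have hcd : ContDiff ℝ (↑(⊤ : ℕ∞)) fun x : Eucl n => ((χ x * x i ^ r : ℝ) : ℂ) := by
    have hχ : ContDiff ℝ (↑(⊤ : ℕ∞)) χ := χ.contDiff
    have h1 : ContDiff ℝ (↑(⊤ : ℕ∞)) fun x : Eucl n => χ x * x i ^ r := by fun_prop
    exact Complex.ofRealCLM.contDiff.comp h1
  have hcs : HasCompactSupport fun x : Eucl n => ((χ x * x i ^ r : ℝ) : ℂ) :=
    (χ.hasCompactSupport.mul_right (f' := fun x : Eucl n => x i ^ r)).comp_left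
      (g := fun t : ℝ => (t : ℂ)) Complex.ofReal_zero
  obtain ⟨U, hU⟩ := HsRn.exists_toComplex_eq s (hcs.toSchwartzMap hcd) fun x =>
    Complex.ofReal_im _
  obtain ⟨w, hw, -⟩ := Hs.exists_of_extension Ω hs U
  refine ⟨w, ?_⟩
  rw [hw]
  have h1 := U.coeFn_toComplex
  rw [hU] at h1
  filter_upwards [HsRn.coeFn_restrict Ω U, ae_restrict_of_ae h1,
    ae_restrict_of_ae ((hcs.toSchwartzMap hcd).coeFn_toLp 2 (volume : Measure (Eucl n))),
    ae_restrict_mem hΩ] with x h2 h3 h4 h5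
  rw [h3] at h4
  have h6 : ((HsRn.incl n s U x : ℝ) : ℂ) = ((χ x * x i ^ r : ℝ) : ℂ) := h4
  rw [h2, Complex.ofReal_injective h6, χ.one_of_mem_closedBall (hΩρ h5), one_mul]

/-- Shape regularity makes the volume of each cell comparable to that of its inscribed ball, so
lower bounds on the balls add up to one on Ω without counting cells. Replacing C by max C 1 only
secures positivity. -/
theorem IsMesh.le_integral {n : ℕ} {Ω : Set (Eucl n)} (hb : Bornology.IsBounded Ω) {c C h : ℝ}
    (hc : 0 < c) (hh : 0 < h) {T : Set (Set (Eucl n))} (hT : IsMesh Ω c C h T) {f : Eucl n → ℝ}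
    (hf : IntegrableOn f Ω) (hf0 : ∀ x, 0 ≤ f x) {κ : ℝ} (hκ : 0 ≤ κ)
    (hfκ : ∀ K ∈ T, ∀ x, Metric.ball x (c * h) ⊆ K →
      κ * (c * h) ^ n ≤ ∫ y in Metric.ball x (c * h), f y) :
    κ * (c / max C 1) ^ n * volume.real Ω ≤
      volume.real (Metric.ball (0 : Eucl n) 1) * ∫ y in Ω, f y := by
  have : Fintype T := hT.finite.fintype
  set ω := volume.real (Metric.ball (0 : Eucl n) 1) with hω
  set C' := max C 1 with hC'
  have hC0 : 0 < C' := lt_max_of_lt_right one_pos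
  have hfin : ∀ K ⊆ Ω, volume K ≠ ∞ := fun K hK =>
    ((measure_mono hK).trans_lt hb.measure_lt_top).ne
  have hcell : ∀ K : T, κ * (c / C') ^ n * volume.real (K : Set (Eucl n)) ≤
      ω * ∫ y in (K : Set (Eucl n)), f y := by
    intro K
    have hKΩ := hT.subset K K.2
    obtain ⟨x, hx⟩ := hT.ball K K.2
    have hxK : x ∈ (K : Set (Eucl n)) := hx (Metric.mem_ball_self (by positivity))
    have h1 : (K : Set (Eucl n)) ⊆ Metric.closedBall x (C' * h) := by
      intro y hy
      refine (Metric.dist_le_diam_of_mem (hb.subset hKΩ) hy hxK).trans ((hT.diam K K.2).trans ?_)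
      gcongr
      exact le_max_left _ _
    have h2 : volume.real (K : Set (Eucl n)) ≤ (C' * h) ^ n * ω := by
      refine (measureReal_mono h1 measure_closedBall_lt_top.ne).trans (le_of_eq ?_)
      rw [measureReal_def, Measure.addHaar_closedBall _ _ (by positivity),
        finrank_euclideanSpace_fin, ENNReal.toReal_mul, ENNReal.toReal_ofReal (by positivity)]
      rfl
    have h3 : ∫ y in Metric.ball x (c * h), f y ≤ ∫ y in (K : Set (Eucl n)), f y :=
      setIntegral_mono_set (hf.mono_set hKΩ) (Filter.Eventually.of_forall hf0) hx.eventuallyLE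
    calc κ * (c / C') ^ n * volume.real (K : Set (Eucl n))
        ≤ κ * (c / C') ^ n * ((C' * h) ^ n * ω) := by gcongr
      _ = ω * (κ * (c * h) ^ n) := by
          rw [div_pow, mul_pow, mul_pow]
          field_simp
      _ ≤ _ := by
          gcongr
          exact (hfκ K K.2 x hx).trans h3
  have hUΩ : ⋃ K : T, (K : Set (Eucl n)) ⊆ Ω := Set.iUnion_subset fun K => hT.subset K K.2
  have hvol : volume.real Ω ≤ ∑ K : T, volume.real (K : Set (Eucl n)) := by
    have h1 : volume Ω ≤ volume (⋃ K : T, (K : Set (Eucl n))) := by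
      refine measure_mono_ae (ae_le_set.mpr ?_)
      rw [← Set.sUnion_eq_iUnion]
      exact hT.cover
    exact (ENNReal.toReal_mono (hfin _ hUΩ) h1).trans (measureReal_iUnion_fintype_le _)
  have hint : ∑ K : T, ∫ y in (K : Set (Eucl n)), f y ≤ ∫ y in Ω, f y := by
    have h1 := integral_iUnion_ae (μ := volume) (f := f) (s := fun K : T => (K : Set (Eucl n)))
      (fun K => (hT.measurable K K.2).nullMeasurableSet)
      (fun K L hKL => hT.disjoint K K.2 L L.2 fun h => hKL (Subtype.ext h)) (hf.mono_set hUΩ)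
    rw [tsum_fintype] at h1
    rw [← h1]
    exact setIntegral_mono_set hf (Filter.Eventually.of_forall hf0) hUΩ.eventuallyLE
  calc κ * (c / C') ^ n * volume.real Ω
      ≤ κ * (c / C') ^ n * ∑ K : T, volume.real (K : Set (Eucl n)) := by gcongr
    _ ≤ ω * ∑ K : T, ∫ y in (K : Set (Eucl n)), f y := by
        rw [Finset.mul_sum, Finset.mul_sum]
        exact Finset.sum_le_sum fun K _ => hcell K
    _ ≤ _ := by gcongr

/-- One function serves all levels: the r-th power of the first coordinate, suitably scaled. On the
inscribed ball of every cell it stays away from polynomials of degree less than r in that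
coordinate. -/
theorem IsMultiscale.exists_far_of_lt {n : ℕ} (hn : 0 < n) {Ω : Set (Eucl n)} (hΩ : IsOpen Ω)
    (hne : Ω.Nonempty) (hb : Bornology.IsBounded Ω) {r : ℕ} {V : ℕ → Submodule ℝ (L2 Ω)}
    (hV : IsMultiscale Ω r V) {s : ℝ} (hs : 0 < s) :
    ∃ c : ℝ, 0 < c ∧ ∀ j, ∃ w : Hs Ω s, ‖w‖ ≤ 1 ∧
      ∀ v ∈ V j, c * meshWidth j ^ r ≤ ‖Hs.toL2 Ω s w - v‖ := by
  have : Nonempty (Fin n) := ⟨⟨0, hn⟩⟩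
  obtain ⟨w₀, hw₀⟩ := Hs.exists_coordinate_pow hΩ.measurableSet hb hs.le (⟨0, hn⟩ : Fin n) r
  obtain ⟨κ, hκ, hball⟩ := exists_ball_polynomial_le (⟨0, hn⟩ : Fin n) rfl r
  obtain ⟨c, C, T, hc, hT⟩ := hV.piecewise
  set ω := volume.real (Metric.ball (0 : Eucl n) 1) with hω
  have hω0 : 0 < ω := ENNReal.toReal_pos (Metric.measure_ball_pos _ _ one_pos).ne'
    measure_ball_lt_top.ne
  have hΩ0 : 0 < volume.real Ω := ENNReal.toReal_pos (hΩ.measure_pos volume hne).ne'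
    hb.measure_lt_top.ne
  have hC0 : 0 < max C 1 := lt_max_of_lt_right one_pos
  set A := κ * (c ^ r) ^ 2 * (c / max C 1) ^ n * volume.real Ω / ω with hA
  have hA0 : 0 < A := by positivity
  have hN : 0 < ‖w₀‖ + 1 := by positivity
  have key : ∀ j, ∀ v ∈ V j, √A * meshWidth j ^ r ≤ ‖Hs.toL2 Ω s w₀ - v‖ := by
    intro j v hv
    have hh := meshWidth_pos j
    obtain ⟨hmesh, hcells⟩ := hT j
    set g := Hs.toL2 Ω s w₀ - v with hg
    have h1 := hmesh.le_integral hb hc hh (f := fun x => ‖g x‖ ^ 2) (integrable_norm_sq g)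
      (fun x => by positivity) (κ := κ * ((c * meshWidth j) ^ r) ^ 2) (by positivity)
      (fun K hK x hx => by
        obtain ⟨p, hp, hvp⟩ := (hcells K hK).1 v hv
        refine (hball p (hp _) x (c * meshWidth j) (by positivity)).trans (le_of_eq ?_)
        have hKΩ := hmesh.subset K hK
        have h2 : ∀ᵐ y ∂volume.restrict (Metric.ball x (c * meshWidth j)),
            v y = MvPolynomial.eval (fun l => y l) p := ae_restrict_of_ae_restrict_of_subset hx hvp
        have h3 := ae_restrict_of_ae_restrict_of_subset (hx.trans hKΩ) hw₀
        have h4 := ae_restrict_of_ae_restrict_of_subset (hx.trans hKΩ)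
          (Lp.coeFn_sub (Hs.toL2 Ω s w₀) v)
        refine integral_congr_ae ?_
        filter_upwards [h2, h3, h4] with y h2 h3 h4
        rw [hg, h4, Pi.sub_apply, h3, h2, Real.norm_eq_abs, sq_abs])
    rw [← norm_sq_eq_integral, ← hω] at h1
    have h2 : (√A * meshWidth j ^ r) ^ 2 ≤ ‖g‖ ^ 2 := by
      rw [mul_pow, Real.sq_sqrt hA0.le, hA, div_mul_eq_mul_div, div_le_iff₀ hω0]
      refine le_trans (le_of_eq ?_) (h1.trans (le_of_eq (mul_comm _ _)))
      rw [mul_pow c]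
      ring
    exact le_of_sq_le_sq h2 (norm_nonneg _)
  refine ⟨√A / (‖w₀‖ + 1), div_pos (Real.sqrt_pos.mpr hA0) hN, fun j =>
    ⟨(‖w₀‖ + 1)⁻¹ • w₀, ?_, fun v hv => ?_⟩⟩
  · rw [norm_smul, norm_inv, Real.norm_of_nonneg hN.le, ← div_eq_inv_mul, div_le_one hN]
    linarith
  · have h1 := key j ((‖w₀‖ + 1) • v) ((V j).smul_mem _ hv)
    have h2 : Hs.toL2 Ω s ((‖w₀‖ + 1)⁻¹ • w₀) - v =
        (‖w₀‖ + 1)⁻¹ • (Hs.toL2 Ω s w₀ - (‖w₀‖ + 1) • v) := by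
      rw [map_smul, smul_sub, smul_smul, inv_mul_cancel₀ hN.ne', one_smul]
    rw [h2, norm_smul, norm_inv, Real.norm_of_nonneg hN.le, div_mul_eq_mul_div, ← div_eq_inv_mul]
    exact div_le_div_of_nonneg_right h1 hN.le

theorem meshWidth_rpow (j : ℕ) (μ : ℝ) : meshWidth j ^ μ = ((2 : ℝ) ^ j) ^ (-μ) := by
  rw [meshWidth, Real.rpow_neg (by positivity), ← Real.inv_rpow (by positivity), one_div, inv_pow]

theorem IsMultiscale.exists_dim {n : ℕ} {Ω : Set (Eucl n)} {r : ℕ}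
    {V : ℕ → Submodule ℝ (L2 Ω)} (hV : IsMultiscale Ω r V) :
    ∃ c C : ℝ, 0 < c ∧ 0 < C ∧ ∀ j : ℕ, c * ((2 : ℝ) ^ j) ^ (n : ℝ) ≤ Module.finrank ℝ (V j) ∧
      (Module.finrank ℝ (V j) : ℝ) ≤ C * ((2 : ℝ) ^ j) ^ (n : ℝ) := by
  obtain ⟨c, C, hc, hd⟩ := hV.dim
  have hC : 0 < C := by
    have h1 := (hd 0).1.trans (hd 0).2
    simp at h1
    linarith
  refine ⟨c, C, hc, hC, fun j => ?_⟩
  rw [Real.rpow_natCast, ← pow_mul]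
  exact hd j

/-- By counting dimensions some nonzero u in X has its image orthogonal to V; the distance of that
image to V is its full norm, which the inverse estimate bounds below. -/
theorem exists_unit_far {E G : Type*} [NormedAddCommGroup E] [InnerProductSpace ℝ E]
    [NormedAddCommGroup G] [InnerProductSpace ℝ G] (i : G →ₗ[ℝ] E) (X : Submodule ℝ G)
    [FiniteDimensional ℝ X] (V : Submodule ℝ E) [FiniteDimensional ℝ V]
    (hVX : Module.finrank ℝ V < Module.finrank ℝ X) {C : ℝ} (hC : 0 < C)
    (hX : ∀ u ∈ X, ‖u‖ ≤ C * ‖i u‖) : ∃ w : G, ‖w‖ ≤ 1 ∧ ∀ v ∈ V, C⁻¹ ≤ ‖i w - v‖ := by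
  let P : X →ₗ[ℝ] V := (V.orthogonalProjectionOnto : E →ₗ[ℝ] V) ∘ₗ i ∘ₗ X.subtype
  obtain ⟨u, hu, hu0⟩ := (Submodule.ne_bot_iff _).mp (LinearMap.ker_ne_bot_of_finrank_lt (f := P) hVX)
  have hu1 : i u ∈ Vᗮ := by
    have h1 : V.orthogonalProjectionOnto (i u) = 0 := hu
    exact Submodule.orthogonalProjectionOnto_eq_zero_iff.mp h1
  have hn : 0 < ‖(u : G)‖ := norm_pos_iff.mpr fun h => hu0 (Subtype.ext h)
  refine ⟨‖(u : G)‖⁻¹ • (u : G), ?_, fun v hv => ?_⟩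
  · rw [norm_smul, norm_inv, norm_norm, inv_mul_cancel₀ hn.ne']
  · have h1 : ‖i (‖(u : G)‖⁻¹ • (u : G))‖ ≤ ‖i (‖(u : G)‖⁻¹ • (u : G)) - v‖ := by
      have h2 : inner ℝ (i (‖(u : G)‖⁻¹ • (u : G))) v = 0 := by
        rw [map_smul, inner_smul_left, real_inner_comm, hu1 v hv, mul_zero]
      have h3 := norm_sub_sq_real (i (‖(u : G)‖⁻¹ • (u : G))) v
      rw [h2] at h3
      refine le_of_sq_le_sq ?_ (norm_nonneg _)
      nlinarith [sq_nonneg ‖v‖]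
    refine le_trans ?_ h1
    rw [map_smul, norm_smul, norm_inv, norm_norm, ← div_eq_inv_mul, le_div_iff₀ hn,
      ← div_eq_inv_mul, div_le_iff₀ hC]
    linarith [hX u u.2]

/-- Two obstructions: for r < s the order saturates because of the polynomial degree, and for s ≤ r
a space of dimension ~ 2^(jn) cannot do better than 2^(-js). -/
theorem IsMultiscale.exists_far {n : ℕ} (hn : 0 < n) {Ω : Set (Eucl n)} (hΩ : IsOpen Ω)
    (hne : Ω.Nonempty) (hb : Bornology.IsBounded Ω) {r : ℕ}
    {V : ℕ → Submodule ℝ (L2 Ω)} (hV : IsMultiscale Ω r V) {s : ℝ} (hs : 0 < s) :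
    ∃ c : ℝ, 0 < c ∧ ∀ j, ∃ w : Hs Ω s, ‖w‖ ≤ 1 ∧
      ∀ v ∈ V j, c * meshWidth j ^ min s r ≤ ‖Hs.toL2 Ω s w - v‖ := by
  have hn0 : (0 : ℝ) < n := by exact_mod_cast hn
  rcases lt_or_ge (r : ℝ) s with hrs | hrs
  · rw [min_eq_right hrs.le]
    simp only [Real.rpow_natCast]
    exact hV.exists_far_of_lt hn hΩ hne hb hs
  · rw [min_eq_left hrs]
    obtain ⟨C, hC, hinv⟩ := exists_inverse_subspace hn hΩ hne hs.le
    obtain ⟨_, D, _, hD, hdim⟩ := hV.exists_dim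
    refine ⟨(C * (D + 1) ^ (s / n))⁻¹, by positivity, fun j => ?_⟩
    obtain ⟨X, hX1, hX2, hX3⟩ := hinv (Module.finrank ℝ (V j) + 1) (Nat.le_add_left _ _)
    have := hV.finiteDimensional j
    obtain ⟨w, hw, hw'⟩ := exists_unit_far (Hs.toL2 Ω s) X (V j) hX2 (by positivity) hX3
    refine ⟨w, hw, fun v hv => le_trans ?_ (hw' v hv)⟩
    have h2j : (1 : ℝ) ≤ ((2 : ℝ) ^ j) ^ (n : ℝ) :=
      Real.one_le_rpow (one_le_pow₀ one_le_two) hn0.le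
    have h1 : (((Module.finrank ℝ (V j) + 1 : ℕ) : ℝ)) ^ (s / n) ≤
        (D + 1) ^ (s / n) * ((2 : ℝ) ^ j) ^ s := by
      calc (((Module.finrank ℝ (V j) + 1 : ℕ) : ℝ)) ^ (s / n)
          ≤ ((D + 1) * ((2 : ℝ) ^ j) ^ (n : ℝ)) ^ (s / n) := by
            refine Real.rpow_le_rpow (by positivity) ?_ (by positivity)
            push_cast
            linarith [(hdim j).2]
        _ = _ := by
            rw [Real.mul_rpow (by positivity) (by positivity), ← Real.rpow_mul (by positivity)]
            congr 2
            field_simp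
    rw [meshWidth_rpow, Real.rpow_neg (by positivity), ← mul_inv]
    refine inv_anti₀ (by positivity) ?_
    rw [mul_assoc]
    gcongr

/-! ### The spaces as cross products -/

instance Hs.completeSpace {n : ℕ} (Ω : Set (Eucl n)) (s : ℝ) [hs : Fact (0 ≤ s)] :
    CompleteSpace (Hs Ω s) := by
  have := HsRn.completeSpace (n := n) hs.out
  exact (Submodule.isClosed_orthogonal (LinearMap.ker (HsRn.restrict Ω s))).completeSpace_coe

theorem Hs.norm_toL2_le {n : ℕ} (Ω : Set (Eucl n)) {s : ℝ} (hs : 0 ≤ s) (u : Hs Ω s) :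
    ‖Hs.toL2 Ω s u‖ ≤ ‖u‖ :=
  HsRn.norm_restrict_le Ω hs u.1

/-- The inclusion `Hˢ(Ω) ⊂ L²(Ω)` as a continuous map. -/
def Hs.toL2L {n : ℕ} (Ω : Set (Eucl n)) (s : ℝ) [hs : Fact (0 ≤ s)] : Hs Ω s →L[ℝ] L2 Ω :=
  (Hs.toL2 Ω s).mkContinuous 1 fun u => by
    rw [one_mul]
    exact Hs.norm_toL2_le Ω hs.out u

theorem Hs.norm_toL2L_le {n : ℕ} (Ω : Set (Eucl n)) (s : ℝ) [Fact (0 ≤ s)] :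
    ‖Hs.toL2L Ω s‖ ≤ 1 :=
  LinearMap.mkContinuous_norm_le _ zero_le_one _

theorem isCross_tensorBilin {X Y : Type*} [MeasurableSpace X] [MeasurableSpace Y] (μ : Measure X)
    (ν : Measure Y) [SigmaFinite μ] [SigmaFinite ν] : IsCross (tensorBilin μ ν) :=
  fun u₁ u₂ v₁ v₂ => inner_tensorFun u₁ u₂ v₁ v₂

/-- The map `(u, v) ↦ u ⊗ v` into the Hilbert space tensor product. -/
def HMix.tmul {n₁ n₂ : ℕ} (Ω₁ : Set (Eucl n₁)) (Ω₂ : Set (Eucl n₂)) (s₁ s₂ : ℝ) :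
    Hs Ω₁ s₁ →ₗ[ℝ] Hs Ω₂ s₂ →ₗ[ℝ] HMix Ω₁ Ω₂ s₁ s₂ :=
  (TensorProduct.mk ℝ (Hs Ω₁ s₁) (Hs Ω₂ s₂)).compr₂
    (UniformSpace.Completion.toComplₗᵢ (𝕜 := ℝ) (E := Hs Ω₁ s₁ ⊗[ℝ] Hs Ω₂ s₂)).toLinearMap

theorem HMix.isCross_tmul {n₁ n₂ : ℕ} (Ω₁ : Set (Eucl n₁)) (Ω₂ : Set (Eucl n₂)) (s₁ s₂ : ℝ) :
    IsCross (HMix.tmul Ω₁ Ω₂ s₁ s₂) := fun x x' y y' =>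
  (UniformSpace.Completion.inner_coe (𝕜 := ℝ) (x ⊗ₜ[ℝ] y) (x' ⊗ₜ[ℝ] y')).trans
    (by rw [TensorProduct.inner_tmul])

theorem HMix.dense_span_tmul {n₁ n₂ : ℕ} (Ω₁ : Set (Eucl n₁)) (Ω₂ : Set (Eucl n₂)) (s₁ s₂ : ℝ) :
    Dense (Submodule.span ℝ {h | ∃ x y, h = HMix.tmul Ω₁ Ω₂ s₁ s₂ x y} :
      Set (HMix Ω₁ Ω₂ s₁ s₂)) := by
  refine UniformSpace.Completion.denseRange_coe.mono ?_
  rintro _ ⟨z, rfl⟩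
  induction z with
  | zero =>
    rw [UniformSpace.Completion.coe_zero]
    exact Submodule.zero_mem _
  | add x y hx hy =>
    rw [UniformSpace.Completion.coe_add]
    exact Submodule.add_mem _ hx hy
  | tmul x y => exact Submodule.subset_span ⟨x, y, rfl⟩

/-! ### Choice of levels -/

theorem exists_level_le {C μ : ℝ} (hC : 0 < C) (hμ : 0 < μ) :
    ∃ C' : ℝ, 0 < C' ∧ ∀ ε : ℝ, 0 < ε → ε ≤ 1 →
      ∃ j : ℕ, C * meshWidth j ^ μ ≤ ε ∧ (2 : ℝ) ^ j ≤ C' * ε ^ (-(1 / μ)) := by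
  set K := max C 1 with hK
  have hK1 : 1 ≤ K := le_max_right _ _
  refine ⟨2 * K ^ (1 / μ), by positivity, fun ε hε hε1 => ?_⟩
  have hX : 1 ≤ (K / ε) ^ (1 / μ) :=
    Real.one_le_rpow (by rw [one_le_div hε]; linarith) (by positivity)
  obtain ⟨j, hj1, hj2⟩ := exists_nat_pow_near hX (one_lt_two (α := ℝ))
  refine ⟨j + 1, ?_, ?_⟩
  · rw [meshWidth_rpow]
    have h1 : ((2 : ℝ) ^ (j + 1)) ^ (-μ) ≤ ((K / ε) ^ (1 / μ)) ^ (-μ) :=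
      Real.rpow_le_rpow_of_nonpos (by positivity) hj2.le (by linarith)
    rw [← Real.rpow_mul (by positivity), show 1 / μ * -μ = -1 by field_simp, Real.rpow_neg_one,
      inv_div] at h1
    calc C * ((2 : ℝ) ^ (j + 1)) ^ (-μ) ≤ K * (ε / K) := by
          gcongr
          exact le_max_left _ _
      _ = ε := by field_simp
  · rw [pow_succ, mul_comm, mul_assoc, Real.rpow_neg hε.le, ← div_eq_mul_inv,
      ← Real.div_rpow (by positivity) hε.le]
    gcongr

/-- Halving c makes the first inequality strict. The second one is about j + 1 because level j is
shown to be too coarse, so that j + 1 is the first admissible level. -/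
theorem exists_level_ge {c μ : ℝ} (hc : 0 < c) (hμ : 0 < μ) :
    ∃ c' : ℝ, 0 < c' ∧ ∀ ε : ℝ, 0 < ε → ε ≤ c / 2 →
      ∃ j : ℕ, ε < c * meshWidth j ^ μ ∧ c' * ε ^ (-(1 / μ)) ≤ (2 : ℝ) ^ (j + 1) := by
  refine ⟨(c / 2) ^ (1 / μ), by positivity, fun ε hε hε1 => ?_⟩
  have hX : 1 ≤ (c / 2 / ε) ^ (1 / μ) :=
    Real.one_le_rpow (by rw [one_le_div hε]; linarith) (by positivity)
  obtain ⟨j, hj1, hj2⟩ := exists_nat_pow_near hX (one_lt_two (α := ℝ))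
  refine ⟨j, ?_, ?_⟩
  · rw [meshWidth_rpow]
    have h1 : ((c / 2 / ε) ^ (1 / μ)) ^ (-μ) ≤ ((2 : ℝ) ^ j) ^ (-μ) :=
      Real.rpow_le_rpow_of_nonpos (by positivity) hj1 (by linarith)
    rw [← Real.rpow_mul (by positivity), show 1 / μ * -μ = -1 by field_simp, Real.rpow_neg_one,
      inv_div] at h1
    calc ε < 2 * ε := by linarith
      _ = c * (ε / (c / 2)) := by field_simp
      _ ≤ _ := by gcongr
  · rw [Real.rpow_neg hε.le, ← div_eq_mul_inv, ← Real.div_rpow (by positivity) hε.le]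
    exact hj2.le

theorem exists_count_le {C β : ℝ} (hC : 0 < C) (hβ : 0 < β) :
    ∃ C' : ℝ, 0 < C' ∧ ∀ ε : ℝ, 0 < ε → ε ≤ 1 →
      ∃ m : ℕ, 1 ≤ m ∧ C * (m : ℝ) ^ (-β) ≤ ε ∧ (m : ℝ) ≤ C' * ε ^ (-(1 / β)) := by
  set K := max C 1 with hK
  have hK1 : 1 ≤ K := le_max_right _ _
  refine ⟨2 * K ^ (1 / β), by positivity, fun ε hε hε1 => ?_⟩
  have hX : 1 ≤ (K / ε) ^ (1 / β) :=
    Real.one_le_rpow (by rw [one_le_div hε]; linarith) (by positivity)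
  have hm : (K / ε) ^ (1 / β) ≤ (⌈(K / ε) ^ (1 / β)⌉₊ : ℝ) := Nat.le_ceil _
  refine ⟨⌈(K / ε) ^ (1 / β)⌉₊, Nat.one_le_ceil_iff.mpr (by linarith), ?_, ?_⟩
  · have h1 : (⌈(K / ε) ^ (1 / β)⌉₊ : ℝ) ^ (-β) ≤ ((K / ε) ^ (1 / β)) ^ (-β) :=
      Real.rpow_le_rpow_of_nonpos (by positivity) hm (by linarith)
    rw [← Real.rpow_mul (by positivity), show 1 / β * -β = -1 by field_simp, Real.rpow_neg_one,
      inv_div] at h1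
    calc C * (⌈(K / ε) ^ (1 / β)⌉₊ : ℝ) ^ (-β) ≤ K * (ε / K) := by
          gcongr
          exact le_max_left _ _
      _ = ε := by field_simp
  · have h2 := (Nat.ceil_lt_add_one (zero_le_one.trans hX)).le
    rw [mul_assoc, Real.rpow_neg hε.le, ← div_eq_mul_inv,
      ← Real.div_rpow (by positivity) hε.le]
    linarith

theorem exists_count_ge {c β : ℝ} (hc : 0 < c) (hβ : 0 < β) :
    ∃ c' : ℝ, 0 < c' ∧ ∀ ε : ℝ, 0 < ε → ε ≤ c →
      ∃ m : ℕ, 1 ≤ m ∧ ε * (m : ℝ) ^ β ≤ c ∧ c' * ε ^ (-(1 / β)) ≤ m := by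
  refine ⟨c ^ (1 / β) / 2, by positivity, fun ε hε hε1 => ?_⟩
  have hX : 1 ≤ (c / ε) ^ (1 / β) :=
    Real.one_le_rpow (by rwa [one_le_div hε]) (by positivity)
  have hm : (⌊(c / ε) ^ (1 / β)⌋₊ : ℝ) ≤ (c / ε) ^ (1 / β) := Nat.floor_le (by positivity)
  have h1m : 1 ≤ ⌊(c / ε) ^ (1 / β)⌋₊ := (Nat.one_le_floor_iff _).mpr hX
  refine ⟨⌊(c / ε) ^ (1 / β)⌋₊, h1m, ?_, ?_⟩
  · have h1 : (⌊(c / ε) ^ (1 / β)⌋₊ : ℝ) ^ β ≤ ((c / ε) ^ (1 / β)) ^ β := by gcongr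
    rw [← Real.rpow_mul (by positivity), show 1 / β * β = 1 by field_simp, Real.rpow_one] at h1
    calc ε * (⌊(c / ε) ^ (1 / β)⌋₊ : ℝ) ^ β ≤ ε * (c / ε) := by gcongr
      _ = c := by field_simp
  · have h2 := Nat.lt_floor_add_one ((c / ε) ^ (1 / β))
    have h3 : (1 : ℝ) ≤ (⌊(c / ε) ^ (1 / β)⌋₊ : ℝ) := by exact_mod_cast h1m
    rw [Real.rpow_neg hε.le, ← div_eq_mul_inv, div_right_comm,
      ← Real.div_rpow hc.le hε.le]
    linarith

/-! ### Orthonormal families -/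

/-- Orthonormalize with respect to the weaker inner product; the inverse estimate then turns into an
upper Riesz bound in the stronger norm. Orthogonality to z₀ costs one dimension, hence m + 1. -/
theorem exists_orthonormal_of_inverse {E G : Type*} [NormedAddCommGroup E] [InnerProductSpace ℝ E]
    [NormedAddCommGroup G] [InnerProductSpace ℝ G] (i : G →ₗ[ℝ] E) (X : Submodule ℝ G)
    [FiniteDimensional ℝ X] {C : ℝ} (hX : ∀ u ∈ X, ‖u‖ ≤ C * ‖i u‖) {m : ℕ}
    (hm : m + 1 ≤ Module.finrank ℝ X) (z₀ : E) :
    ∃ e : Fin m → G, Orthonormal ℝ (fun k => i (e k)) ∧ (∀ k, inner ℝ z₀ (i (e k)) = 0) ∧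
      ∀ c : Fin m → ℝ, ‖∑ k, c k • e k‖ ^ 2 ≤ C ^ 2 * ∑ k, c k ^ 2 := by
  let ψ : X →ₗ[ℝ] ℝ := (innerₛₗ ℝ z₀) ∘ₗ i ∘ₗ X.subtype
  let N := LinearMap.ker ψ
  have hN : m ≤ Module.finrank ℝ N := by
    have h1 := LinearMap.finrank_range_add_finrank_ker ψ
    have h2 : Module.finrank ℝ (LinearMap.range ψ) ≤ 1 :=
      (Submodule.finrank_le _).trans (Module.finrank_self ℝ).le
    change m ≤ Module.finrank ℝ (LinearMap.ker ψ)
    omega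
  let L : N →ₗ[ℝ] E := i ∘ₗ X.subtype ∘ₗ N.subtype
  have hL : Function.Injective L := (injective_iff_map_eq_zero _).mpr fun u hu => by
    have h1 := hX _ u.1.2
    have h2 : i (u.1 : G) = 0 := hu
    rw [h2, norm_zero, mul_zero, norm_le_zero_iff] at h1
    exact Subtype.ext (Subtype.ext h1)
  let Y := LinearMap.range L
  have hY : Module.finrank ℝ Y = Module.finrank ℝ N := LinearMap.finrank_range_of_inj hL
  let b := stdOrthonormalBasis ℝ Y
  have hmY : m ≤ Module.finrank ℝ Y := hY ▸ hN
  have hb : ∀ k : Fin m, ∃ u : N, L u = b (Fin.castLE hmY k) := fun k =>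
    LinearMap.mem_range.mp (b (Fin.castLE hmY k)).2
  choose u hu using hb
  have horth : Orthonormal ℝ fun k => i (u k : G) := by
    have h1 : Orthonormal ℝ fun k : Fin m => (b (Fin.castLE hmY k) : E) :=
      (b.orthonormal.comp_linearIsometry Y.subtypeₗᵢ).comp _ (Fin.castLE_injective hmY)
    have h2 : (fun k => i (u k : G)) = fun k : Fin m => (b (Fin.castLE hmY k) : E) :=
      funext fun k => hu k
    rw [h2]
    exact h1
  refine ⟨fun k => u k, horth, fun k => (u k).2, fun c => ?_⟩
  have h1 := hX (∑ k, c k • (u k : G)) (Submodule.sum_mem _ fun k _ =>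
    Submodule.smul_mem _ _ (u k).1.2)
  have h2 : ‖i (∑ k, c k • (u k : G))‖ ^ 2 = ∑ k, c k ^ 2 := by
    rw [map_sum, ← real_inner_self_eq_norm_sq]
    simp only [map_smul]
    rw [horth.inner_sum]
    exact Finset.sum_congr rfl fun k _ => by simp [sq]
  calc ‖∑ k, c k • (u k : G)‖ ^ 2 ≤ (C * ‖i (∑ k, c k • (u k : G))‖) ^ 2 := by gcongr
    _ = _ := by rw [mul_pow, h2]

theorem Hs.exists_orthonormal {n : ℕ} (hn : 0 < n) {Ω : Set (Eucl n)} (hΩ : IsOpen Ω)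
    (hne : Ω.Nonempty) {s : ℝ} (hs : 0 < s) :
    ∃ C : ℝ, 0 < C ∧ ∀ (z₀ : L2 Ω) (m : ℕ), 1 ≤ m → ∃ e : Fin m → Hs Ω s,
      Orthonormal ℝ (fun k => Hs.toL2 Ω s (e k)) ∧
      (∀ k, inner ℝ z₀ (Hs.toL2 Ω s (e k)) = 0) ∧
      ∀ c : Fin m → ℝ, ‖∑ k, c k • e k‖ ^ 2 ≤
        (C * (m : ℝ) ^ (s / n)) ^ 2 * ∑ k, c k ^ 2 := by
  obtain ⟨C, hC, h⟩ := exists_inverse_subspace hn hΩ hne hs.le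
  refine ⟨C * 2 ^ (s / n), by positivity, fun z₀ m hm => ?_⟩
  obtain ⟨X, hX, hmX, hX'⟩ := h (m + 1) (by omega)
  refine exists_orthonormal_of_inverse (Hs.toL2 Ω s) X (fun u hu => (hX' u hu).trans ?_) hmX z₀
  have h1 : ((m + 1 : ℕ) : ℝ) ≤ 2 * m := by
    have : (1 : ℝ) ≤ m := by exact_mod_cast hm
    push_cast; linarith
  rw [mul_assoc C (2 ^ (s / n)), ← Real.mul_rpow (by positivity) (by positivity)]
  gcongr

namespace IsCross

variable {E F H : Type*} [NormedAddCommGroup E] [InnerProductSpace ℝ E]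
    [NormedAddCommGroup F] [InnerProductSpace ℝ F] [NormedAddCommGroup H] [InnerProductSpace ℝ H]
    {t : E →ₗ[ℝ] F →ₗ[ℝ] H} [CompleteSpace E] [CompleteSpace H]
    {G₁ G₂ K : Type*} [NormedAddCommGroup G₁] [InnerProductSpace ℝ G₁]
    [NormedAddCommGroup G₂] [InnerProductSpace ℝ G₂]
    [NormedAddCommGroup K] [InnerProductSpace ℝ K]
    {τ : G₁ →ₗ[ℝ] G₂ →ₗ[ℝ] K} {i₁ : G₁ →L[ℝ] E} {i₂ : G₂ →L[ℝ] F} {j : K →L[ℝ] H}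

/-- An element of the unit ball that can neither be approximated by few terms nor in a subspace
that is bad for `w`. -/
theorem exists_hard_element (ht : IsCross t) (hτ : IsCross τ)
    (hj : ∀ x y, j (τ x y) = t (i₁ x) (i₂ y)) {m : ℕ} (hm : 1 ≤ m) {e : Fin m → G₁}
    {z : Fin m → G₂} {D₁ D₂ : ℝ} (hD₁ : 0 < D₁) (hD₂ : 0 < D₂)
    (he : Orthonormal ℝ fun k => i₁ (e k)) (he' : ∀ k, ‖e k‖ ≤ D₁)
    (hz : Orthonormal ℝ fun k => i₂ (z k))
    (hz' : ∀ c : Fin m → ℝ, ‖∑ k, c k • z k‖ ^ 2 ≤ D₂ ^ 2 * ∑ k, c k ^ 2)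
    {z₀ : G₂} (hz₀ : ‖i₂ z₀‖ = 1) (hz₀' : ∀ k, inner ℝ (i₂ z₀) (i₂ (z k)) = 0)
    {w : G₁} (hw : ‖w‖ ≤ 1) {V : Submodule ℝ E} {q : ℝ} (hV : ∀ v ∈ V, q ≤ ‖i₁ w - v‖) :
    ∃ φ : K, ‖φ‖ ≤ 1 ∧ ∀ (R : ℕ) (x : ℕ → E) (y : ℕ → F) (ε : ℝ),
      ‖j φ - ∑ k ∈ Finset.range R, t (x k) (y k)‖ ≤ ε →
      (m - R : ℝ) ≤ 4 * m * (D₁ * D₂) ^ 2 * ε ^ 2 ∧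
      ((∀ k < R, x k ∈ V) → q / (2 * ‖z₀‖) ≤ ε) := by
  have hm0 : (0 : ℝ) < m := by exact_mod_cast hm
  have hz₀0 : 0 < ‖z₀‖ := by
    rw [norm_pos_iff]
    rintro rfl
    simp at hz₀
  -- The weights a and b give each of the two parts norm at most 1/2.
  set a : ℝ := (2 * Real.sqrt m * (D₁ * D₂))⁻¹ with ha
  set b : ℝ := (2 * ‖z₀‖)⁻¹ with hb
  have ha0 : 0 < a := by positivity
  have hb0 : 0 < b := by positivity
  have ha2 : a ^ 2 * (4 * m * (D₁ * D₂) ^ 2) = 1 := by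
    rw [ha, inv_pow, mul_pow, mul_pow, Real.sq_sqrt hm0.le]
    field_simp
    ring
  set φ : K := a • ∑ k, τ (e k) (z k) + b • τ w z₀ with hφ
  have h1 : ‖a • ∑ k, τ (e k) (z k)‖ ≤ 1 / 2 := by
    have := hτ.norm_sum_le_of_forall hD₂.le he' hz'
    refine le_of_sq_le_sq ?_ (by norm_num)
    rw [norm_smul, mul_pow, Real.norm_eq_abs, sq_abs]
    nlinarith [mul_le_mul_of_nonneg_left this (sq_nonneg a)]
  have h2 : ‖b • τ w z₀‖ ≤ 1 / 2 := by
    rw [norm_smul, hτ.norm_apply, Real.norm_eq_abs, abs_of_pos hb0, hb]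
    calc (2 * ‖z₀‖)⁻¹ * (‖w‖ * ‖z₀‖) ≤ (2 * ‖z₀‖)⁻¹ * (1 * ‖z₀‖) := by gcongr
      _ = 1 / 2 := by field_simp
  have hjφ : j φ = a • ∑ k, t (i₁ (e k)) (i₂ (z k)) + b • t (i₁ w) (i₂ z₀) := by
    rw [hφ, map_add, map_smul, map_smul, map_sum]
    simp only [hj]
  -- Because z₀ is orthogonal to the zₖ after inclusion, the two parts do not interfere: the zₖ see
  -- only the m equal singular values, and z₀ sees only w.
  have h3 : ∀ k, ht.op (j φ) (i₂ (z k)) = a • i₁ (e k) := by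
    intro k
    rw [hjφ, op_add, op_smul, op_smul, op_sum]
    simp only [add_apply, smul_apply, sum_apply, op_apply_cross]
    rw [Finset.sum_eq_single k, real_inner_self_eq_norm_sq, hz.1, real_inner_comm, hz₀']
    · simp
    · intro l _ hl
      rw [hz.2 (Ne.symm hl), zero_smul]
    · intro h; exact absurd (Finset.mem_univ k) h
  have h4 : ht.op (j φ) (i₂ z₀) = b • i₁ w := by
    rw [hjφ, op_add, op_smul, op_smul, op_sum]
    simp only [add_apply, smul_apply, sum_apply, op_apply_cross, hz₀', zero_smul]
    rw [real_inner_self_eq_norm_sq, hz₀]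
    simp
  refine ⟨φ, ?_, fun R x y ε h => ⟨?_, fun hx => ?_⟩⟩
  · exact (norm_add_le _ _).trans (by linarith)
  · have h5 := ht.sq_mul_sub_le he hz h3 x y h
    have h6 := mul_le_mul_of_nonneg_left h5 (by positivity : 0 ≤ 4 * m * (D₁ * D₂) ^ 2)
    have h7 : 4 * m * (D₁ * D₂) ^ 2 * (a ^ 2 * (m - R)) = (m - R : ℝ) := by
      rw [← mul_assoc, mul_comm _ (a ^ 2), ha2, one_mul]
    rwa [h7] at h6
  · obtain ⟨v, hv, hv'⟩ := ht.exists_mem_norm_op_sub_le hz₀ V x hx y h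
    rw [h4] at hv'
    have h8 := hV _ (V.smul_mem b⁻¹ hv)
    have h9 : ‖b • i₁ w - v‖ = b * ‖i₁ w - b⁻¹ • v‖ := by
      rw [← Real.norm_of_nonneg hb0.le, ← norm_smul, Real.norm_of_nonneg hb0.le, smul_sub,
        smul_smul, mul_inv_cancel₀ hb0.ne', one_smul]
    rw [h9] at hv'
    rw [div_eq_inv_mul]
    exact (mul_le_mul_of_nonneg_left h8 hb0.le).trans hv'

end IsCross

/-! ### The number of degrees of freedom -/

theorem IsMultiscale.not_finiteDimensional {n : ℕ} (hn : 0 < n) {Ω : Set (Eucl n)} {r : ℕ}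
    {V : ℕ → Submodule ℝ (L2 Ω)} (hV : IsMultiscale Ω r V) : ¬ FiniteDimensional ℝ (L2 Ω) := by
  intro h
  obtain ⟨c, C, hc, hd⟩ := hV.dim
  obtain ⟨j, hj⟩ := pow_unbounded_of_one_lt (Module.finrank ℝ (L2 Ω) / c : ℝ)
    (one_lt_two (α := ℝ))
  have h1 : (2 : ℝ) ^ j ≤ 2 ^ (j * n) := by
    gcongr
    · norm_num
    · exact Nat.le_mul_of_pos_right j hn
  have h2 : (Module.finrank ℝ (V j) : ℝ) ≤ Module.finrank ℝ (L2 Ω) := by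
    exact_mod_cast Submodule.finrank_le (V j)
  have h3 := (hd j).1
  rw [div_lt_iff₀ hc] at hj
  nlinarith

theorem discreteSVDDofs_mono {n₁ n₂ : ℕ} {Ω₁ : Set (Eucl n₁)} {Ω₂ : Set (Eucl n₂)}
    (V₁ : ℕ → Submodule ℝ (L2 Ω₁)) (V₂ : ℕ → Submodule ℝ (L2 Ω₂)) (f : L2prod Ω₁ Ω₂) (ε : ℝ) :
    discreteSVDDofs IsBestApprox IsBestApprox V₁ V₂ f ε ⊆
      discreteSVDDofs (fun V _ w => w ∈ V) (fun V _ w => w ∈ V) V₁ V₂ f ε := by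
  rintro N ⟨R, j₁, j₂, σ, u, u', v, v', h, h₁, h₂, h₃, h₄⟩
  exact ⟨R, j₁, j₂, σ, u, u', v, v', h, fun k hk => (h₁ k hk).1, fun k hk => (h₂ k hk).1, h₃, h₄⟩

theorem dofSVDFree_le_dofSVD {n₁ n₂ : ℕ} {Ω₁ : Set (Eucl n₁)} {Ω₂ : Set (Eucl n₂)} (s₁ s₂ : ℝ)
    (V₁ : ℕ → Submodule ℝ (L2 Ω₁)) (V₂ : ℕ → Submodule ℝ (L2 Ω₂)) (ε : ℝ) :
    dofSVDFree s₁ s₂ V₁ V₂ ε ≤ dofSVD s₁ s₂ V₁ V₂ ε :=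
  iSup₂_mono fun _ _ => biInf_mono (discreteSVDDofs_mono _ _ _ _)

section

variable {n₁ n₂ : ℕ} {Ω₁ : Set (Eucl n₁)} {Ω₂ : Set (Eucl n₂)} {r₁ r₂ : ℕ}
  {V₁ : ℕ → Submodule ℝ (L2 Ω₁)} {V₂ : ℕ → Submodule ℝ (L2 Ω₂)} {s₁ s₂ : ℝ}

theorem HMix.toL2_tmul_eq (hs₁ : Fact (0 ≤ s₁)) (hs₂ : Fact (0 ≤ s₂)) (x : Hs Ω₁ s₁)
    (y : Hs Ω₂ s₂) :
    HMix.toL2 Ω₁ Ω₂ s₁ s₂ (HMix.tmul Ω₁ Ω₂ s₁ s₂ x y) =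
      tensorBilin (volume.restrict Ω₁) (volume.restrict Ω₂) (Hs.toL2L Ω₁ s₁ x)
        (Hs.toL2L Ω₂ s₂ y) :=
  HMix.toL2_tmul Ω₁ Ω₂ hs₁.out hs₂.out x y

theorem rate_exponent_eq (hn₁ : 0 < n₁) (hn₂ : 0 < n₂) (hs₁ : 0 < s₁) (hs₂ : 0 < s₂) :
    (n₁ : ℝ) * n₂ / (s₁ * n₂ + s₂ * n₁) = 1 / (s₁ / n₁ + s₂ / n₂) := by
  have h1 : (0 : ℝ) < n₁ := by exact_mod_cast hn₁
  have h2 : (0 : ℝ) < n₂ := by exact_mod_cast hn₂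
  field_simp

/-- The dimension of the space in `V` of the coarsest level with accuracy `ε`. -/
theorem IsMultiscale.exists_level (hn₁ : 0 < n₁) (hV₁ : IsMultiscale Ω₁ r₁ V₁) (hr₁ : 1 ≤ r₁)
    (hs₁ : 0 < s₁) :
    ∃ C : ℝ, 0 < C ∧ ∀ ε : ℝ, 0 < ε → ε ≤ 1 → ∃ j : ℕ,
      (∀ u : Hs Ω₁ s₁, ∃ v ∈ V₁ j, ‖Hs.toL2 Ω₁ s₁ u - v‖ ≤ ε / 3 * ‖u‖) ∧
      (Module.finrank ℝ (V₁ j) : ℝ) ≤ C * ε ^ (-((n₁ : ℝ) / min s₁ r₁)) := by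
  have hμ : 0 < min s₁ (r₁ : ℝ) := lt_min hs₁ (by exact_mod_cast hr₁)
  obtain ⟨C₁, hC₁, h₁⟩ := hV₁.exists_close hs₁
  obtain ⟨C₂, hC₂, h₂⟩ := exists_level_le (C := 3 * C₁) (by positivity) hμ
  obtain ⟨_, C₃, _, hC₃, h₃⟩ := hV₁.exists_dim
  refine ⟨C₃ * C₂ ^ (n₁ : ℝ), by positivity, fun ε hε hε1 => ?_⟩
  obtain ⟨j, hj, hj'⟩ := h₂ ε hε hε1
  refine ⟨j, fun u => ?_, (h₃ j).2.trans ?_⟩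
  · obtain ⟨v, hv, hv'⟩ := h₁ j u
    refine ⟨v, hv, hv'.trans ?_⟩
    gcongr
    linarith
  · rw [mul_assoc]
    gcongr
    have h4 : ((2 : ℝ) ^ j) ^ (n₁ : ℝ) ≤ (C₂ * ε ^ (-(1 / min s₁ (r₁ : ℝ)))) ^ (n₁ : ℝ) := by
      gcongr
    refine h4.trans_eq ?_
    rw [Real.mul_rpow hC₂.le (by positivity), ← Real.rpow_mul hε.le]
    congr 2
    ring

/-- The tolerance is split into three thirds, for the truncation and for the discretization in each
variable. The number of terms is 2m, one m for each of the two auxiliary spaces. -/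
theorem exists_le_of_unit_ball (hn₁ : 0 < n₁) (hn₂ : 0 < n₂)
    (hb₁ : Bornology.IsBounded Ω₁) (hb₂ : Bornology.IsBounded Ω₂)
    (hr₁ : 1 ≤ r₁) (hr₂ : 1 ≤ r₂) (hV₁ : IsMultiscale Ω₁ r₁ V₁) (hV₂ : IsMultiscale Ω₂ r₂ V₂)
    (hs₁ : 0 < s₁) (hs₂ : 0 < s₂) :
    ∃ C : ℝ, 0 < C ∧ ∀ ε : ℝ, 0 < ε → ε ≤ 1 → ∀ φ : HMix Ω₁ Ω₂ s₁ s₂, ‖φ‖ ≤ 1 →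
      ∃ N ∈ discreteSVDDofs IsBestApprox IsBestApprox V₁ V₂ (HMix.toL2 Ω₁ Ω₂ s₁ s₂ φ) ε,
        (N : ℝ) ≤ C * (ε ^ (-((n₁ : ℝ) * n₂ / (s₁ * n₂ + s₂ * n₁))) *
          ε ^ (-max ((n₁ : ℝ) / min s₁ r₁) ((n₂ : ℝ) / min s₂ r₂))) := by
  have hs₁' : Fact (0 ≤ s₁) := ⟨hs₁.le⟩
  have hs₂' : Fact (0 ≤ s₂) := ⟨hs₂.le⟩
  have hn₁' : (0 : ℝ) < n₁ := by exact_mod_cast hn₁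
  have hn₂' : (0 : ℝ) < n₂ := by exact_mod_cast hn₂
  obtain ⟨A₁, hA₁, hW₁⟩ := exists_approx_subspace hn₁ hb₁ hs₁
  obtain ⟨A₂, hA₂, hW₂⟩ := exists_approx_subspace hn₂ hb₂ hs₂
  obtain ⟨B₁, hB₁, hL₁⟩ := hV₁.exists_level hn₁ hr₁ hs₁
  obtain ⟨B₂, hB₂, hL₂⟩ := hV₂.exists_level hn₂ hr₂ hs₂
  obtain ⟨C, hC, hm⟩ := exists_count_le (C := 3 * (A₁ * A₂)) (β := s₁ / n₁ + s₂ / n₂)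
    (by positivity) (by positivity)
  rw [rate_exponent_eq hn₁ hn₂ hs₁ hs₂]
  set β := s₁ / n₁ + s₂ / n₂ with hβ
  set ρ := max ((n₁ : ℝ) / min s₁ r₁) ((n₂ : ℝ) / min s₂ r₂) with hρ
  refine ⟨2 * C * (B₁ + B₂), by positivity, fun ε hε hε1 φ hφ => ?_⟩
  obtain ⟨m, hm1, hm2, hm3⟩ := hm ε hε hε1
  obtain ⟨W₁, hfW₁, hdW₁, haW₁⟩ := hW₁ m hm1
  obtain ⟨W₂, hfW₂, hdW₂, haW₂⟩ := hW₂ m hm1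
  obtain ⟨j₁, haV₁, hdV₁⟩ := hL₁ ε hε hε1
  obtain ⟨j₂, haV₂, hdV₂⟩ := hL₂ ε hε hε1
  have hfV₁ := hV₁.finiteDimensional j₁
  have hfV₂ := hV₂.finiteDimensional j₂
  have ht := isCross_tensorBilin (volume.restrict Ω₁) (volume.restrict Ω₂)
  have hτ := HMix.isCross_tmul Ω₁ Ω₂ s₁ s₂
  have hj := HMix.toL2_tmul_eq (Ω₁ := Ω₁) (Ω₂ := Ω₂) hs₁' hs₂'
  have hd := HMix.dense_span_tmul Ω₁ Ω₂ s₁ s₂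
  obtain ⟨σ, u, v, hσ, hanti, hu, hv, hf⟩ := ht.exists_svd
    (hV₁.not_finiteDimensional hn₁) (hV₂.not_finiteDimensional hn₂)
    (IsCross.map_mem_closure_span hj hd φ)
  have key := ht.norm_sub_discrete_le hτ hj hd hφ (Hs.norm_toL2L_le Ω₁ s₁)
    (Hs.norm_toL2L_le Ω₂ s₂) hσ hanti hu hv hf W₁ W₂ (by positivity) (by positivity) haW₁ haW₂
    (R := m + m) (by gcongr) (V₁ j₁) (V₂ j₂) (η₁ := ε / 3) (η₂ := ε / 3) (by positivity)
    (by positivity) haV₁ haV₂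
  have hbest : ∀ {n : ℕ} {Ω : Set (Eucl n)} (V : Submodule ℝ (L2 Ω)) [V.HasOrthogonalProjection]
      (u : L2 Ω), IsBestApprox V u (V.starProjection u) := fun V _ u =>
    ⟨V.starProjection_apply_mem u, fun z hz => norm_sub_starProjection_le V u hz⟩
  refine ⟨_, ⟨m + m, j₁, j₂, σ, u, fun k => (V₁ j₁).starProjection (u k), v,
    fun k => (V₂ j₂).starProjection (v k), ⟨hσ, hanti, hu, hv, hf⟩, fun k _ => hbest _ _,
    fun k _ => hbest _ _, key.trans ?_, rfl⟩, ?_⟩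
  · have h1 : A₁ * (m : ℝ) ^ (-(s₁ / n₁)) * (A₂ * (m : ℝ) ^ (-(s₂ / n₂))) =
        A₁ * A₂ * (m : ℝ) ^ (-β) := by
      have hm0 : (0 : ℝ) < m := by exact_mod_cast hm1
      rw [hβ, neg_add, Real.rpow_add hm0]
      ring
    rw [h1]
    linarith
  -- As ε ≤ 1, the larger exponent bounds both dimensions.
  · have h1 : ∀ x : ℝ, x ≤ ρ → ε ^ (-x) ≤ ε ^ (-ρ) := fun x hx =>
      Real.rpow_le_rpow_of_exponent_ge hε hε1 (by linarith)
    have h2 : (Module.finrank ℝ (V₁ j₁) : ℝ) ≤ B₁ * ε ^ (-ρ) :=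
      hdV₁.trans (mul_le_mul_of_nonneg_left (h1 _ (le_max_left _ _)) hB₁.le)
    have h3 : (Module.finrank ℝ (V₂ j₂) : ℝ) ≤ B₂ * ε ^ (-ρ) :=
      hdV₂.trans (mul_le_mul_of_nonneg_left (h1 _ (le_max_right _ _)) hB₂.le)
    push_cast
    calc ((m : ℝ) + m) * (Module.finrank ℝ (V₁ j₁) + Module.finrank ℝ (V₂ j₂))
        ≤ (C * ε ^ (-(1 / β)) + C * ε ^ (-(1 / β))) * (B₁ * ε ^ (-ρ) + B₂ * ε ^ (-ρ)) := by
          gcongr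
      _ = _ := by ring

end

/-- The lower bound where the resolution in the first variable counts. -/
theorem exists_hard_of_left {n₁ n₂ : ℕ} (hn₁ : 0 < n₁) (hn₂ : 0 < n₂)
    {Ω₁ : Set (Eucl n₁)} {Ω₂ : Set (Eucl n₂)}
    (hΩ₁ : IsOpen Ω₁) (hΩ₂ : IsOpen Ω₂) (hΩ₁' : Ω₁.Nonempty) (hΩ₂' : Ω₂.Nonempty)
    (hb₁ : Bornology.IsBounded Ω₁) {r₁ : ℕ} (hr₁ : 1 ≤ r₁)
    {V₁ : ℕ → Submodule ℝ (L2 Ω₁)} (hV₁ : IsMultiscale Ω₁ r₁ V₁)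
    {s₁ s₂ : ℝ} (hs₁ : 0 < s₁) (hs₂ : 0 < s₂) {K H : Type*}
    [NormedAddCommGroup K] [InnerProductSpace ℝ K] [NormedAddCommGroup H] [InnerProductSpace ℝ H]
    [CompleteSpace H] {t : L2 Ω₁ →ₗ[ℝ] L2 Ω₂ →ₗ[ℝ] H} (ht : IsCross t)
    {τ : Hs Ω₁ s₁ →ₗ[ℝ] Hs Ω₂ s₂ →ₗ[ℝ] K} (hτ : IsCross τ) {j : K →L[ℝ] H}
    (hj : ∀ x y, j (τ x y) = t (Hs.toL2 Ω₁ s₁ x) (Hs.toL2 Ω₂ s₂ y)) :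
    ∃ c ε₀ : ℝ, 0 < c ∧ 0 < ε₀ ∧ ε₀ ≤ 1 ∧ ∀ ε : ℝ, 0 < ε → ε ≤ ε₀ → ∃ φ : K, ‖φ‖ ≤ 1 ∧
      ∀ (R j₁ : ℕ) (x : ℕ → L2 Ω₁) (y : ℕ → L2 Ω₂), (∀ k < R, x k ∈ V₁ j₁) →
        ‖j φ - ∑ k ∈ Finset.range R, t (x k) (y k)‖ ≤ ε →
        c * (ε ^ (-(1 / (s₁ / n₁ + s₂ / n₂))) * ε ^ (-((n₁ : ℝ) / min s₁ r₁))) ≤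
          R * Module.finrank ℝ (V₁ j₁) := by
  have hs₁' : Fact (0 ≤ s₁) := ⟨hs₁.le⟩
  have hs₂' : Fact (0 ≤ s₂) := ⟨hs₂.le⟩
  have hn₁' : (0 : ℝ) < n₁ := by exact_mod_cast hn₁
  have hn₂' : (0 : ℝ) < n₂ := by exact_mod_cast hn₂
  have hμ : 0 < min s₁ (r₁ : ℝ) := lt_min hs₁ (by exact_mod_cast hr₁)
  obtain ⟨D₁, hD₁, hE₁⟩ := Hs.exists_orthonormal hn₁ hΩ₁ hΩ₁' hs₁
  obtain ⟨D₂, hD₂, hE₂⟩ := Hs.exists_orthonormal hn₂ hΩ₂ hΩ₂' hs₂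
  obtain ⟨q, hq, hfar⟩ := hV₁.exists_far hn₁ hΩ₁ hΩ₁' hb₁ hs₁
  obtain ⟨d, _, hd, _, hdim⟩ := hV₁.exists_dim
  -- The function z₀ is fixed before ε and m, so that its Sobolev norm enters only the constants.
  obtain ⟨z, hz, -, -⟩ := hE₂ 0 1 le_rfl
  set z₀ := z 0 with hz₀
  have hz₀1 : ‖Hs.toL2 Ω₂ s₂ z₀‖ = 1 := hz.1 0
  have hz₀0 : 0 < ‖z₀‖ := by
    rw [norm_pos_iff]
    intro h
    rw [h, map_zero, norm_zero] at hz₀1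
    exact zero_ne_one hz₀1
  set β := s₁ / n₁ + s₂ / n₂ with hβ
  have hβ0 : 0 < β := by positivity
  obtain ⟨c₁, hc₁, hm⟩ := exists_count_ge (c := 1 / (4 * (D₁ * D₂))) (by positivity) hβ0
  obtain ⟨c₂, hc₂, hl⟩ := exists_level_ge (c := q / (2 * ‖z₀‖)) (by positivity) hμ
  refine ⟨c₁ / 2 * (d * c₂ ^ (n₁ : ℝ)), min 1 (min (1 / (4 * (D₁ * D₂))) (q / (2 * ‖z₀‖) / 2)),
    by positivity, by positivity, min_le_left _ _, fun ε hε hεε => ?_⟩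
  obtain ⟨m, hm1, hm2, hm3⟩ := hm ε hε (hεε.trans ((min_le_right _ _).trans (min_le_left _ _)))
  obtain ⟨l, hl1, hl2⟩ := hl ε hε (hεε.trans ((min_le_right _ _).trans (min_le_right _ _)))
  obtain ⟨w, hw, hw'⟩ := hfar l
  obtain ⟨e, he, -, he'⟩ := hE₁ 0 m hm1
  obtain ⟨z', hz', hz'0, hz'b⟩ := hE₂ (Hs.toL2 Ω₂ s₂ z₀) m hm1
  have hm0 : (0 : ℝ) < m := by exact_mod_cast hm1
  have heb : ∀ k, ‖e k‖ ≤ D₁ * (m : ℝ) ^ (s₁ / n₁) := fun k => by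
    classical
    refine le_of_sq_le_sq ?_ (by positivity)
    have := he' (Pi.single k 1)
    simpa [Pi.single_apply, ite_smul] using this
  obtain ⟨φ, hφ, hφ'⟩ := ht.exists_hard_element hτ (i₁ := Hs.toL2L Ω₁ s₁)
    (i₂ := Hs.toL2L Ω₂ s₂) hj hm1 (by positivity) (by positivity) he heb hz' hz'b hz₀1 hz'0 hw hw'
  refine ⟨φ, hφ, fun R j₁ x y hx h => ?_⟩
  obtain ⟨h1, h2⟩ := hφ' R x y ε h
  -- The choice of m makes the bound on m - R equal to at most m/4.
  have hR : (m : ℝ) / 2 ≤ R := by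
    have h3 : D₁ * (m : ℝ) ^ (s₁ / n₁) * (D₂ * (m : ℝ) ^ (s₂ / n₂)) =
        D₁ * D₂ * (m : ℝ) ^ β := by
      rw [hβ, Real.rpow_add hm0]
      ring
    rw [h3] at h1
    have h4 : D₁ * D₂ * (ε * (m : ℝ) ^ β) ≤ 1 / 4 := by
      calc D₁ * D₂ * (ε * (m : ℝ) ^ β) ≤ D₁ * D₂ * (1 / (4 * (D₁ * D₂))) := by gcongr
        _ = 1 / 4 := by field_simp
    have h5 : (D₁ * D₂ * (ε * (m : ℝ) ^ β)) ^ 2 ≤ (1 / 4) ^ 2 := by gcongr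
    have h6 : 4 * (m : ℝ) * (D₁ * D₂ * (m : ℝ) ^ β) ^ 2 * ε ^ 2 =
        4 * m * (D₁ * D₂ * (ε * (m : ℝ) ^ β)) ^ 2 := by ring
    rw [h6] at h1
    nlinarith
  -- By nestedness any level up to l would put the left factors into V₁ l, from which w is too far.
  have hj₁ : l + 1 ≤ j₁ := by
    by_contra hlt
    have h3 : V₁ j₁ ≤ V₁ l := hV₁.nested (by omega)
    have h4 := h2 fun k hk => h3 (hx k hk)
    refine absurd h4 (not_le.mpr (hl1.trans_eq ?_))
    ring
  have hdim' : d * (c₂ ^ (n₁ : ℝ) * ε ^ (-((n₁ : ℝ) / min s₁ r₁))) ≤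
      Module.finrank ℝ (V₁ j₁) := by
    refine le_trans ?_ (hdim j₁).1
    gcongr
    have h3 : (c₂ * ε ^ (-(1 / min s₁ (r₁ : ℝ)))) ^ (n₁ : ℝ) ≤ ((2 : ℝ) ^ j₁) ^ (n₁ : ℝ) := by
      gcongr
      refine hl2.trans ?_
      gcongr
      norm_num
    refine le_trans (le_of_eq ?_) h3
    rw [Real.mul_rpow hc₂.le (by positivity), ← Real.rpow_mul hε.le]
    congr 2
    ring
  calc c₁ / 2 * (d * c₂ ^ (n₁ : ℝ)) * (ε ^ (-(1 / β)) * ε ^ (-((n₁ : ℝ) / min s₁ r₁)))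
      = (c₁ * ε ^ (-(1 / β)) / 2) * (d * (c₂ ^ (n₁ : ℝ) * ε ^ (-((n₁ : ℝ) / min s₁ r₁)))) := by
        ring
    _ ≤ (m / 2) * Module.finrank ℝ (V₁ j₁) := by gcongr
    _ ≤ _ := by gcongr

end LowRank

end

/-! ### The two-sided estimate -/

theorem mainTheorem5 {n₁ n₂ : ℕ} (hn₁ : 0 < n₁) (hn₂ : 0 < n₂)
    (Ω₁ : Set (LowRank.Eucl n₁)) (Ω₂ : Set (LowRank.Eucl n₂))
    (hΩ₁ : IsOpen Ω₁) (hΩ₂ : IsOpen Ω₂) (hΩ₁' : Ω₁.Nonempty) (hΩ₂' : Ω₂.Nonempty)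
    (hb₁ : Bornology.IsBounded Ω₁) (hb₂ : Bornology.IsBounded Ω₂)
    (r₁ r₂ : ℕ) (hr₁ : 1 ≤ r₁) (hr₂ : 1 ≤ r₂)
    (V₁ : ℕ → Submodule ℝ (LowRank.L2 Ω₁)) (V₂ : ℕ → Submodule ℝ (LowRank.L2 Ω₂))
    (hV₁ : LowRank.IsMultiscale Ω₁ r₁ V₁) (hV₂ : LowRank.IsMultiscale Ω₂ r₂ V₂)
    (s₁ s₂ : ℝ) (hs₁ : 0 < s₁) (hs₂ : 0 < s₂) :
    ∃ c C ε₀ : ℝ, 0 < c ∧ 0 < C ∧ 0 < ε₀ ∧ ∀ ε : ℝ, 0 < ε → ε ≤ ε₀ →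
      ENNReal.ofReal (c * (ε ^ (-((n₁ : ℝ) * n₂ / (s₁ * n₂ + s₂ * n₁))) *
          ε ^ (-max ((n₁ : ℝ) / min s₁ r₁) ((n₂ : ℝ) / min s₂ r₂)))) ≤
        ((LowRank.dofSVDFree s₁ s₂ V₁ V₂ ε : ℕ∞) : ℝ≥0∞) ∧
      LowRank.dofSVDFree s₁ s₂ V₁ V₂ ε ≤ LowRank.dofSVD s₁ s₂ V₁ V₂ ε ∧
      ((LowRank.dofSVD s₁ s₂ V₁ V₂ ε : ℕ∞) : ℝ≥0∞) ≤
        ENNReal.ofReal (C * (ε ^ (-((n₁ : ℝ) * n₂ / (s₁ * n₂ + s₂ * n₁))) *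
          ε ^ (-max ((n₁ : ℝ) / min s₁ r₁) ((n₂ : ℝ) / min s₂ r₂)))) := by
  open LowRank in
  have hs₁' : Fact (0 ≤ s₁) := ⟨hs₁.le⟩
  have hs₂' : Fact (0 ≤ s₂) := ⟨hs₂.le⟩
  obtain ⟨C, hC, hup⟩ := exists_le_of_unit_ball hn₁ hn₂ hb₁ hb₂ hr₁ hr₂ hV₁ hV₂ hs₁ hs₂
  have ht := isCross_tensorBilin (volume.restrict Ω₁) (volume.restrict Ω₂)
  have hτ := HMix.isCross_tmul Ω₁ Ω₂ s₁ s₂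
  have hj := HMix.toL2_tmul_eq (Ω₁ := Ω₁) (Ω₂ := Ω₂) hs₁' hs₂'
  have hlow : ∃ c ε₀ : ℝ, 0 < c ∧ 0 < ε₀ ∧ ε₀ ≤ 1 ∧ ∀ ε : ℝ, 0 < ε → ε ≤ ε₀ →
      ∃ φ : HMix Ω₁ Ω₂ s₁ s₂, ‖φ‖ ≤ 1 ∧
      ∀ N ∈ discreteSVDDofs (fun V _ w => w ∈ V) (fun V _ w => w ∈ V) V₁ V₂
        (HMix.toL2 Ω₁ Ω₂ s₁ s₂ φ) ε,
        c * (ε ^ (-((n₁ : ℝ) * n₂ / (s₁ * n₂ + s₂ * n₁))) *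
          ε ^ (-max ((n₁ : ℝ) / min s₁ r₁) ((n₂ : ℝ) / min s₂ r₂))) ≤ N := by
    rw [rate_exponent_eq hn₁ hn₂ hs₁ hs₂]
    -- The variable attaining the maximum takes the left role; in the second case both tensor
    -- products are flipped.
    rcases le_total ((n₂ : ℝ) / min s₂ r₂) ((n₁ : ℝ) / min s₁ r₁) with hmax | hmax
    · rw [max_eq_left hmax]
      obtain ⟨c, ε₀, hc, hε₀, hε₁, h⟩ := exists_hard_of_left hn₁ hn₂ hΩ₁ hΩ₂ hΩ₁' hΩ₂' hb₁ hr₁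
        hV₁ hs₁ hs₂ ht hτ hj
      refine ⟨c, ε₀, hc, hε₀, hε₁, fun ε hε hεε => ?_⟩
      obtain ⟨φ, hφ, hφ'⟩ := h ε hε hεε
      refine ⟨φ, hφ, ?_⟩
      rintro N ⟨R, j₁, j₂, σ, u, u', v, v', -, h₁, -, h₃, rfl⟩
      -- The singular values are absorbed into the left factors, which stay in the same subspace;
      -- the dimension of the other space is then dropped.
      have h4 := hφ' R j₁ (fun k => σ k • u' k) v'
        (fun k hk => Submodule.smul_mem _ _ (h₁ k hk)) (by
          simp only [map_smul, LinearMap.smul_apply]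
          exact h₃)
      refine h4.trans ?_
      push_cast
      gcongr
      simp
    · rw [max_eq_right hmax, add_comm (s₁ / (n₁ : ℝ))]
      obtain ⟨c, ε₀, hc, hε₀, hε₁, h⟩ := exists_hard_of_left hn₂ hn₁ hΩ₂ hΩ₁ hΩ₂' hΩ₁' hb₂ hr₂
        hV₂ hs₂ hs₁ ht.flip hτ.flip (fun x y => hj y x)
      refine ⟨c, ε₀, hc, hε₀, hε₁, fun ε hε hεε => ?_⟩
      obtain ⟨φ, hφ, hφ'⟩ := h ε hε hεε
      refine ⟨φ, hφ, ?_⟩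
      rintro N ⟨R, j₁, j₂, σ, u, u', v, v', -, -, h₁, h₃, rfl⟩
      have h4 := hφ' R j₂ (fun k => σ k • v' k) u'
        (fun k hk => Submodule.smul_mem _ _ (h₁ k hk)) (by
          simp only [map_smul]
          exact h₃)
      refine h4.trans ?_
      push_cast
      gcongr
      simp
  obtain ⟨c, ε₀, hc, hε₀, hε₁, hlow⟩ := hlow
  refine ⟨c, C, ε₀, hc, hC, hε₀, fun ε hε hεε => ⟨?_, dofSVDFree_le_dofSVD _ _ _ _ _, ?_⟩⟩
  · obtain ⟨φ, hφ, hφ'⟩ := hlow ε hε hεε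
    set B := c * (ε ^ (-((n₁ : ℝ) * n₂ / (s₁ * n₂ + s₂ * n₁))) *
          ε ^ (-max ((n₁ : ℝ) / min s₁ r₁) ((n₂ : ℝ) / min s₂ r₂))) with hB
    have h1 : (⌈B⌉₊ : ℕ∞) ≤ dofSVDFree s₁ s₂ V₁ V₂ ε :=
      le_iSup₂_of_le φ hφ (le_iInf₂ fun N hN => by
        exact_mod_cast Nat.ceil_le.mpr (hφ' N hN))
    have h2 : ENNReal.ofReal B ≤ (((⌈B⌉₊ : ℕ) : ℕ∞) : ℝ≥0∞) := by
      rw [ENat.toENNReal_coe, ← ENNReal.ofReal_natCast]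
      exact ENNReal.ofReal_le_ofReal (Nat.le_ceil B)
    exact h2.trans (ENat.toENNReal_le.mpr h1)
  · set B := C * (ε ^ (-((n₁ : ℝ) * n₂ / (s₁ * n₂ + s₂ * n₁))) *
          ε ^ (-max ((n₁ : ℝ) / min s₁ r₁) ((n₂ : ℝ) / min s₂ r₂))) with hB
    have hB0 : 0 ≤ B := by positivity
    have h1 : dofSVD s₁ s₂ V₁ V₂ ε ≤ (⌊B⌋₊ : ℕ∞) := iSup₂_le fun φ hφ => by
      obtain ⟨N, hN, hN'⟩ := hup ε hε (hεε.trans hε₁) φ hφ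
      refine iInf₂_le_of_le N hN ?_
      exact Nat.cast_le.mpr (Nat.le_floor hN')
    have h2 : (((⌊B⌋₊ : ℕ) : ℕ∞) : ℝ≥0∞) ≤ ENNReal.ofReal B := by
      rw [ENat.toENNReal_coe, ← ENNReal.ofReal_natCast]
      exact ENNReal.ofReal_le_ofReal (Nat.floor_le hB0)
    exact (ENat.toENNReal_le.mpr h1).trans h2
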